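/- Let $n\ge 11$ be odd and $F(2,n)=\langle x_1,\dots,x_n \mid x_ix_{i+1}=x_{i+2}\ (i \bmod n)\rangle$. Let $K$ be a van Kampen diagram over this presentation (a finite connected plane diagram with directed edges labelled by the $x_i$, all of whose bounded faces are triangles with boundary label $x_ix_{i+1}x_{i+2}^{-1}$ for some $i$, read in one of the two directions). A vertex is interior if it does not lie on the outer face; degrees are counted by edge ends. *Conventions.* A triangle has vertices $B,A,C$ and edges $B\to A$, $A\to C$, $B\to C$ labelled $x_{i},x_{i+1},x_{i+2}$. At $B$, the edges $BA$, $BC$ are consecutive outward edges, $BA$ first and $BC$ second; at $C$, the edges $BC$, $AC$ are consecutive inward edges, $BC$ first and $AC$ second. This orders each maximal sequence of consecutive outward (inward) edges at a vertex, consecutive meaning separated by a corner of a bounded face; the sequence then has a first and a last edge, unless it closes up around the vertex. An outward and an inward sequence which together make up all edges of a vertex have the same orientation if, around the vertex, the first inward edge is next to the last outward edge and the last inward edge is next to the first outward edge; they have opposite orientation if the two last edges are next to each other and the two first edges are next to each other. *Reduced.* $K$ is reduced if no two bounded faces carrying the same relator share an edge. *Spherically reduced.* Let $SD_n$ be the triangulated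 sphere with vertices $N$, $S$, $V_a$, $E_a$ ($a\in\mathbb Z/n$) and $4n$ triangles $(N;V_{a-2},V_a)$, $(V_a;E_a,V_{a+2})$, $(E_{a-2};V_a,E_a)$, $(S;E_{a-2},E_a)$, where $(B;A,C)$ denotes a triangle as above, with $i=a-2,\ a-1,\ a-2,\ a-1$, respectively. $K$ is spherically reduced if it contains no subdiagram that matches a simply connected subdiagram $T$ of $SD_n$ with more than $2n$ faces. Here $T$ is a set of faces that is connected through common edges and for which the union of the other closed faces is connected; a match is an injective, label-preserving map from $T$ to the bounded faces of $K$ that takes every common edge of two faces of $T$ to the corresponding common edge of their images. *Colours.* A 5 vertex is an interior vertex of degree 5; in a reduced $K$ it has three inward edges and two outward edges, in the same orientation. Each 5 vertex $V$ colours edges as follows. - The middle inward edge of $V$ is blue if the first inward edge $VB$ of $V$ is, at $B$, the second outward edge of a sequence of outward edges. - The last outward edge $VA$ of $V$ is green if the middle inward edge of $V$ is not coloured blue and $A$ is not a 5 vertex. - The first inward edge $VB$ of $V$ is yellow if $V$ colours no edge blue or green and $VB$ is, at $B$, the middle one of five consecutive outward edges. All other edges are uncoloured. A deg-6 (deg-7)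 vertex is an interior vertex attached to exactly 6 (at least 7) uncoloured edges. **Lemma 4.** Let $K$ be reduced and spherically reduced. Then every interior vertex $v$ of $K$ is a 5 vertex, or a deg-7 vertex, or a deg-6 vertex of one of the following five types, in which all edges not said to be coloured are uncoloured: - GG: three outward edges and five inward edges in the same orientation, where the second and the fourth inward edge are green; - YB: $o=(n+1)/2$ outward edges and two inward edges in opposite orientation, where outward edges number $3,\dots,o-3$ are yellow and the last outward edge is blue; - Y+: $o=(n+1)/2$ outward edges and two inward edges in opposite orientation, where outward edges number $3,\dots,o-2$ are yellow; - Y−: $o=(n+3)/2$ outward edges and two inward edges in the same orientation, where outward edges number $3,\dots,o-2$ are yellow; - 5G: $n=11$, and $v$ has degree 11 with all edges inward, of which five are green, no two of these being consecutive. -/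

import Mathlib

namespace Fibonacci

/-! ### The presentation -/

/-- The relator `x_i x_{i+1} x_{i+2}⁻¹` of `F(2,n)`, as a word in signed letters. -/
def relator {n : ℕ} (i : ZMod n) : List (ZMod n × Bool) :=
  [(i, true), (i + 1, true), (i + 2, false)]

/-! ### Labelled planar maps

A finite map on an oriented surface is given by its darts (oriented edges): `rot d` is the next dart
anticlockwise around the initial vertex of `d`, and `rev d` is `d` traversed backwards. The *corner*
of `d` is the angle between `d` and `rot d`; it belongs to the face on the left of `d`. -/

structure LabelledMap (n : ℕ) where
  Dart : Type
  finite_dart : Finite Dart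
  rot : Equiv.Perm Dart
  rev : Equiv.Perm Dart
  rev_rev : ∀ d, rev (rev d) = d
  rev_ne : ∀ d, rev d ≠ d
  /-- `(i, true)` if `d` runs along the arrow of an edge labelled `x_i`, `(i, false)` if it runs
  against the arrow. -/
  letter : Dart → ZMod n × Bool
  letter_rev : ∀ d, letter (rev d) = ((letter d).1, !(letter d).2)
  /-- A dart on the boundary of the outer (unbounded) face. -/
  outer : Dart

namespace LabelledMap

variable {n : ℕ} (M : LabelledMap n)

/-- The next dart along the boundary of the face on the left. -/
def face : Equiv.Perm M.Dart := M.rot⁻¹ * M.rev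

abbrev Vertex : Type := Quotient (Equiv.Perm.SameCycle.setoid M.rot)
abbrev Edge : Type := Quotient (Equiv.Perm.SameCycle.setoid M.rev)
abbrev Face : Type := Quotient (Equiv.Perm.SameCycle.setoid M.face)

/-- The initial vertex of a dart. -/
def origin (d : M.Dart) : M.Vertex := Quotient.mk _ d

/-- The face on the left of `d` is not the outer face. -/
def Inner (d : M.Dart) : Prop := ¬ M.face.SameCycle M.outer d

/-- The first three letters of the boundary word of the face on the left of `d`, from `d` on. -/
def word (d : M.Dart) : List (ZMod n × Bool) :=
  [M.letter d, M.letter (M.face d), M.letter (M.face (M.face d))]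

/-- The triangular face on the left of `d` is labelled, in one of the two directions, by the
`i`-th relator. -/
def FaceLabel (d : M.Dart) (i : ZMod n) : Prop :=
  M.word d ~r relator i ∨ M.word d ~r FreeGroup.invRev (relator i)

end LabelledMap

/-- A van Kampen diagram over the presentation of `F(2,n)`: a finite connected plane map with a
distinguished outer face, in which every other face is a triangle labelled by a relator. (The
diagram consisting of a single point, which has no interior vertex, is not represented.) -/
structure VanKampenDiagram (n : ℕ) extends LabelledMap n where
  connected : ∀ d e : Dart, Relation.ReflTransGen (fun x y => y = rot x ∨ y = rev x) d e
  euler : Nat.card toLabelledMap.Vertex + Nat.card toLabelledMap.Face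
    = Nat.card toLabelledMap.Edge + 2
  triangle : ∀ d, toLabelledMap.Inner d →
    toLabelledMap.face (toLabelledMap.face (toLabelledMap.face d)) = d ∧
      ∃ i, toLabelledMap.FaceLabel d i

namespace LabelledMap

variable {n : ℕ} (M : LabelledMap n)

/-- No two identically labelled faces share an edge. -/
def Reduced : Prop :=
  ∀ d, M.Inner d → M.Inner (M.rev d) → ∀ i, ¬ (M.FaceLabel d i ∧ M.FaceLabel (M.rev d) i)

/-- `d` points away from its initial vertex in the sense of the arrow on its edge; otherwise `d`
represents an inward edge of its initial vertex. -/
def Outward (d : M.Dart) : Prop := (M.letter d).2 = true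

/-! ### Vertices and sequences of edges -/

/-- No corner of `v` lies in the outer face. -/
def Interior (v : M.Vertex) : Prop := ∀ d, M.origin d = v → M.Inner d

noncomputable def degree (v : M.Vertex) : ℕ := {d | M.origin d = v}.ncard

/-- An interior vertex of degree 5. -/
def IsFive (v : M.Vertex) : Prop := M.Interior v ∧ M.degree v = 5

/-- `a` and `b` bound a common corner, not in the outer face, at their common initial vertex. -/
def Consecutive (a b : M.Dart) : Prop :=
  (M.rot a = b ∧ M.Inner a) ∨ (M.rot b = a ∧ M.Inner b)

/-- `a`, `b` are the first and the second outward edge of a face corner (labels `x_{i-1}` and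
`x_{i+1}`). -/
def OutNext (a b : M.Dart) : Prop :=
  M.Consecutive a b ∧ M.Outward a ∧ M.Outward b ∧ (M.letter b).1 = (M.letter a).1 + 2

/-- `a`, `b` are the first and the second inward edge of a face corner (labels `x_{i+1}` and
`x_i`). -/
def InNext (a b : M.Dart) : Prop :=
  M.Consecutive a b ∧ ¬ M.Outward a ∧ ¬ M.Outward b ∧ (M.letter b).1 = (M.letter a).1 - 1

def FirstOut (a : M.Dart) : Prop := M.Outward a ∧ ∀ y, ¬ M.OutNext y a
def LastOut (a : M.Dart) : Prop := M.Outward a ∧ ∀ y, ¬ M.OutNext a y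
def FirstIn (a : M.Dart) : Prop := ¬ M.Outward a ∧ ∀ y, ¬ M.InNext y a
def LastIn (a : M.Dart) : Prop := ¬ M.Outward a ∧ ∀ y, ¬ M.InNext a y

/-! ### Colours

`BlueAt c`, `GreenAt a`, `YellowAt b`: the edge of the dart receives the colour because of the
5 vertex that is the initial vertex of the dart. -/

/-- `c` is the middle inward edge of a 5 vertex whose first inward edge `b` is, at its other end,
the second outward edge of a sequence of outward edges. -/
def BlueAt (c : M.Dart) : Prop :=
  M.IsFive (M.origin c) ∧ ∃ b d, M.FirstIn b ∧ M.InNext b c ∧ M.InNext c d ∧ M.LastIn d ∧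
    ∃ z, M.FirstOut z ∧ M.OutNext z (M.rev b)

/-- `a` is the last outward edge of a 5 vertex without blue edge, and its other end is not a
5 vertex. -/
def GreenAt (a : M.Dart) : Prop :=
  M.IsFive (M.origin a) ∧ M.LastOut a ∧ (∀ c, M.origin c = M.origin a → ¬ M.BlueAt c) ∧
    ¬ M.IsFive (M.origin (M.rev a))

/-- `b` is the first inward edge of a 5 vertex without blue or green edge, and at its other end it
is the middle one of five consecutive outward edges. -/
def YellowAt (b : M.Dart) : Prop :=
  M.IsFive (M.origin b) ∧ M.FirstIn b ∧
    (∀ c, M.origin c = M.origin b → ¬ M.BlueAt c ∧ ¬ M.GreenAt c) ∧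
    ∃ p q s t, M.OutNext p q ∧ M.OutNext q (M.rev b) ∧ M.OutNext (M.rev b) s ∧ M.OutNext s t

def Blue (d : M.Dart) : Prop := M.BlueAt d ∨ M.BlueAt (M.rev d)
def Green (d : M.Dart) : Prop := M.GreenAt d ∨ M.GreenAt (M.rev d)
def Yellow (d : M.Dart) : Prop := M.YellowAt d ∨ M.YellowAt (M.rev d)
def Uncoloured (d : M.Dart) : Prop := ¬ M.Blue d ∧ ¬ M.Green d ∧ ¬ M.Yellow d

/-- The number of uncoloured edges attached to `v`. -/
noncomputable def uncolouredDegree (v : M.Vertex) : ℕ :=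
  {d | M.origin d = v ∧ M.Uncoloured d}.ncard

def IsDegSix (v : M.Vertex) : Prop := M.Interior v ∧ M.uncolouredDegree v = 6
def IsDegSeven (v : M.Vertex) : Prop := M.Interior v ∧ 7 ≤ M.uncolouredDegree v

/-! ### The five special configurations

Around `v`, in one of the two directions `r` of rotation, we meet `a, r a, r (r a), …`. -/

/-- `v` consists of `o` outward edges, met from the first to the last, followed by `i` inward edges,
met from the first to the last. -/
structure SameOriented (v : M.Vertex) (r : Equiv.Perm M.Dart) (a : M.Dart) (o i : ℕ) : Prop where
  dir : r = M.rot ∨ r = M.rot⁻¹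
  base : M.origin a = v
  deg : M.degree v = o + i
  outs : ∀ k, k + 1 < o → M.OutNext ((r ^ k) a) ((r ^ (k + 1)) a)
  ins : ∀ k, o ≤ k → k + 1 < o + i → M.InNext ((r ^ k) a) ((r ^ (k + 1)) a)

/-- `v` consists of `o` outward edges, met from the first to the last, followed by `i` inward edges,
met from the last to the first. -/
structure OppOriented (v : M.Vertex) (r : Equiv.Perm M.Dart) (a : M.Dart) (o i : ℕ) : Prop where
  dir : r = M.rot ∨ r = M.rot⁻¹
  base : M.origin a = v
  deg : M.degree v = o + i
  outs : ∀ k, k + 1 < o → M.OutNext ((r ^ k) a) ((r ^ (k + 1)) a)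
  ins : ∀ k, o ≤ k → k + 1 < o + i → M.InNext ((r ^ (k + 1)) a) ((r ^ k) a)

/-- Three outward and five inward edges in the same orientation; the second and the fourth inward
edge are green. -/
def IsGG (v : M.Vertex) : Prop :=
  ∃ r a, M.SameOriented v r a 3 5 ∧ M.Green ((r ^ 4) a) ∧ M.Green ((r ^ 6) a) ∧
    ∀ k < 8, k ≠ 4 → k ≠ 6 → M.Uncoloured ((r ^ k) a)

/-- `o = (n+1)/2` outward edges and two inward edges in opposite orientation; outward edges number
`3, …, o-3` are yellow and the last outward edge is blue. -/
def IsYB (v : M.Vertex) : Prop :=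
  ∃ r a o, 2 * o = n + 1 ∧ M.OppOriented v r a o 2 ∧
    (∀ k, 2 ≤ k → k + 4 ≤ o → M.Yellow ((r ^ k) a)) ∧ M.Blue ((r ^ (o - 1)) a) ∧
    ∀ k < o + 2, k < 2 ∨ k + 3 = o ∨ k + 2 = o ∨ o ≤ k → M.Uncoloured ((r ^ k) a)

/-- `o = (n+1)/2` outward edges and two inward edges in opposite orientation; outward edges number
`3, …, o-2` are yellow. -/
def IsYPlus (v : M.Vertex) : Prop :=
  ∃ r a o, 2 * o = n + 1 ∧ M.OppOriented v r a o 2 ∧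
    (∀ k, 2 ≤ k → k + 3 ≤ o → M.Yellow ((r ^ k) a)) ∧
    ∀ k < o + 2, k < 2 ∨ o ≤ k + 2 → M.Uncoloured ((r ^ k) a)

/-- `o = (n+3)/2` outward edges and two inward edges in the same orientation; outward edges number
`3, …, o-2` are yellow. -/
def IsYMinus (v : M.Vertex) : Prop :=
  ∃ r a o, 2 * o = n + 3 ∧ M.SameOriented v r a o 2 ∧
    (∀ k, 2 ≤ k → k + 3 ≤ o → M.Yellow ((r ^ k) a)) ∧
    ∀ k < o + 2, k < 2 ∨ o ≤ k + 2 → M.Uncoloured ((r ^ k) a)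

/-- `n = 11`, and `v` is attached to eleven edges, all inward, five of which are green, no two of
these consecutive. -/
def IsFiveG (v : M.Vertex) : Prop :=
  n = 11 ∧ ∃ r a, (r = M.rot ∨ r = M.rot⁻¹) ∧ M.origin a = v ∧ M.degree v = 11 ∧
    (∀ k, M.InNext ((r ^ k) a) ((r ^ (k + 1)) a)) ∧
    ∀ k < 11, (Odd k → M.Green ((r ^ k) a)) ∧ (Even k → M.Uncoloured ((r ^ k) a))

end LabelledMap

/-! ### The spherical diagram `SDn`

Its vertices are two poles of degree `n` and `2n` vertices of degree 5. The outward edge of the north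
pole labelled `x_a` ends at `upper a`; `lower a` is the end of the edge labelled `x_{a-1}` that
starts at `upper a`. -/

inductive SDVertex (n : ℕ) : Type
  | north : SDVertex n
  | south : SDVertex n
  | upper : ZMod n → SDVertex n
  | lower : ZMod n → SDVertex n

/-- The `4n` triangles, in four rings from the north to the south pole. -/
inductive SDFace (n : ℕ) : Type
  | cap : ZMod n → SDFace n
  | upperBelt : ZMod n → SDFace n
  | lowerBelt : ZMod n → SDFace n
  | base : ZMod n → SDFace n

namespace SDFace

variable {n : ℕ}

/-- The corners `B, A, C` of a triangle with edges `B → A`, `A → C`, `B → C`, which carry the labels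
`x_i`, `x_{i+1}`, `x_{i+2}`. -/
def corner : SDFace n → Fin 3 → SDVertex n
  | cap a => ![.north, .upper (a - 2), .upper a]
  | upperBelt a => ![.upper a, .lower a, .upper (a + 2)]
  | lowerBelt a => ![.lower (a - 2), .upper a, .lower a]
  | base a => ![.south, .lower (a - 2), .lower a]

/-- The `i` of the relator `x_i x_{i+1} x_{i+2}⁻¹` on the triangle. -/
def index : SDFace n → ZMod n
  | cap a => a - 2
  | upperBelt a => a - 1
  | lowerBelt a => a - 2
  | base a => a - 1

/-- The initial and the final vertex of the three edges, in the order `x_i`, `x_{i+1}`, `x_{i+2}`. -/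
def edge (f : SDFace n) : Fin 3 → SDVertex n × SDVertex n :=
  ![(f.corner 0, f.corner 1), (f.corner 1, f.corner 2), (f.corner 0, f.corner 2)]

/-- Two faces are joined if they share an edge. -/
def edgeGraph (n : ℕ) : SimpleGraph (SDFace n) :=
  SimpleGraph.fromRel fun f g => ∃ p q, f.edge p = g.edge q

/-- Two faces are joined if they share a vertex. -/
def vertexGraph (n : ℕ) : SimpleGraph (SDFace n) :=
  SimpleGraph.fromRel fun f g => ∃ p q, f.corner p = g.corner q

/-- A simply connected subdiagram, given by its set of faces: it is connected through edges, and the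
union of the remaining (closed) faces of the sphere is connected. -/
def IsSubdiagram (T : Finset (SDFace n)) : Prop :=
  ((edgeGraph n).induce (T : Set (SDFace n))).Preconnected ∧
    ((vertexGraph n).induce ((T : Set (SDFace n))ᶜ)).Preconnected

end SDFace

namespace LabelledMap

variable {n : ℕ} (M : LabelledMap n)

/-- `s` is the corner between the two outward edges of a non-outer triangle. Each such triangle
has exactly one such corner, by which we represent it. -/
def IsSource (s : M.Dart) : Prop := M.Inner s ∧ M.Outward s ∧ M.Outward (M.rot s)

open Classical in
/-- The darts, with the triangle represented by `s` on their left, on the edges labelled `x_i`,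
`x_{i+1}`, `x_{i+2}` of this triangle. -/
noncomputable def side (s : M.Dart) : Fin 3 → M.Dart :=
  if M.Outward (M.face s) then ![s, M.face s, M.face (M.face s)]
  else ![M.face (M.face s), M.face s, s]

/-- The set `T` of faces of `SDn` occurs in the diagram: there is an injective label-preserving map
to the faces of the diagram under which every common edge of two faces of `T` becomes the
corresponding common edge of their images. -/
def Matches (T : Finset (SDFace n)) : Prop :=
  ∃ m : SDFace n → M.Dart, Set.InjOn m T ∧
    (∀ f ∈ T, M.IsSource (m f) ∧ M.FaceLabel (m f) f.index) ∧
    ∀ f ∈ T, ∀ g ∈ T, f ≠ g → ∀ p q, f.edge p = g.edge q →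
      M.side (m f) p = M.rev (M.side (m g) q)

/-- No subdiagram matches a subdiagram of `SDn` with more than half of its `4n` faces. -/
def SphericallyReduced : Prop :=
  ∀ T : Finset (SDFace n), SDFace.IsSubdiagram T → 2 * n < T.card → ¬ M.Matches T

end LabelledMap

end Fibonacci

/-!
Around an interior vertex of a reduced diagram, an edge and its two neighbours carry letters
such that those of the neighbours differ, and every corner changes the letter in one of three ways: by
`±2` between outward edges, by `±1` between inward edges (`OutNext`, `InNext`), and from the inward
letter `x_i` to the outward letter `x_{i+1}` or back (`Spoke`). In other words, the letters around the
vertex form a closed walk without backtracking in a generalized Petersen graph with parameters `n`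
and `2`. So the edges fall into alternating outward and inward sequences of at least two edges, each
with monotone labels, and the label shifts around the vertex add up to zero modulo `n`. The 5 vertices
are the shortest such walks (`exists_star`).

At a vertex which is not a 5 vertex, every coloured edge is coloured by the 5 vertex at its other end,
and the triangles around this 5 vertex restrict the position of the edge. Green edges are inward
edges in the interior of a sequence, no two of them consecutive. A blue edge is the last edge of an
outward sequence that is followed by the last edge of an inward sequence. A yellow edge has at least two
further edges of its outward sequence on both sides, and both it and the next edge end as first inward
edges of 5 vertices (`exists_chain_of_yellowAt`). Therefore an inward sequence of length `i` has at
least `(i + 1) / 2` uncoloured edges (`le_uncolouredCount_inward`), and an outward sequence has four or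
as many as its length permits, except that a blue edge may save one. A count leaves only
the listed types, unless an outward sequence is long (`cases_of_mixed`, `of_all_inward`).

An outward sequence of about `n` edges, nearly all of them yellow, looks like the surroundings of a
pole of `SDn`: its triangles are the caps, and the triangles at the 5 vertices at the ends of its edges
belong to the two belts. The resulting part of `SDn` has more than `2n` faces, against spherical
reducedness (`card_le_of_sphericallyReduced`). This bounds the outward sequences by less than `n` edges
in the types with yellow edges (`not_all_yellow`) and deals with vertices that have outward edges only
(`seven_le_of_all_outward`).
-/

namespace Fibonacci

/-! ### Corners and triangles -/

lemma natCast_ne_zero {n k : ℕ} (hk : 0 < k) (hkn : k < n) : (k : ZMod n) ≠ 0 := by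
  intro h
  rw [ZMod.natCast_eq_zero_iff] at h
  exact absurd (Nat.le_of_dvd hk h) (by omega)

namespace LabelledMap

variable {n : ℕ} (M : LabelledMap n)

/-- `a` and `b` bound a common corner, not in the outer face, and `b` follows `a` anticlockwise
(`t = true`) or clockwise (`t = false`). -/
def Corner (t : Bool) (a b : M.Dart) : Prop :=
  match t with
  | true => M.rot a = b ∧ M.Inner a
  | false => M.rot b = a ∧ M.Inner b

/-- The inward edge `i` and the outward edge `o` bound a common corner (labels `x_i`, `x_{i+1}`):
a corner of the third kind, besides those of `OutNext` and `InNext`. -/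
def Spoke (i o : M.Dart) : Prop :=
  M.Consecutive i o ∧ ¬ M.Outward i ∧ M.Outward o ∧ (M.letter o).1 = (M.letter i).1 + 1

/-- A triangular face with edges `x : B → A`, `y : A → C`, `z : B → C`. The flag `t` records on
which side of its edges the face lies: anticlockwise from `x` to `z` around `B` if `t = true`,
clockwise if `t = false`. -/
structure Triangle (t : Bool) (x y z : M.Dart) : Prop where
  source : M.Corner t x z
  middle : M.Corner t y (M.rev x)
  target : M.Corner t (M.rev z) (M.rev y)
  letter_x : M.letter x = ((M.letter x).1, true)
  letter_y : M.letter y = ((M.letter x).1 + 1, true)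
  letter_z : M.letter z = ((M.letter x).1 + 2, true)

variable {M}

lemma corner_not {t : Bool} {a b : M.Dart} : M.Corner (!t) a b ↔ M.Corner t b a := by
  cases t <;> exact Iff.rfl

lemma Corner.symm {t : Bool} {a b : M.Dart} (h : M.Corner t a b) : M.Corner (!t) b a :=
  corner_not.2 h

lemma Corner.consecutive {t : Bool} {a b : M.Dart} (h : M.Corner t a b) : M.Consecutive a b := by
  cases t
  · exact Or.inr h
  · exact Or.inl h

lemma Consecutive.exists_corner {a b : M.Dart} (h : M.Consecutive a b) :
    ∃ t, M.Corner t a b := by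
  rcases h with h | h
  · exact ⟨true, h⟩
  · exact ⟨false, h⟩

lemma Consecutive.symm {a b : M.Dart} (h : M.Consecutive a b) : M.Consecutive b a := Or.symm h

lemma Corner.right_unique {t : Bool} {a b c : M.Dart} (h : M.Corner t a b) (h' : M.Corner t a c) :
    b = c := by
  cases t
  · exact M.rot.injective (h.1.trans h'.1.symm)
  · exact h.1.symm.trans h'.1

lemma Corner.left_unique {t : Bool} {a b c : M.Dart} (h : M.Corner t a c) (h' : M.Corner t b c) :
    a = b :=
  h.symm.right_unique h'.symm

/-- A dart has at most two neighbours around its initial vertex. -/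
lemma Consecutive.pigeonhole {d a b c : M.Dart} (ha : M.Consecutive d a) (hb : M.Consecutive d b)
    (hc : M.Consecutive d c) : a = b ∨ a = c ∨ b = c := by
  obtain ⟨s, hs⟩ := ha.exists_corner
  obtain ⟨t, ht⟩ := hb.exists_corner
  obtain ⟨u, hu⟩ := hc.exists_corner
  by_cases hst : s = t
  · subst hst; exact Or.inl (hs.right_unique ht)
  by_cases hsu : s = u
  · subst hsu; exact Or.inr (Or.inl (hs.right_unique hu))
  have : t = u := by cases s <;> cases t <;> cases u <;> simp_all
  subst this; exact Or.inr (Or.inr (ht.right_unique hu))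

lemma Consecutive.origin_eq {a b : M.Dart} (h : M.Consecutive a b) : M.origin a = M.origin b := by
  have key : ∀ x : M.Dart, M.origin x = M.origin (M.rot x) := fun x =>
    Quotient.sound (s := Equiv.Perm.SameCycle.setoid M.rot) (Equiv.Perm.sameCycle_apply_right.2
      (Equiv.Perm.SameCycle.refl _ _))
  rcases h with ⟨h, -⟩ | ⟨h, -⟩
  · rw [← h]; exact key a
  · rw [← h]; exact (key b).symm

lemma outward_iff {d : M.Dart} : M.Outward d ↔ M.letter d = ((M.letter d).1, true) := by
  unfold Outward
  constructor
  · intro h; ext <;> simp [h]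
  · intro h; rw [h]

lemma not_outward_iff {d : M.Dart} : ¬ M.Outward d ↔ M.letter d = ((M.letter d).1, false) := by
  unfold Outward
  constructor
  · intro h; ext <;> simp_all
  · intro h; rw [h]; simp

lemma outward_rev {d : M.Dart} : M.Outward (M.rev d) ↔ ¬ M.Outward d := by
  simp [Outward, M.letter_rev]

lemma label_rev {d : M.Dart} : (M.letter (M.rev d)).1 = (M.letter d).1 := by
  simp [M.letter_rev]

lemma inner_face {d : M.Dart} : M.Inner (M.face d) ↔ M.Inner d := by
  unfold Inner
  rw [Equiv.Perm.sameCycle_apply_right]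

lemma face_eq_iff {a b : M.Dart} : M.face a = b ↔ M.rot b = M.rev a := by
  simp only [face, Equiv.Perm.mul_apply]
  rw [Equiv.Perm.inv_eq_iff_eq]
  exact eq_comm

namespace Triangle

variable {t : Bool} {x y z : M.Dart}

/-- The dart which represents the face: it spans, with the next dart anticlockwise, the corner
between the two outward edges. -/
def src (t : Bool) (x z : M.Dart) : M.Dart := bif t then x else z

lemma outNext (h : M.Triangle t x y z) : M.OutNext x z :=
  ⟨h.source.consecutive, outward_iff.2 h.letter_x, by rw [Outward, h.letter_z],
    by rw [h.letter_z]⟩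

lemma spoke (h : M.Triangle t x y z) : M.Spoke (M.rev x) y :=
  ⟨h.middle.consecutive.symm, by rw [outward_rev, not_not]; exact outward_iff.2 h.letter_x,
    by rw [Outward, h.letter_y], by rw [h.letter_y, label_rev]⟩

lemma inNext (h : M.Triangle t x y z) : M.InNext (M.rev z) (M.rev y) :=
  ⟨h.target.consecutive, by rw [outward_rev, not_not, Outward, h.letter_z],
    by rw [outward_rev, not_not, Outward, h.letter_y],
    by rw [label_rev, label_rev, h.letter_y, h.letter_z]; ring⟩

lemma face_src (h : M.Triangle t x y z) : M.face (src t x z) = bif t then y else M.rev y := by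
  rw [face_eq_iff]
  cases t
  · exact h.target.1
  · exact h.middle.1

lemma face_face_src (h : M.Triangle t x y z) :
    M.face (M.face (src t x z)) = bif t then M.rev z else M.rev x := by
  rw [h.face_src, face_eq_iff]
  cases t
  · exact h.middle.1.trans (M.rev_rev _).symm
  · exact h.target.1

lemma face_face_face_src (h : M.Triangle t x y z) :
    M.face (M.face (M.face (src t x z))) = src t x z := by
  rw [h.face_face_src, face_eq_iff]
  cases t
  · exact h.source.1.trans (M.rev_rev _).symm
  · exact h.source.1.trans (M.rev_rev _).symm

lemma isSource (h : M.Triangle t x y z) : M.IsSource (src t x z) := by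
  have hx : M.Outward x := outward_iff.2 h.letter_x
  have hz : M.Outward z := by rw [Outward, h.letter_z]
  cases t
  · exact ⟨h.source.2, hz, by rw [src, cond_false, h.source.1]; exact hx⟩
  · exact ⟨h.source.2, hx, by rw [src, cond_true, h.source.1]; exact hz⟩

lemma outward_face_src (h : M.Triangle t x y z) : M.Outward (M.face (src t x z)) ↔ t = true := by
  have hy : M.Outward y := by rw [Outward, h.letter_y]
  rw [h.face_src]
  cases t
  · simp [outward_rev, hy]
  · simp [hy]

lemma side_src (h : M.Triangle t x y z) : M.side (src t x z) =
    bif t then ![x, y, M.rev z] else ![M.rev x, M.rev y, z] := by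
  unfold side
  rw [h.face_face_src, h.face_src]
  have hy : M.Outward y := by rw [Outward, h.letter_y]
  cases t
  · simp [outward_rev, hy, src]
  · simp [hy, src]

lemma word_src (h : M.Triangle t x y z) : M.word (src t x z) =
    bif t then relator (M.letter x).1 else FreeGroup.invRev (relator (M.letter x).1) := by
  unfold word
  rw [h.face_face_src, h.face_src]
  cases t
  · simp [relator, FreeGroup.invRev, src, M.letter_rev, h.letter_z, h.letter_y]
    rw [h.letter_x]
  · simp [relator, src, M.letter_rev, h.letter_z, h.letter_y]
    exact h.letter_x

lemma faceLabel_src (h : M.Triangle t x y z) : M.FaceLabel (src t x z) (M.letter x).1 := by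
  unfold FaceLabel
  rw [h.word_src]
  cases t
  · exact Or.inr (List.IsRotated.refl _)
  · exact Or.inl (List.IsRotated.refl _)

/-- The three sides of a triangle are determined by its representing dart. -/
lemma src_injective {t' : Bool} {x' y' z' : M.Dart} (h : M.Triangle t x y z)
    (h' : M.Triangle t' x' y' z') (hs : src t x z = src t' x' z') :
    t = t' ∧ x = x' ∧ y = y' ∧ z = z' := by
  have ht : t = t' := by
    have h1 := h.outward_face_src
    rw [hs, h'.outward_face_src] at h1
    cases t <;> cases t' <;> simp_all
  subst ht
  have h1 := h.side_src
  rw [hs, h'.side_src] at h1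
  have e0 := congrFun h1 0
  have e1 := congrFun h1 1
  have e2 := congrFun h1 2
  refine ⟨rfl, ?_⟩
  cases t
  · simp at e0 e1 e2
    exact ⟨e0.symm, e1.symm, e2.symm⟩
  · simp at e0 e1 e2
    exact ⟨e0.symm, e1.symm, e2.symm⟩

end Triangle

lemma FaceLabel.face {d : M.Dart} {i : ZMod n} (h : M.FaceLabel d i)
    (hd : M.face (M.face (M.face d)) = d) : M.FaceLabel (M.face d) i := by
  have key : M.word (M.face d) ~r M.word d := by
    refine List.IsRotated.symm ⟨1, ?_⟩
    simp [word, hd]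
  exact h.imp key.trans key.trans

/-- All three darts with the triangle on their left see the same relator. -/
lemma Triangle.faceLabel_left {t : Bool} {x y z : M.Dart} (h : M.Triangle t x y z) (d : M.Dart)
    (hd : d = (bif t then x else M.rev x) ∨ d = (bif t then y else M.rev y) ∨
      d = bif t then M.rev z else z) : M.FaceLabel d (M.letter x).1 := by
  have h0 := h.faceLabel_src
  have h1 := h0.face h.face_face_face_src
  have h2 := h1.face (by rw [h.face_face_face_src])
  rw [h.face_face_src] at h2
  rw [h.face_src] at h1
  cases t
  · rcases hd with rfl | rfl | rfl
    · exact h2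
    · exact h1
    · exact h0
  · rcases hd with rfl | rfl | rfl
    · exact h0
    · exact h1
    · exact h2

end LabelledMap

namespace VanKampenDiagram

open LabelledMap

variable {n : ℕ} {K : VanKampenDiagram n}

/-- `a` and `b`, in this order in direction `t`, bound the source, the middle or the target corner of
a triangle with flag `t`. -/
def CornerOf (K : VanKampenDiagram n) (t : Bool) (a b : K.Dart) : Prop :=
  (∃ y, K.Triangle t a y b) ∨ (∃ z, K.Triangle t (K.rev b) a z) ∨
    ∃ x, K.Triangle t x (K.rev b) (K.rev a)

/-- The boundary word of the face, read from `s` on, is one of the three rotations of a relator or of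
its inverse; the rotation tells which corner of the triangle is the one at `s`. -/
lemma cornerOf_of_inner {s : K.Dart} (hs : K.Inner s) :
    CornerOf K true s (K.rot s) ∨ CornerOf K false (K.rot s) s := by
  obtain ⟨h3, i, hi⟩ := K.triangle s hs
  set s1 := K.face s with hs1
  set s2 := K.face s1 with hs2
  have r0 : K.rot s = K.rev s2 := face_eq_iff.1 h3
  have r1 : K.rot s1 = K.rev s := face_eq_iff.1 hs1.symm
  have r2 : K.rot s2 = K.rev s1 := face_eq_iff.1 hs2.symm
  have i1 : K.Inner s1 := inner_face.2 hs
  have i2 : K.Inner s2 := inner_face.2 i1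
  have l0 := K.letter_rev s
  have l1 := K.letter_rev s1
  have l2 := K.letter_rev s2
  rw [r0]
  unfold FaceLabel word at hi
  rw [← hs1, ← hs2] at hi
  rcases hi with hi | hi
  · left
    obtain ⟨k, hk, hi⟩ := List.isRotated_iff_mod.1 hi.symm
    simp only [relator, List.length_cons, List.length_nil] at hk hi
    have : (i, true) :: (i + 1, true) :: (i + 2, false) :: [] =
      [K.letter s, K.letter s1, K.letter s2] ∨
      [(i + 1, true), (i + 2, false), (i, true)] = [K.letter s, K.letter s1, K.letter s2] ∨
      [(i + 2, false), (i, true), (i + 1, true)] = [K.letter s, K.letter s1, K.letter s2] := by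
      interval_cases k <;> simp_all
    simp only [List.cons.injEq, and_true] at this
    rcases this with ⟨a, b, c⟩ | ⟨a, b, c⟩ | ⟨a, b, c⟩
    · refine Or.inl ⟨s1, ⟨r0, hs⟩, ⟨r1, i1⟩, ?_, ?_, ?_, ?_⟩
      · rw [K.rev_rev]; exact ⟨r2, i2⟩
      all_goals simp [l2, ← a, ← b, ← c]
    · refine Or.inr (Or.inl ⟨K.rev s1, ?_, ?_, ?_, ?_, ?_, ?_⟩)
      · rw [K.rev_rev]; exact ⟨r2, i2⟩
      · rw [K.rev_rev]; exact ⟨r0, hs⟩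
      · rw [K.rev_rev]; exact ⟨r1, i1⟩
      all_goals simp [K.rev_rev, l1, ← a, ← b, ← c]
    · refine Or.inr (Or.inr ⟨s1, ?_, ?_, ?_, ?_, ?_, ?_⟩)
      · exact ⟨r1, i1⟩
      · rw [K.rev_rev]; exact ⟨r2, i2⟩
      · rw [K.rev_rev, K.rev_rev]; exact ⟨r0, hs⟩
      all_goals simp [K.rev_rev, l0, ← a, ← b, ← c]
  · right
    obtain ⟨k, hk, hi⟩ := List.isRotated_iff_mod.1 hi.symm
    simp [relator, FreeGroup.invRev] at hk hi
    have : [(i + 2, true), (i + 1, false), (i, false)] =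
      [K.letter s, K.letter s1, K.letter s2] ∨
      [(i + 1, false), (i, false), (i + 2, true)] = [K.letter s, K.letter s1, K.letter s2] ∨
      [(i, false), (i + 2, true), (i + 1, false)] = [K.letter s, K.letter s1, K.letter s2] := by
      interval_cases k <;> simp_all
    simp only [List.cons.injEq, and_true] at this
    rcases this with ⟨a, b, c⟩ | ⟨a, b, c⟩ | ⟨a, b, c⟩
    · refine Or.inl ⟨K.rev s1, ⟨r0, hs⟩, ?_, ?_, ?_, ?_, ?_⟩
      · rw [K.rev_rev]; exact ⟨r2, i2⟩
      · rw [K.rev_rev]; exact ⟨r1, i1⟩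
      all_goals simp [l1, l2, ← a, ← b, ← c]
    · refine Or.inr (Or.inr ⟨K.rev s1, ?_, ?_, ?_, ?_, ?_, ?_⟩)
      · rw [K.rev_rev]; exact ⟨r2, i2⟩
      · rw [K.rev_rev]; exact ⟨r1, i1⟩
      · rw [K.rev_rev, K.rev_rev]; exact ⟨r0, hs⟩
      all_goals simp [K.rev_rev, l0, l1, ← a, ← b, ← c]
    · refine Or.inr (Or.inl ⟨s1, ?_, ?_, ?_, ?_, ?_, ?_⟩)
      · exact ⟨r1, i1⟩
      · rw [K.rev_rev]; exact ⟨r0, hs⟩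
      · rw [K.rev_rev]; exact ⟨r2, i2⟩
      all_goals simp [l0, l2, ← a, ← b, ← c]

/-- Every corner is one of the three corners of a triangle, read in one of the two directions. -/
lemma cornerOf {t : Bool} {a b : K.Dart} (h : K.Corner t a b) :
    CornerOf K t a b ∨ CornerOf K (!t) b a := by
  cases t
  · obtain ⟨rfl, h⟩ := h
    exact (cornerOf_of_inner h).symm
  · obtain ⟨rfl, h⟩ := h
    exact cornerOf_of_inner h

end VanKampenDiagram
end Fibonacci

namespace Fibonacci

/-! ### Neighbouring edges of a vertex -/

lemma two_ne_zero_of {n : ℕ} (hn : 11 ≤ n) : (2 : ZMod n) ≠ 0 := by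
  simpa using natCast_ne_zero (n := n) (k := 2) (by omega) (by omega)

lemma four_ne_zero_of {n : ℕ} (hn : 11 ≤ n) : (4 : ZMod n) ≠ 0 := by
  simpa using natCast_ne_zero (n := n) (k := 4) (by omega) (by omega)

namespace LabelledMap

variable {n : ℕ} {M : LabelledMap n} {a b : M.Dart}

lemma OutNext.asymm (hn : 11 ≤ n) (h : M.OutNext a b) : ¬ M.OutNext b a := fun h' =>
  four_ne_zero_of hn (by linear_combination -h.2.2.2 - h'.2.2.2)

lemma InNext.asymm (hn : 11 ≤ n) (h : M.InNext a b) : ¬ M.InNext b a := fun h' =>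
  two_ne_zero_of hn (by linear_combination h.2.2.2 + h'.2.2.2)

/-- The index of the relator on a triangle, read off from the letters of two darts that bound one
of its corners. -/
def cornerIndex (p q : ZMod n × Bool) : ZMod n :=
  if p.2 = true then
    if q.2 = true then if q.1 = p.1 + 2 then p.1 else q.1
    else q.1
  else
    if q.2 = true then p.1
    else if q.1 = p.1 - 1 then q.1 - 1 else p.1 - 1

end LabelledMap

namespace VanKampenDiagram

open LabelledMap

variable {n : ℕ} {K : VanKampenDiagram n} {t : Bool} {a b c d e : K.Dart}

lemma CornerOf.cases (h : CornerOf K t a b) :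
    (K.OutNext a b ∧ ∃ y, K.Triangle t a y b) ∨ (K.Spoke b a ∧ ∃ z, K.Triangle t (K.rev b) a z) ∨
      (K.InNext a b ∧ ∃ x, K.Triangle t x (K.rev b) (K.rev a)) := by
  rcases h with ⟨y, h⟩ | ⟨z, h⟩ | ⟨x, h⟩
  · exact Or.inl ⟨h.outNext, y, h⟩
  · refine Or.inr (Or.inl ⟨?_, z, h⟩)
    have := h.spoke
    rwa [K.rev_rev] at this
  · refine Or.inr (Or.inr ⟨?_, x, h⟩)
    have := h.inNext
    rwa [K.rev_rev, K.rev_rev] at this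

lemma triangle_of_outNext (hn : 11 ≤ n) (hc : K.Corner t a b) (h : K.OutNext a b) :
    ∃ y, K.Triangle t a y b := by
  rcases cornerOf hc with h' | h'
  · rcases h'.cases with ⟨-, h'⟩ | ⟨h', -⟩ | ⟨h', -⟩
    · exact h'
    · exact absurd h.2.2.1 h'.2.1
    · exact absurd h.2.1 h'.2.1
  · rcases h'.cases with ⟨h', -⟩ | ⟨h', -⟩ | ⟨h', -⟩
    · exact absurd h' (h.asymm hn)
    · exact absurd h.2.1 h'.2.1
    · exact absurd h.2.2.1 h'.2.1

lemma triangle_of_inNext (hn : 11 ≤ n) (hc : K.Corner t a b) (h : K.InNext a b) :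
    ∃ x, K.Triangle t x (K.rev b) (K.rev a) := by
  rcases cornerOf hc with h' | h'
  · rcases h'.cases with ⟨h', -⟩ | ⟨h', -⟩ | ⟨-, h'⟩
    · exact absurd h'.2.1 h.2.1
    · exact absurd h'.2.2.1 h.2.1
    · exact h'
  · rcases h'.cases with ⟨h', -⟩ | ⟨h', -⟩ | ⟨h', -⟩
    · exact absurd h'.2.1 h.2.2.1
    · exact absurd h'.2.2.1 h.2.2.1
    · exact absurd h' (h.asymm hn)

lemma triangle_of_spoke (hc : K.Corner t b a) (h : K.Spoke a b) :
    ∃ z, K.Triangle t (K.rev a) b z := by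
  rcases cornerOf hc with h' | h'
  · rcases h'.cases with ⟨h', -⟩ | ⟨-, h'⟩ | ⟨h', -⟩
    · exact absurd h'.2.2.1 h.2.1
    · exact h'
    · exact absurd h.2.2.1 h'.2.1
  · rcases h'.cases with ⟨h', -⟩ | ⟨h', -⟩ | ⟨h', -⟩
    · exact absurd h'.2.1 h.2.1
    · exact absurd h.2.2.1 h'.2.1
    · exact absurd h.2.2.1 h'.2.2.1

/-- Two neighbouring edges of a vertex form one of the three kinds of corners. -/
lemma consecutive_cases (h : K.Consecutive a b) :
    K.OutNext a b ∨ K.OutNext b a ∨ K.InNext a b ∨ K.InNext b a ∨ K.Spoke a b ∨ K.Spoke b a := by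
  obtain ⟨t, ht⟩ := h.exists_corner
  rcases cornerOf ht with h' | h' <;> rcases h'.cases with ⟨h', -⟩ | ⟨h', -⟩ | ⟨h', -⟩ <;> simp [h']

/-- The letters on the two sides of a corner determine the relator on its triangle. The face on the
left of the chosen dart is this triangle. -/
lemma faceLabel_cornerIndex (hn : 11 ≤ n) (h : K.Corner t a b) :
    K.FaceLabel (bif t then a else K.rev a) (cornerIndex (K.letter a) (K.letter b)) := by
  rcases cornerOf h with (⟨y, h'⟩ | ⟨z, h'⟩ | ⟨x, h'⟩) | ⟨y, h'⟩ | ⟨z, h'⟩ | ⟨x, h'⟩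
  · have ho := h'.outNext
    have : cornerIndex (K.letter a) (K.letter b) = (K.letter a).1 := by
      unfold cornerIndex
      rw [if_pos (show (K.letter _).2 = true from ho.2.1),
        if_pos (show (K.letter _).2 = true from ho.2.2.1), if_pos ho.2.2.2]
    rw [this]
    exact h'.faceLabel_left _ (Or.inl rfl)
  · have ho := h'.spoke
    rw [K.rev_rev] at ho
    have : cornerIndex (K.letter a) (K.letter b) = (K.letter (K.rev b)).1 := by
      unfold cornerIndex
      rw [if_pos (show (K.letter _).2 = true from ho.2.2.1),
        if_neg (show ¬ (K.letter _).2 = true from ho.2.1), label_rev]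
    rw [this]
    exact h'.faceLabel_left _ (Or.inr (Or.inl rfl))
  · have ho := h'.inNext
    rw [K.rev_rev, K.rev_rev] at ho
    have : cornerIndex (K.letter a) (K.letter b) = (K.letter x).1 := by
      unfold cornerIndex
      rw [if_neg (show ¬ (K.letter _).2 = true from ho.2.1),
        if_neg (show ¬ (K.letter _).2 = true from ho.2.2.1), if_pos ho.2.2.2,
        ← label_rev (d := b), h'.letter_y]
      ring
    rw [this]
    refine h'.faceLabel_left _ (Or.inr (Or.inr ?_))
    cases t <;> simp [K.rev_rev]
  · have ho := h'.outNext
    have : cornerIndex (K.letter a) (K.letter b) = (K.letter b).1 := by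
      unfold cornerIndex
      rw [if_pos (show (K.letter _).2 = true from ho.2.2.1),
        if_pos (show (K.letter _).2 = true from ho.2.1), if_neg]
      exact fun hh => ho.asymm hn ⟨ho.1.symm, ho.2.2.1, ho.2.1, hh⟩
    rw [this]
    refine h'.faceLabel_left _ (Or.inr (Or.inr ?_))
    cases t <;> simp
  · have ho := h'.spoke
    rw [K.rev_rev] at ho
    have : cornerIndex (K.letter a) (K.letter b) = (K.letter (K.rev a)).1 := by
      unfold cornerIndex
      rw [if_neg (show ¬ (K.letter _).2 = true from ho.2.1),
        if_pos (show (K.letter _).2 = true from ho.2.2.1), label_rev]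
    rw [this]
    refine h'.faceLabel_left _ (Or.inl ?_)
    cases t <;> simp [K.rev_rev]
  · have ho := h'.inNext
    rw [K.rev_rev, K.rev_rev] at ho
    have : cornerIndex (K.letter a) (K.letter b) = (K.letter x).1 := by
      unfold cornerIndex
      rw [if_neg (show ¬ (K.letter _).2 = true from ho.2.2.1),
        if_neg (show ¬ (K.letter _).2 = true from ho.2.1), if_neg, ← label_rev (d := a),
        h'.letter_y]
      · ring
      · exact fun hh => ho.asymm hn ⟨ho.1.symm, ho.2.2.1, ho.2.1, hh⟩
    rw [this]
    refine h'.faceLabel_left _ (Or.inr (Or.inl ?_))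
    cases t <;> simp [K.rev_rev]

/-- Reducedness at a vertex: the two neighbours of an edge carry different letters, since otherwise
the triangles on both sides of the edge would carry the same relator. -/
lemma letter_ne_of_corner (hn : 11 ≤ n) (hred : K.Reduced) (h : K.Corner t d a)
    (h' : K.Corner (!t) d b) : K.letter a ≠ K.letter b := by
  have key : ∀ a b : K.Dart, K.Corner true d a → K.Corner false d b →
      K.letter a ≠ K.letter b := by
    intro a b h h' hab
    have h1 := faceLabel_cornerIndex hn h
    have h2 := faceLabel_cornerIndex hn h'
    rw [← hab] at h2
    refine hred d h.2 ?_ _ ⟨h1, h2⟩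
    rw [← inner_face, (face_eq_iff (b := b)).2 (by rw [K.rev_rev]; exact h'.1)]
    exact h'.2
  cases t
  · exact (key b a h' h).symm
  · exact key a b h h'

/-- Edges of a vertex next to a given edge are determined by their letters. -/
lemma eq_of_letter_eq (hn : 11 ≤ n) (hred : K.Reduced) (h : K.Consecutive d a)
    (h' : K.Consecutive d b) (hl : K.letter a = K.letter b) : a = b := by
  obtain ⟨s, hs⟩ := h.exists_corner
  obtain ⟨t, ht⟩ := h'.exists_corner
  by_cases hst : s = t
  · subst hst; exact hs.right_unique ht
  · have : t = !s := by cases s <;> cases t <;> simp_all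
    subst this
    exact absurd hl (letter_ne_of_corner hn hred hs ht)

/-- No edge has three neighbours. -/
lemma not_three_neighbours (ha : K.Consecutive d a) (hb : K.Consecutive d b)
    (hc : K.Consecutive d c) (hab : K.letter a ≠ K.letter b) (hac : K.letter a ≠ K.letter c)
    (hbc : K.letter b ≠ K.letter c) : False := by
  rcases ha.pigeonhole hb hc with rfl | rfl | rfl <;> contradiction

lemma letter_ne_of_outward (ha : K.Outward a) (hb : ¬ K.Outward b) : K.letter a ≠ K.letter b :=
  fun h => hb (by rw [Outward, ← h]; exact ha)

lemma OutNext.letter_ne (hn : 11 ≤ n) (h : K.OutNext a d) (h' : K.OutNext d b) :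
    K.letter a ≠ K.letter b := fun hl =>
  four_ne_zero_of hn (by linear_combination -h.2.2.2 - h'.2.2.2 - congrArg Prod.fst hl)

lemma InNext.letter_ne (hn : 11 ≤ n) (h : K.InNext a d) (h' : K.InNext d b) :
    K.letter a ≠ K.letter b := fun hl =>
  two_ne_zero_of hn (by linear_combination h.2.2.2 + h'.2.2.2 + congrArg Prod.fst hl)

/-- An outward edge between two outward edges is not next to an inward edge. -/
lemma not_spoke_of_outNext (hn : 11 ≤ n) (h : K.OutNext a d) (h' : K.OutNext d b) :
    ¬ K.Spoke e d := fun hs =>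
  not_three_neighbours h.1.symm h'.1 hs.1.symm (OutNext.letter_ne hn h h')
    (letter_ne_of_outward h.2.1 hs.2.1) (letter_ne_of_outward h'.2.2.1 hs.2.1)

lemma not_spoke_of_inNext (hn : 11 ≤ n) (h : K.InNext a d) (h' : K.InNext d b) :
    ¬ K.Spoke d e := fun hs =>
  not_three_neighbours h.1.symm h'.1 hs.1 (InNext.letter_ne hn h h')
    (letter_ne_of_outward hs.2.2.1 h.2.1).symm (letter_ne_of_outward hs.2.2.1 h'.2.2.1).symm

lemma OutNext.right_unique (hn : 11 ≤ n) (hred : K.Reduced)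
    (h : K.OutNext d a) (h' : K.OutNext d b) : a = b :=
  eq_of_letter_eq hn hred h.1 h'.1 (by
    rw [outward_iff.1 h.2.2.1, outward_iff.1 h'.2.2.1, h.2.2.2, h'.2.2.2])

lemma OutNext.left_unique (hn : 11 ≤ n) (hred : K.Reduced)
    (h : K.OutNext a d) (h' : K.OutNext b d) : a = b :=
  eq_of_letter_eq hn hred h.1.symm h'.1.symm (by
    rw [outward_iff.1 h.2.1, outward_iff.1 h'.2.1, eq_sub_of_add_eq h.2.2.2.symm,
      eq_sub_of_add_eq h'.2.2.2.symm])

lemma InNext.right_unique (hn : 11 ≤ n) (hred : K.Reduced)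
    (h : K.InNext d a) (h' : K.InNext d b) : a = b :=
  eq_of_letter_eq hn hred h.1 h'.1 (by
    rw [not_outward_iff.1 h.2.2.1, not_outward_iff.1 h'.2.2.1, h.2.2.2, h'.2.2.2])

lemma InNext.left_unique (hn : 11 ≤ n) (hred : K.Reduced)
    (h : K.InNext a d) (h' : K.InNext b d) : a = b :=
  eq_of_letter_eq hn hred h.1.symm h'.1.symm (by
    rw [not_outward_iff.1 h.2.1, not_outward_iff.1 h'.2.1, eq_add_of_sub_eq h.2.2.2.symm,
      eq_add_of_sub_eq h'.2.2.2.symm])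

lemma Spoke.right_unique (hn : 11 ≤ n) (hred : K.Reduced)
    (h : K.Spoke d a) (h' : K.Spoke d b) : a = b :=
  eq_of_letter_eq hn hred h.1 h'.1 (by
    rw [outward_iff.1 h.2.2.1, outward_iff.1 h'.2.2.1, h.2.2.2, h'.2.2.2])

lemma Spoke.left_unique (hn : 11 ≤ n) (hred : K.Reduced)
    (h : K.Spoke a d) (h' : K.Spoke b d) : a = b :=
  eq_of_letter_eq hn hred h.1.symm h'.1.symm (by
    rw [not_outward_iff.1 h.2.1, not_outward_iff.1 h'.2.1, eq_sub_of_add_eq h.2.2.2.symm,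
      eq_sub_of_add_eq h'.2.2.2.symm])

end VanKampenDiagram
end Fibonacci

namespace Fibonacci

/-! ### Walking around a vertex -/

namespace LabelledMap

variable {n : ℕ} (M : LabelledMap n)

/-- Rotation around the initial vertex, anticlockwise (`t = true`) or clockwise. -/
def dir (t : Bool) : Equiv.Perm M.Dart := bif t then M.rot else M.rot⁻¹

/-- The label shift along one step of a run of outward (`o = true`) or inward edges, met from the
first to the last (`u = true`) or from the last to the first. -/
def shift (n : ℕ) : Bool → Bool → ZMod n
  | true, true => 2
  | true, false => -2
  | false, true => -1
  | false, false => 1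

/-- `b` succeeds (`u = true`) or precedes (`u = false`) `a` in a sequence of outward (`o = true`) or
inward (`o = false`) edges. -/
def Next (o u : Bool) (a b : M.Dart) : Prop :=
  M.Consecutive a b ∧ (M.letter a).2 = o ∧ (M.letter b).2 = o ∧
    (M.letter b).1 = (M.letter a).1 + shift n o u

variable {M} {t o u : Bool} {a b d : M.Dart} {v : M.Vertex}

lemma next_true_true : M.Next true true a b ↔ M.OutNext a b := Iff.rfl

lemma next_true_false : M.Next true false a b ↔ M.OutNext b a := by
  unfold Next OutNext Outward shift
  constructor
  · rintro ⟨h1, h2, h3, h4⟩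
    exact ⟨h1.symm, h3, h2, by rw [h4]; ring⟩
  · rintro ⟨h1, h2, h3, h4⟩
    exact ⟨h1.symm, h3, h2, by rw [h4]; ring⟩

lemma next_false_true : M.Next false true a b ↔ M.InNext a b := by
  simp [Next, InNext, Outward, shift, sub_eq_add_neg]

lemma next_false_false : M.Next false false a b ↔ M.InNext b a := by
  rw [← next_false_true]
  unfold Next shift
  constructor
  · rintro ⟨h1, h2, h3, h4⟩
    exact ⟨h1.symm, h3, h2, by rw [h4]; ring⟩
  · rintro ⟨h1, h2, h3, h4⟩
    exact ⟨h1.symm, h3, h2, by rw [h4]; ring⟩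

lemma next_not : M.Next o (!u) a b ↔ M.Next o u b a := by
  cases o <;> cases u <;>
    simp [next_true_true, next_true_false, next_false_true, next_false_false]

lemma dir_cases (t : Bool) : M.dir t = M.rot ∨ M.dir t = M.rot⁻¹ := by
  cases t
  · exact Or.inr rfl
  · exact Or.inl rfl

lemma dir_not (t : Bool) (a : M.Dart) : M.dir (!t) (M.dir t a) = a := by
  cases t <;> simp [dir]

lemma dir_pow_succ (k : ℕ) : (M.dir t ^ (k + 1)) a = M.dir t ((M.dir t ^ k) a) := by
  rw [pow_succ', Equiv.Perm.mul_apply]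

lemma origin_eq_iff : M.origin a = M.origin b ↔ M.rot.SameCycle a b :=
  ⟨fun h => Quotient.exact (s := Equiv.Perm.SameCycle.setoid M.rot) h,
    fun h => Quotient.sound (s := Equiv.Perm.SameCycle.setoid M.rot) h⟩

lemma sameCycle_dir : (M.dir t).SameCycle a b ↔ M.rot.SameCycle a b := by
  cases t
  · exact Equiv.Perm.sameCycle_inv
  · exact Iff.rfl

lemma exists_origin (v : M.Vertex) : ∃ a, M.origin a = v := Quotient.exists_rep v

lemma origin_pow (h : M.origin a = v) (k : ℕ) : M.origin ((M.dir t ^ k) a) = v := by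
  rw [← h, origin_eq_iff, ← sameCycle_dir (t := t)]
  exact Equiv.Perm.sameCycle_pow_left.2 (Equiv.Perm.SameCycle.refl _ _)

lemma corner_dir (hv : M.Interior v) (h : M.origin a = v) : M.Corner t a (M.dir t a) := by
  cases t
  · have : M.origin (M.dir false a) = v := by
      have := origin_pow (t := false) h 1
      simpa using this
    exact ⟨by simp [dir], hv _ this⟩
  · exact ⟨rfl, hv _ h⟩

lemma corner_pow (hv : M.Interior v) (h : M.origin a = v) (k : ℕ) :
    M.Corner t ((M.dir t ^ k) a) ((M.dir t ^ (k + 1)) a) := by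
  rw [dir_pow_succ]
  exact corner_dir hv (origin_pow h k)

lemma setOf_origin_eq (h : M.origin a = v) :
    {d | M.origin d = v} =
      (fun k => (M.dir t ^ k) a) '' Set.Iio (Function.minimalPeriod (M.dir t) a) := by
  have := M.finite_dart
  have := Fintype.ofFinite M.Dart
  ext d
  simp only [Set.mem_ofPred_eq, Set.mem_image, Set.mem_Iio]
  constructor
  · intro hd
    rw [← h, eq_comm, origin_eq_iff, ← sameCycle_dir (t := t)] at hd
    obtain ⟨k, hk⟩ := hd.exists_nat_pow_eq
    refine ⟨k % Function.minimalPeriod (M.dir t) a, Nat.mod_lt _ ?_, ?_⟩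
    · refine Function.minimalPeriod_pos_of_mem_periodicPts ?_
      exact (M.dir t).injective.mem_periodicPts a
    · rw [← hk, ← Equiv.Perm.iterate_eq_pow, ← Equiv.Perm.iterate_eq_pow,
        Function.iterate_mod_minimalPeriod_eq]
  · rintro ⟨k, -, rfl⟩
    exact origin_pow h k

lemma injOn_pow (t : Bool) (a : M.Dart) : Set.InjOn (fun k => (M.dir t ^ k) a)
    (Set.Iio (Function.minimalPeriod (M.dir t) a)) := by
  intro i hi j hj hij
  simp only [← Equiv.Perm.iterate_eq_pow] at hij
  exact Function.iterate_injOn_Iio_minimalPeriod hi hj hij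

lemma minimalPeriod_eq_degree (h : M.origin a = v) :
    Function.minimalPeriod (M.dir t) a = M.degree v := by
  rw [degree, setOf_origin_eq (t := t) h, (injOn_pow t a).ncard_image]
  simp [Set.ncard_eq_toFinset_card']

lemma pow_add_degree (h : M.origin a = v) (k : ℕ) :
    (M.dir t ^ (k + M.degree v)) a = (M.dir t ^ k) a := by
  rw [← minimalPeriod_eq_degree (t := t) h, ← Equiv.Perm.iterate_eq_pow,
    ← Equiv.Perm.iterate_eq_pow, Function.iterate_add_minimalPeriod_eq]

lemma pow_injective (h : M.origin a = v) {i j : ℕ} (hi : i < M.degree v) (hj : j < M.degree v)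
    (hij : (M.dir t ^ i) a = (M.dir t ^ j) a) : i = j := by
  rw [← minimalPeriod_eq_degree (t := t) h] at hi hj
  exact injOn_pow t a hi hj hij

lemma exists_pow_eq (h : M.origin a = v) (hd : M.origin d = v) :
    ∃ k < M.degree v, (M.dir t ^ k) a = d := by
  have : d ∈ {d | M.origin d = v} := hd
  rw [setOf_origin_eq (t := t) h, minimalPeriod_eq_degree h] at this
  exact this

lemma degree_pos (v : M.Vertex) : 0 < M.degree v := by
  obtain ⟨a, h⟩ := exists_origin v
  obtain ⟨k, hk, -⟩ := exists_pow_eq (t := true) h h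
  omega

open Classical in
/-- The number of uncoloured edges among those numbered `p, …, q - 1` around a vertex. -/
noncomputable def uncolouredCount (f : ℕ → M.Dart) (p q : ℕ) : ℕ :=
  ((Finset.Ico p q).filter fun k => M.Uncoloured (f k)).card

lemma uncolouredDegree_eq (h : M.origin a = v) :
    M.uncolouredDegree v = uncolouredCount (fun k => (M.dir t ^ k) a) 0 (M.degree v) := by
  classical
  unfold uncolouredDegree uncolouredCount
  have : {d | M.origin d = v ∧ M.Uncoloured d} = (fun k => (M.dir t ^ k) a) ''
      ((Finset.Ico 0 (M.degree v)).filter fun k => M.Uncoloured ((M.dir t ^ k) a)) := by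
    ext d
    simp only [Set.mem_ofPred_eq, Set.mem_image, Finset.coe_filter, Finset.mem_Ico, zero_le,
      true_and]
    constructor
    · rintro ⟨hd, hu⟩
      obtain ⟨k, hk, rfl⟩ := exists_pow_eq (t := t) h hd
      exact ⟨k, ⟨hk, hu⟩, rfl⟩
    · rintro ⟨k, ⟨hk, hu⟩, rfl⟩
      exact ⟨origin_pow h k, hu⟩
  rw [this, Set.InjOn.ncard_image, Set.ncard_coe_finset]
  intro i hi j hj hij
  simp only [Finset.coe_filter, Finset.mem_Ico, zero_le, true_and, Set.mem_ofPred_eq] at hi hj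
  exact pow_injective h hi.1 hj.1 hij

end LabelledMap

namespace VanKampenDiagram

open LabelledMap

variable {n : ℕ} {K : VanKampenDiagram n} {t o u : Bool} {a b c d e : K.Dart} {v : K.Vertex}

/-- Two neighbouring edges of the same kind follow each other in a sequence. -/
lemma exists_next (h : K.Consecutive a b) (ha : (K.letter a).2 = o) (hb : (K.letter b).2 = o) :
    ∃ u, K.Next o u a b := by
  cases o
  · have ha' : ¬ K.Outward a := by simp [Outward, ha]
    have hb' : ¬ K.Outward b := by simp [Outward, hb]
    rcases consecutive_cases h with h | h | h | h | h | h
    · exact absurd h.2.1 ha'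
    · exact absurd h.2.1 hb'
    · exact ⟨true, next_false_true.2 h⟩
    · exact ⟨false, next_false_false.2 h⟩
    · exact absurd h.2.2.1 hb'
    · exact absurd h.2.2.1 ha'
  · rcases consecutive_cases h with h | h | h | h | h | h
    · exact ⟨true, h⟩
    · exact ⟨false, next_true_false.2 h⟩
    · exact absurd ha h.2.1
    · exact absurd ha h.2.2.1
    · exact absurd ha h.2.1
    · exact absurd hb h.2.1

lemma spoke_of_consecutive (h : K.Consecutive a b) (ha : ¬ K.Outward a) (hb : K.Outward b) :
    K.Spoke a b := by
  rcases consecutive_cases h with h | h | h | h | h | h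
  · exact absurd h.2.1 ha
  · exact absurd h.2.2.1 ha
  · exact absurd hb h.2.2.1
  · exact absurd hb h.2.1
  · exact h
  · exact absurd h.2.2.1 ha

lemma letter_ne_of_pow (hn : 11 ≤ n) (hred : K.Reduced) (hv : K.Interior v)
    (h : K.origin a = v) (k : ℕ) :
    K.letter ((K.dir t ^ k) a) ≠ K.letter ((K.dir t ^ (k + 2)) a) :=
  (letter_ne_of_corner hn hred (corner_pow (t := t) hv h (k + 1))
    (corner_pow (t := t) hv h k).symm).symm

/-- A sequence of edges keeps its direction: a turn would give the two neighbours of an edge the same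
letter. -/
lemma next_succ (hn : 11 ≤ n) (hred : K.Reduced) (hv : K.Interior v) (h : K.origin a = v) {k : ℕ}
    (hk : K.Next o u ((K.dir t ^ k) a) ((K.dir t ^ (k + 1)) a))
    (ho : (K.letter ((K.dir t ^ (k + 2)) a)).2 = o) :
    K.Next o u ((K.dir t ^ (k + 1)) a) ((K.dir t ^ (k + 2)) a) := by
  obtain ⟨u', hu'⟩ := exists_next (corner_pow (t := t) hv h (k + 1)).consecutive hk.2.2.1 ho
  by_cases huu : u' = u
  · rw [← huu]; exact hu'
  · exfalso
    have : u' = !u := by cases u <;> cases u' <;> simp_all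
    rw [this, next_not] at hu'
    refine letter_ne_of_pow hn hred hv h (t := t) k (Prod.ext ?_ ?_)
    · exact add_right_cancel (hk.2.2.2.symm.trans hu'.2.2.2)
    · rw [hk.2.1, ho]

/-- A maximal sequence of outward or inward edges has at least two members: otherwise its only member
would have two neighbours with the same letter. -/
lemma outward_iff_of_outward_ne (hn : 11 ≤ n) (hred : K.Reduced) (hv : K.Interior v)
    (h : K.origin a = v) {k : ℕ}
    (hk : K.Outward ((K.dir t ^ k) a) ↔ ¬ K.Outward ((K.dir t ^ (k + 1)) a)) :
    K.Outward ((K.dir t ^ (k + 2)) a) ↔ K.Outward ((K.dir t ^ (k + 1)) a) := by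
  have c0 := (corner_pow (t := t) hv h k).consecutive
  have c1 := (corner_pow (t := t) hv h (k + 1)).consecutive
  have hne := letter_ne_of_pow hn hred hv h (t := t) k
  by_cases h1 : K.Outward ((K.dir t ^ (k + 1)) a)
  · refine iff_of_true ?_ h1
    by_contra h2
    have s0 := spoke_of_consecutive c0 (by tauto) h1
    have s1 := spoke_of_consecutive c1.symm h2 h1
    refine hne ?_
    rw [not_outward_iff.1 s0.2.1, not_outward_iff.1 s1.2.1,
      add_right_cancel (s0.2.2.2.symm.trans s1.2.2.2)]
  · refine iff_of_false ?_ h1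
    intro h2
    have s0 := spoke_of_consecutive c0.symm h1 (by tauto)
    have s1 := spoke_of_consecutive c1 h1 h2
    refine hne ?_
    rw [outward_iff.1 s0.2.2.1, outward_iff.1 s1.2.2.1, s0.2.2.2, s1.2.2.2]

/-- A run of edges of the same kind is traversed in one direction. -/
lemma next_of_run (hn : 11 ≤ n) (hred : K.Reduced) (hv : K.Interior v) (h : K.origin a = v)
    {p q : ℕ} (hpq : ∀ k, p ≤ k → k < q → (K.letter ((K.dir t ^ k) a)).2 = o)
    (hp : K.Next o u ((K.dir t ^ p) a) ((K.dir t ^ (p + 1)) a)) {k : ℕ} (hk : p ≤ k)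
    (hkq : k + 1 < q) : K.Next o u ((K.dir t ^ k) a) ((K.dir t ^ (k + 1)) a) := by
  induction k, hk using Nat.le_induction with
  | base => exact hp
  | succ k hk ih => exact next_succ hn hred hv h (ih (by omega)) (hpq _ (by omega) hkq)

lemma label_of_run {f : ℕ → K.Dart} {p q : ℕ}
    (hf : ∀ k, p ≤ k → k + 1 < q → K.Next o u (f k) (f (k + 1))) (j : ℕ) (hj : p + j < q) :
    (K.letter (f (p + j))).1 = (K.letter (f p)).1 + j * shift n o u := by
  induction j with
  | zero => simp
  | succ j ih =>
    have := (hf (p + j) (by omega) (by omega)).2.2.2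
    rw [← add_assoc, this, ih (by omega)]
    push_cast
    ring

/-- The first index after a run. -/
lemma exists_run_end {P : ℕ → Prop} {p m : ℕ} (hp : P p) (hpm : p ≤ m) (hm : ¬ P m) :
    ∃ q, p < q ∧ q ≤ m ∧ ¬ P q ∧ ∀ k, p ≤ k → k < q → P k := by
  classical
  have hex : ∃ q, p ≤ q ∧ ¬ P q := ⟨m, hpm, hm⟩
  refine ⟨Nat.find hex, ?_, Nat.find_min' hex ⟨hpm, hm⟩, (Nat.find_spec hex).2, ?_⟩
  · have h1 := (Nat.find_spec hex).1
    have h2 := (Nat.find_spec hex).2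
    rcases h1.lt_or_eq with h | h
    · exact h
    · rw [← h] at h2; exact absurd hp h2
  · intro k hk hkq
    by_contra hc
    exact Nat.find_min hex hkq ⟨hk, hc⟩

/-- A vertex with outward and inward edges can be traversed starting with a maximal outward
sequence, from its first edge on. -/
lemma exists_start (hn : 11 ≤ n) (hred : K.Reduced) (hv : K.Interior v)
    (hb : K.origin b = v) (hbo : K.Outward b) (hc : K.origin c = v) (hci : ¬ K.Outward c) :
    ∃ t a, K.origin a = v ∧ K.Outward a ∧ ¬ K.Outward ((K.dir t ^ (K.degree v - 1)) a) ∧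
      K.OutNext a (K.dir t a) := by
  have hL := degree_pos v
  obtain ⟨m, hm, hmb⟩ := exists_pow_eq (t := true) hc hb
  obtain ⟨q, hq0, hqm, hq, hlt⟩ := exists_run_end (P := fun k => ¬ K.Outward ((K.dir true ^ k) c))
    (p := 0) (m := m) hci (Nat.zero_le _) (by rw [hmb]; exact not_not.2 hbo)
  rw [not_not] at hq
  obtain ⟨q, rfl⟩ : ∃ j, q = j + 1 := ⟨q - 1, by omega⟩
  set a := (K.dir true ^ (q + 1)) c with ha
  have hav : K.origin a = v := origin_pow hc _
  have hpow : ∀ k, (K.dir true ^ k) a = (K.dir true ^ (q + 1 + k)) c := fun k => by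
    rw [ha, ← Equiv.Perm.mul_apply, ← pow_add, add_comm]
  have hlast : (K.dir true ^ (K.degree v - 1)) a = (K.dir true ^ q) c := by
    rw [hpow, ← pow_add_degree (t := true) hc q]
    congr 2; omega
  have hlast' : ¬ K.Outward ((K.dir true ^ (K.degree v - 1)) a) := by
    rw [hlast]; exact hlt q (Nat.zero_le _) (by omega)
  have h1 : K.Outward (K.dir true a) := by
    have h0 : ¬ K.Outward ((K.dir true ^ q) c) := hlt q (Nat.zero_le _) (by omega)
    have := (outward_iff_of_outward_ne hn hred hv hc (t := true) (k := q)
      (iff_of_false h0 (not_not.2 hq))).2 hq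
    rwa [dir_pow_succ] at this
  rcases exists_next (corner_dir (t := true) hv hav).consecutive hq h1 with ⟨u, hu⟩
  cases u
  -- the sequence is met from its last edge on: walk backwards from its other end
  · have hL' : 0 < K.degree v - 1 := by
      by_contra hc'
      have : K.degree v - 1 = 0 := by omega
      rw [this] at hlast'
      exact hlast' hq
    obtain ⟨p, hp0, hpL, hp, hplt⟩ := exists_run_end
      (P := fun k => K.Outward ((K.dir true ^ k) a)) (p := 0) hq (Nat.zero_le _) hlast'
    have hp2 : p ≠ 1 := by
      rintro rfl
      exact hp h1
    obtain ⟨p, rfl⟩ : ∃ j, p = j + 2 := ⟨p - 2, by omega⟩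
    have hrun := next_of_run hn hred hv hav (t := true) (p := 0) (q := p + 2) (o := true)
      (u := false) (fun k h0 hk => hplt k h0 hk) hu (k := p) (by omega) (by omega)
    set f : ℕ → K.Dart := fun k => (K.dir true ^ k) a with hf
    have hback : ∀ k, K.dir false (f (k + 1)) = f k := fun k => by
      simp only [hf]; rw [dir_pow_succ]; exact dir_not true _
    refine ⟨false, f (p + 1), origin_pow hav _, hplt (p + 1) (by omega) (by omega), ?_, ?_⟩
    · have : (K.dir false ^ (K.degree v - 1)) (f (p + 1)) = f (p + 2) := by
        apply (K.dir false).injective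
        rw [← dir_pow_succ, hback]
        have := pow_add_degree (t := false) (a := f (p + 1)) (origin_pow hav _) 0
        rw [zero_add] at this
        rw [Nat.sub_add_cancel hL, this]; rfl
      rw [this]; exact hp
    · rw [hback]; exact next_true_false.1 hrun
  · exact ⟨true, a, hav, hq, hlast', hu⟩

end VanKampenDiagram
end Fibonacci

namespace Fibonacci

/-! ### The 5 vertices -/

namespace LabelledMap

variable {n : ℕ} (M : LabelledMap n)

/-- The five edges of a 5 vertex in the order of direction `t`: three inward edges `c₀, c₁, c₂` and
two outward edges `c₃, c₄`, both from the first to the last. -/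
structure Star (t : Bool) (c₀ c₁ c₂ c₃ c₄ : M.Dart) : Prop where
  corner₀ : M.Corner t c₀ c₁
  corner₁ : M.Corner t c₁ c₂
  corner₂ : M.Corner t c₂ c₃
  corner₃ : M.Corner t c₃ c₄
  corner₄ : M.Corner t c₄ c₀
  in₀ : M.InNext c₀ c₁
  in₁ : M.InNext c₁ c₂
  spoke : M.Spoke c₂ c₃
  out : M.OutNext c₃ c₄
  spoke' : M.Spoke c₀ c₄

/-- `c` is the first inward edge of a 5 vertex. -/
def FiveFirst (c : M.Dart) : Prop :=
  M.IsFive (M.origin c) ∧ ∃ t c₁ c₂ c₃ c₄, M.Star t c c₁ c₂ c₃ c₄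

end LabelledMap

namespace VanKampenDiagram

open LabelledMap

variable {n : ℕ} {K : VanKampenDiagram n} {t o u : Bool} {a b c d e : K.Dart} {v : K.Vertex}

/-- A vertex all of whose edges are outward, or all inward, is a single sequence that closes up, so
that the label shifts add up to zero. -/
lemma all_next (hn : 11 ≤ n) (hred : K.Reduced) (hv : K.Interior v) (h : K.origin a = v)
    (ho : ∀ k, (K.letter ((K.dir t ^ k) a)).2 = o) :
    ∃ u, (∀ k, K.Next o u ((K.dir t ^ k) a) ((K.dir t ^ (k + 1)) a)) ∧
      (K.degree v : ZMod n) * shift n o u = 0 := by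
  obtain ⟨u, hu⟩ := exists_next (corner_pow (t := t) hv h 0).consecutive (ho 0) (ho 1)
  have hall : ∀ k, K.Next o u ((K.dir t ^ k) a) ((K.dir t ^ (k + 1)) a) := fun k =>
    next_of_run hn hred hv h (p := 0) (q := k + 2) (fun k _ _ => ho k) hu (Nat.zero_le k) (by omega)
  refine ⟨u, hall, ?_⟩
  have h1 := label_of_run (f := fun k => (K.dir t ^ k) a) (p := 0) (q := K.degree v + 1)
    (fun k _ _ => hall k) (K.degree v) (by omega)
  have h2 := pow_add_degree (t := t) h 0
  rw [h2] at h1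
  exact left_eq_add.1 h1

/-- A 5 vertex has three inward and two outward edges in the same orientation: for any other
arrangement of five edges in sequences of at least two, the label shifts around the vertex add up to a
nonzero number of absolute value at most 10. -/
lemma exists_star (hn : 11 ≤ n) (hred : K.Reduced) (hv : K.IsFive v) :
    ∃ t c₀ c₁ c₂ c₃ c₄, K.Star t c₀ c₁ c₂ c₃ c₄ ∧
      ∀ d, K.origin d = v → d = c₀ ∨ d = c₁ ∨ d = c₂ ∨ d = c₃ ∨ d = c₄ := by
  obtain ⟨hv, hdeg⟩ := hv
  have nz : ∀ k : ℕ, 0 < k → k < 11 → (k : ZMod n) ≠ 0 := fun k h0 h1 =>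
    natCast_ne_zero h0 (by omega)
  have hmixed : ∀ o, ∃ b, K.origin b = v ∧ (K.letter b).2 = o := by
    intro o
    by_contra hc
    push Not at hc
    obtain ⟨a, ha⟩ := exists_origin v
    obtain ⟨u, -, hu⟩ := all_next (t := true) (o := !o) hn hred hv ha (fun k => by
      have := hc ((K.dir true ^ k) a) (origin_pow ha k)
      cases o <;> simp_all)
    rw [hdeg] at hu
    have h5 := nz 5 (by norm_num) (by norm_num)
    have h10 := nz 10 (by norm_num) (by norm_num)
    push_cast at hu h5 h10
    cases o <;> cases u <;> simp only [shift, Bool.not_false, Bool.not_true] at hu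
    · exact h10 (by linear_combination -hu)
    · exact h10 (by linear_combination hu)
    · exact h5 (by linear_combination hu)
    · exact h5 (by linear_combination -hu)
  obtain ⟨b, hb, hbo⟩ := hmixed true
  obtain ⟨c, hc, hco⟩ := hmixed false
  obtain ⟨t, a, ha, h0, h4, h01⟩ := exists_start hn hred hv hb hbo hc
    (by rw [Outward, hco]; simp)
  have hper := pow_add_degree (t := t) ha 0
  rw [hdeg] at h4 hper
  have hall : ∀ d, K.origin d = v → ∃ k < 5, (K.dir t ^ k) a = d := fun d hd => by
    have := exists_pow_eq (t := t) ha hd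
    rwa [hdeg] at this
  have cr := corner_pow (t := t) hv ha
  have two := fun k => outward_iff_of_outward_ne (k := k) (t := t) hn hred hv ha
  set f : ℕ → K.Dart := fun k => (K.dir t ^ k) a with hf
  change K.Outward (f 0) at h0
  change ¬ K.Outward (f 4) at h4
  change K.OutNext (f 0) (f 1) at h01
  change f (0 + 5) = f 0 at hper
  simp only [zero_add] at hper
  change ∀ k, K.Corner t (f k) (f (k + 1)) at cr
  change ∀ k, (K.Outward (f k) ↔ ¬ K.Outward (f (k + 1))) →
    (K.Outward (f (k + 2)) ↔ K.Outward (f (k + 1))) at two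
  change ∀ d, K.origin d = v → ∃ k < 5, f k = d at hall
  have t1 := two 1
  have t2 := two 2
  have t3 := two 3
  simp only [Nat.reduceAdd, hper] at t1 t2 t3
  have h1 : K.Outward (f 1) := h01.2.2.1
  have h3 : ¬ K.Outward (f 3) := by tauto
  have c40 := cr 4
  simp only [Nat.reduceAdd, hper] at c40
  have s40 := spoke_of_consecutive c40.consecutive h4 h0
  obtain ⟨u, hu⟩ := exists_next (o := false) (cr 3).consecutive (by simpa [Outward] using h3)
    (by simpa [Outward] using h4)
  by_cases h2 : K.Outward (f 2)
  · exfalso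
    have h12 : K.OutNext (f 1) (f 2) := next_succ (o := true) (u := true) hn hred hv ha h01 h2
    have s32 := spoke_of_consecutive (cr 2).consecutive.symm h3 h2
    have e1 := h01.2.2.2
    have e2 := h12.2.2.2
    have e3 := s32.2.2.2
    have e4 := s40.2.2.2
    have e5 := hu.2.2.2
    have h5 := nz 5 (by norm_num) (by norm_num)
    have h3' := nz 3 (by norm_num) (by norm_num)
    push_cast at h5 h3'
    cases u <;> simp only [shift] at e5
    · exact h5 (by linear_combination -e1 - e2 + e3 - e4 - e5)
    · exact h3' (by linear_combination -e1 - e2 + e3 - e4 - e5)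
  · have s21 := spoke_of_consecutive (cr 1).consecutive.symm h2 h1
    obtain ⟨u', hu'⟩ := exists_next (o := false) (cr 2).consecutive (by simpa [Outward] using h2)
      (by simpa [Outward] using h3)
    have huu := next_succ hn hred hv ha hu' (by simpa [Outward] using h4)
    have : u' = true := by
      by_contra hc'
      rw [Bool.not_eq_true] at hc'
      subst hc'
      have e1 := h01.2.2.2
      have e2 := s21.2.2.2
      have e3 := hu'.2.2.2
      have e4 := huu.2.2.2
      have e5 := s40.2.2.2
      simp only [shift] at e3 e4
      exact four_ne_zero_of hn (by linear_combination -e1 + e2 - e3 - e4 - e5)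
    subst this
    refine ⟨t, f 2, f 3, f 4, f 0, f 1,
      ⟨cr 2, cr 3, c40, cr 0, cr 1, next_false_true.1 hu', next_false_true.1 huu, s40, h01, s21⟩, ?_⟩
    intro d hd
    obtain ⟨k, hk, rfl⟩ := hall d hd
    interval_cases k <;> simp

/-! ### The surroundings of a coloured edge -/

lemma star_of_firstIn (hn : 11 ≤ n) (hred : K.Reduced) (h5 : K.IsFive (K.origin b))
    (hb : K.FirstIn b) : ∃ t c₁ c₂ c₃ c₄, K.Star t b c₁ c₂ c₃ c₄ := by
  obtain ⟨t, c₀, c₁, c₂, c₃, c₄, hs, hall⟩ := exists_star hn hred h5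
  rcases hall b rfl with rfl | rfl | rfl | rfl | rfl
  · exact ⟨t, _, _, _, _, hs⟩
  · exact absurd hs.in₀ (hb.2 _)
  · exact absurd hs.in₁ (hb.2 _)
  · exact absurd hs.out.2.1 hb.1
  · exact absurd hs.out.2.2.1 hb.1

lemma star_of_lastOut (hn : 11 ≤ n) (hred : K.Reduced) (h5 : K.IsFive (K.origin a))
    (ha : K.LastOut a) : ∃ t c₀ c₁ c₂ c₃, K.Star t c₀ c₁ c₂ c₃ a := by
  obtain ⟨t, c₀, c₁, c₂, c₃, c₄, hs, hall⟩ := exists_star hn hred h5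
  rcases hall a rfl with rfl | rfl | rfl | rfl | rfl
  · exact absurd ha.1 hs.in₀.2.1
  · exact absurd ha.1 hs.in₁.2.1
  · exact absurd ha.1 hs.in₁.2.2.1
  · exact absurd hs.out (ha.2 _)
  · exact ⟨t, _, _, _, _, hs⟩

lemma star_of_inNext (hn : 11 ≤ n) (hred : K.Reduced) (h5 : K.IsFive (K.origin c))
    (hb : K.InNext b c) (hd : K.InNext c d) : ∃ t c₃ c₄, K.Star t b c d c₃ c₄ := by
  obtain ⟨t, c₀, c₁, c₂, c₃, c₄, hs, hall⟩ := exists_star hn hred h5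
  rcases hall c rfl with rfl | rfl | rfl | rfl | rfl
  · exact absurd hs.spoke' (not_spoke_of_inNext hn hb hs.in₀)
  · obtain rfl := InNext.left_unique hn hred hb hs.in₀
    obtain rfl := InNext.right_unique hn hred hd hs.in₁
    exact ⟨t, _, _, hs⟩
  · exact absurd hs.spoke (not_spoke_of_inNext hn hs.in₁ hd)
  · exact absurd hs.out.2.1 hd.2.1
  · exact absurd hs.out.2.2.1 hd.2.1

/-- A green edge lies between two inward edges of its final vertex. -/
lemma exists_inNext_of_greenAt (hn : 11 ≤ n) (hred : K.Reduced) (h : K.GreenAt a) :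
    ∃ p q, K.InNext p (K.rev a) ∧ K.InNext (K.rev a) q := by
  obtain ⟨t, c₀, c₁, c₂, c₃, hs⟩ := star_of_lastOut hn hred h.1 h.2.1
  obtain ⟨y, hy⟩ := triangle_of_outNext hn hs.corner₃ hs.out
  obtain ⟨z, hz⟩ := triangle_of_spoke hs.corner₄ hs.spoke'
  exact ⟨_, _, hz.inNext, hy.inNext⟩

/-- Consecutive inward edges `a`, `b` are not both green: the first outward edge of the 5 vertex of
`a` would end as the first inward edge of the 5 vertex of `b`. This makes it the second outward edge
of a corner, although it is next to an inward edge. -/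
lemma not_inNext_of_greenAt (hn : 11 ≤ n) (hred : K.Reduced) (h : K.GreenAt (K.rev a))
    (h' : K.GreenAt (K.rev b)) : ¬ K.InNext a b := by
  intro hab
  obtain ⟨t, c₀, c₁, c₂, c₃, hs⟩ := star_of_lastOut hn hred h.1 h.2.1
  obtain ⟨t', d₀, d₁, d₂, d₃, hs'⟩ := star_of_lastOut hn hred h'.1 h'.2.1
  obtain ⟨y, hy⟩ := triangle_of_outNext hn hs.corner₃ hs.out
  have hy' := hy.inNext
  rw [K.rev_rev] at hy'
  have hb := InNext.right_unique hn hred hab hy'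
  rw [hb, K.rev_rev] at hs'
  have h0 := Spoke.left_unique hn hred hs'.spoke' hy.spoke
  obtain ⟨x, hx⟩ := triangle_of_inNext hn hs'.corner₀ hs'.in₀
  have hx' := hx.outNext
  rw [h0, K.rev_rev] at hx'
  exact not_spoke_of_outNext hn hx' hs.out hs.spoke

/-- A blue edge is, at the vertex it starts from, the last outward edge, and next to a last inward
edge. -/
lemma exists_spoke_of_blueAt (hn : 11 ≤ n) (hred : K.Reduced) (h : K.BlueAt (K.rev a))
    (hv : K.Interior (K.origin a)) :
    ∃ i w p, K.Spoke i a ∧ K.InNext w i ∧ K.OutNext p a := by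
  obtain ⟨h5, b, d, hb, hbc, hcd, hd, z, hz, hzb⟩ := h
  obtain ⟨s, hs⟩ := hbc.1.exists_corner
  obtain ⟨x, hx⟩ := triangle_of_inNext hn hs hbc
  obtain rfl := OutNext.left_unique hn hred hzb hx.outNext
  obtain ⟨s', hs'⟩ := hcd.1.exists_corner
  obtain ⟨x', hx'⟩ := triangle_of_inNext hn hs' hcd
  have hsp := hx.spoke
  rw [K.rev_rev] at hsp
  have hp := hx'.outNext
  rw [K.rev_rev] at hp
  obtain ⟨r, hr⟩ := hsp.1.exists_corner
  have hw := corner_dir (t := !r) hv hsp.1.origin_eq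
  set w := K.dir (!r) (K.rev z)
  -- `w` is the other neighbour of the inward edge next to `a`
  refine ⟨_, w, _, hsp, ?_, hp⟩
  rcases consecutive_cases hw.consecutive with h | h | h | h | h | h
  · exact absurd h.2.1 hsp.2.1
  · exact absurd h.2.2.1 hsp.2.1
  · obtain ⟨y, hy⟩ := triangle_of_inNext hn hw h
    have := hy.outNext
    rw [K.rev_rev] at this
    exact absurd this (hz.2 _)
  · exact h
  · refine absurd ?_ (letter_ne_of_corner hn hred hr hw)
    rw [outward_iff.1 h.2.2.1, outward_iff.1 hsp.2.2.1, h.2.2.2, hsp.2.2.2]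
  · exact absurd h.2.2.1 hsp.2.1

/-- A yellow edge is the middle one of five consecutive outward edges `p, q, a, s, w`, and both `a`
and `s` end as first inward edges of 5 vertices: as the 5 vertex at the end of `a` colours no edge
green, its last outward edge leads to a 5 vertex, which is the end of `s`. -/
lemma exists_chain_of_yellowAt (hn : 11 ≤ n) (hred : K.Reduced) (h : K.YellowAt (K.rev a)) :
    ∃ p q s w, K.OutNext p q ∧ K.OutNext q a ∧ K.OutNext a s ∧ K.OutNext s w ∧
      K.FiveFirst (K.rev a) ∧ K.FiveFirst (K.rev s) := by
  obtain ⟨h5, hf, hcol, p, q, s, w, hpq, hqa, has, hsw⟩ := h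
  rw [K.rev_rev] at hqa has
  obtain ⟨t, c₁, c₂, c₃, c₄, hst⟩ := star_of_firstIn hn hred h5 hf
  refine ⟨p, q, s, w, hpq, hqa, has, hsw, ⟨h5, t, _, _, _, _, hst⟩, ?_⟩
  obtain ⟨r, hr⟩ := has.1.exists_corner
  obtain ⟨y, hy⟩ := triangle_of_outNext hn hr has
  obtain rfl := Spoke.right_unique hn hred hst.spoke' hy.spoke
  have ho : K.origin c₄ = K.origin (K.rev a) := hst.spoke'.1.origin_eq.symm
  have h5' : K.IsFive (K.origin (K.rev c₄)) := by
    by_contra hc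
    refine (hcol c₄ ho).2 ⟨by rw [ho]; exact h5, ⟨hst.out.2.2.1, ?_⟩, ?_, hc⟩
    · exact fun y hy => not_spoke_of_outNext hn hst.out hy hst.spoke'
    · intro c hc
      exact (hcol c (hc.trans ho)).1
  have hin := hy.inNext
  have ho' := hin.1.origin_eq
  rw [← ho'] at h5'
  refine ⟨h5', ?_⟩
  obtain ⟨t', d₀, d₁, d₂, d₃, d₄, hst', hall⟩ := exists_star hn hred h5'
  rcases hall _ rfl with h | h | h | h | h
  · rw [h]; exact ⟨t', _, _, _, _, hst'⟩
  · exfalso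
    obtain ⟨x, hx⟩ := triangle_of_inNext hn hst'.corner₀ hst'.in₀
    rw [← h, K.rev_rev] at hx
    exact not_spoke_of_outNext hn has hsw hx.spoke
  · rw [h] at hin
    exact absurd hst'.spoke (not_spoke_of_inNext hn hst'.in₁ hin)
  · rw [h] at hin
    exact absurd hst'.out.2.1 hin.2.1
  · rw [h] at hin
    exact absurd hst'.out.2.2.1 hin.2.1

/-- The outward edge `a` two places before a blue edge `c` is not yellow. Otherwise the edge from the
end of `b` to the end of `c` would be the last outward edge of one 5 vertex and the last inward edge
of another one; but there it bounds a corner with an outward edge, which makes it the first of two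
outward edges where it starts. -/
lemma not_yellowAt_of_blueAt (hn : 11 ≤ n) (hred : K.Reduced) (h : K.BlueAt (K.rev c))
    (hab : K.OutNext a b) (hbc : K.OutNext b c) : ¬ K.YellowAt (K.rev a) := by
  intro hy
  obtain ⟨p, q, s, w, -, -, has, -, -, -, t', d₁, d₂, d₃, d₄, hst'⟩ :=
    exists_chain_of_yellowAt hn hred hy
  obtain rfl := OutNext.right_unique hn hred hab has
  obtain ⟨h5, e₀, e₂, -, he₀, he₂, -⟩ := h
  obtain ⟨t, c₃, c₄, hst⟩ := star_of_inNext hn hred h5 he₀ he₂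
  obtain ⟨r, hr⟩ := hbc.1.exists_corner
  obtain ⟨y, hy⟩ := triangle_of_outNext hn hr hbc
  obtain rfl := InNext.right_unique hn hred hst.in₁ hy.inNext
  have h4 := Spoke.right_unique hn hred hst'.spoke' hy.spoke
  obtain ⟨z, hz⟩ := triangle_of_spoke hst.corner₂.symm hst.spoke
  have hz' := hz.outNext
  rw [K.rev_rev] at hz'
  have h3 := hst'.out
  rw [h4] at h3
  exact not_spoke_of_outNext hn h3 hz' hy.spoke

end VanKampenDiagram
end Fibonacci

namespace Fibonacci

/-! ### A part of the spherical diagram around the north pole -/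

namespace SDFace

variable {n : ℕ}

open Classical in
/-- The set of faces of `SDn` which consists of the caps `C` and of the triangles of the two belts
at the upper vertices `F`: around `upper a` these are `upperBelt a`, `upperBelt (a - 2)` and
`lowerBelt a`. -/
noncomputable def belt (C F : Finset (ZMod n)) : Finset (SDFace n) :=
  C.image cap ∪ ((F ∪ F.image (· - 2)).image upperBelt ∪ F.image lowerBelt)

variable {C F : Finset (ZMod n)} {a b c : ZMod n}

lemma cap_mem_belt : cap a ∈ belt C F ↔ a ∈ C := by
  classical
  simp [belt]

lemma upperBelt_mem_belt : upperBelt a ∈ belt C F ↔ a ∈ F ∨ a + 2 ∈ F := by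
  classical
  simp [belt, sub_eq_iff_eq_add]

lemma lowerBelt_mem_belt : lowerBelt a ∈ belt C F ↔ a ∈ F := by
  classical
  simp [belt]

lemma base_notMem_belt : base a ∉ belt C F := by
  classical
  simp [belt]

lemma card_belt [DecidableEq (ZMod n)] :
    (belt C F).card = C.card + ((F ∪ F.image (· - 2)).card + F.card) := by
  classical
  unfold belt
  rw [Finset.card_union_of_disjoint, Finset.card_union_of_disjoint,
    Finset.card_image_of_injective, Finset.card_image_of_injective, Finset.card_image_of_injective]
  · congr!
  · intro x y h; injection h
  · intro x y h; injection h
  · intro x y h; injection h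
  · rw [Finset.disjoint_left]; intro f hf hf'
    simp only [Finset.mem_image] at hf hf'
    obtain ⟨x, -, rfl⟩ := hf
    obtain ⟨y, -, h⟩ := hf'
    cases h
  · rw [Finset.disjoint_left]; intro f hf hf'
    simp only [Finset.mem_union, Finset.mem_image] at hf hf'
    obtain ⟨x, -, rfl⟩ := hf
    rcases hf' with ⟨y, -, h⟩ | ⟨y, -, h⟩ <;> cases h

lemma exists_two_mul (hodd : Odd n) (a : ZMod n) : ∃ k < n, a = 2 * (k : ZMod n) := by
  obtain ⟨m, rfl⟩ := hodd
  refine ⟨(a * (m + 1 : ℕ)).val, ZMod.val_lt _, ?_⟩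
  rw [ZMod.natCast_val, ZMod.cast_id]
  have : ((2 * m + 1 : ℕ) : ZMod (2 * m + 1)) = 0 := ZMod.natCast_self _
  push_cast at this ⊢
  linear_combination -a * this

/-- If at most one cap `c` is missing, the belt is a simply connected subdiagram: its faces hang on
the caps, which form a path because 2 generates `ZMod n`, and the faces of the complement hang on the
bases, which share the south pole. -/
lemma isSubdiagram_belt (hodd : Odd n) (hn : 11 ≤ n) (hc : ∀ a, a ≠ c → a ∈ C)
    (hF : ∀ a ∈ F, a ∈ C ∧ a + 2 ∈ C) : IsSubdiagram (belt C F) := by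
  have h2 := two_ne_zero_of hn
  have h4 := four_ne_zero_of hn
  constructor
  · have hroot : cap (c + 2) ∈ belt C F := cap_mem_belt.2 (hc _ (by simpa using h2))
    set G := (edgeGraph n).induce (belt C F : Set (SDFace n)) with hG
    have adj : ∀ {f g : SDFace n} (hf : f ∈ belt C F) (hg : g ∈ belt C F), f ≠ g → ∀ p q,
        f.edge p = g.edge q → G.Reachable ⟨f, hf⟩ ⟨g, hg⟩ := by
      intro f g hf hg hfg p q he
      refine SimpleGraph.Adj.reachable ?_
      simp only [hG, SimpleGraph.comap_adj, edgeGraph, SimpleGraph.fromRel_adj]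
      exact ⟨hfg, Or.inl ⟨p, q, he⟩⟩
    have hchain : ∀ k : ℕ, k + 1 < n → ∀ hk : cap (c + 2 * ((k + 1 : ℕ) : ZMod n)) ∈ belt C F,
        G.Reachable ⟨_, hroot⟩ ⟨_, hk⟩ := by
      intro k
      induction k with
      | zero =>
        intro _ hk
        have : cap (c + 2) = cap (c + 2 * ((0 + 1 : ℕ) : ZMod n)) := by simp
        simp only [← this]
        exact SimpleGraph.Reachable.refl _
      | succ k ih =>
        intro hkn hk
        have hm : cap (c + 2 * ((k + 1 : ℕ) : ZMod n)) ∈ belt C F := by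
          refine cap_mem_belt.2 (hc _ ?_)
          intro h
          rw [add_eq_left] at h
          have h' : ((2 * (k + 1) : ℕ) : ZMod n) = 0 := by push_cast at h ⊢; exact h
          rw [ZMod.natCast_eq_zero_iff] at h'
          have := (Nat.coprime_two_right.2 hodd).dvd_of_dvd_mul_left h'
          exact absurd (Nat.le_of_dvd (by omega) this) (by omega)
        refine (ih (by omega) hm).trans (adj hm hk ?_ 2 0 ?_)
        · intro h
          injection h with h
          push_cast at h
          exact h2 (by linear_combination -h)
        · simp only [edge, corner, Matrix.cons_val, Prod.mk.injEq, true_and]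
          congr 1
          push_cast
          ring
    have hcap : ∀ a, ∀ ha : cap a ∈ belt C F, G.Reachable ⟨_, hroot⟩ ⟨_, ha⟩ := by
      intro a ha
      by_cases hac : a = c
      · subst hac
        refine adj hroot ha ?_ 0 2 ?_
        · intro h
          injection h with h
          exact h2 (by linear_combination h)
        · simp [edge, corner]
      · obtain ⟨k, hkn, hk⟩ := exists_two_mul hodd (a - c)
        obtain ⟨k, rfl⟩ : ∃ j, k = j + 1 := ⟨k - 1, by
          have : k ≠ 0 := by
            rintro rfl
            exact hac (by linear_combination hk)
          omega⟩
        obtain rfl : a = c + 2 * ((k + 1 : ℕ) : ZMod n) := by linear_combination hk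
        exact hchain k hkn ha
    have hup : ∀ a, ∀ ha : upperBelt a ∈ belt C F, G.Reachable ⟨_, hroot⟩ ⟨_, ha⟩ := by
      intro a ha
      have hm : cap (a + 2) ∈ belt C F := by
        rw [cap_mem_belt]
        rcases upperBelt_mem_belt.1 ha with h | h
        · exact (hF a h).2
        · exact (hF _ h).1
      refine (hcap _ hm).trans (adj hm ha (by simp) 1 2 ?_)
      simp [edge, corner]
    have hroots : ∀ f : (belt C F : Set (SDFace n)), G.Reachable ⟨_, hroot⟩ f := by
      rintro ⟨f, hf⟩
      have hf' : f ∈ belt C F := hf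
      cases f with
      | cap a => exact hcap a hf
      | upperBelt a => exact hup a hf
      | lowerBelt a =>
        have hm : upperBelt a ∈ belt C F := upperBelt_mem_belt.2 (Or.inl (lowerBelt_mem_belt.1 hf))
        exact (hup a hm).trans (adj hm hf (by simp) 0 1 (by simp [edge, corner]))
      | base a => exact absurd hf' base_notMem_belt
    exact fun f g => (hroots f).symm.trans (hroots g)
  · have hm : ∀ {f : SDFace n}, f ∉ belt C F → f ∈ ((belt C F : Set (SDFace n))ᶜ) := fun h => h
    set G := (vertexGraph n).induce ((belt C F : Set (SDFace n))ᶜ) with hG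
    have adj : ∀ {f g : SDFace n} (hf : f ∉ belt C F) (hg : g ∉ belt C F), ∀ p q,
        f.corner p = g.corner q → G.Reachable ⟨f, hm hf⟩ ⟨g, hm hg⟩ := by
      intro f g hf hg p q he
      by_cases hfg : f = g
      · subst hfg; exact SimpleGraph.Reachable.refl _
      refine SimpleGraph.Adj.reachable ?_
      simp only [hG, SimpleGraph.comap_adj, vertexGraph, SimpleGraph.fromRel_adj]
      exact ⟨hfg, Or.inl ⟨p, q, he⟩⟩
    have hbase : ∀ a, G.Reachable ⟨base 0, hm base_notMem_belt⟩ ⟨base a, hm base_notMem_belt⟩ :=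
      fun a => adj base_notMem_belt base_notMem_belt 0 0 rfl
    have hlow : ∀ a, ∀ ha : lowerBelt a ∉ belt C F,
        G.Reachable ⟨base 0, hm base_notMem_belt⟩ ⟨_, hm ha⟩ := fun a ha =>
      (hbase a).trans (adj base_notMem_belt ha 2 2 rfl)
    have hroots : ∀ f : ((belt C F : Set (SDFace n))ᶜ : Set (SDFace n)),
        G.Reachable ⟨base 0, hm base_notMem_belt⟩ f := by
      rintro ⟨f, hf⟩
      have hf' : f ∉ belt C F := hf
      cases f with
      | cap a =>
        have ha : lowerBelt a ∉ belt C F := fun h =>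
          hf' (cap_mem_belt.2 (hF a (lowerBelt_mem_belt.1 h)).1)
        exact (hlow a ha).trans (adj ha hf' 1 2 rfl)
      | upperBelt a => exact (hbase a).trans (adj base_notMem_belt hf' 2 1 rfl)
      | lowerBelt a => exact hlow a hf'
      | base a => exact hbase a
    exact fun f g => (hroots f).symm.trans (hroots g)

end SDFace

namespace VanKampenDiagram

open LabelledMap SDFace

variable {n : ℕ} {K : VanKampenDiagram n} {t t' : Bool}

/-- A 5 vertex with first inward edge `rev d` has the direction of the two triangles at `d`, and its
second inward and its last outward edge are sides of these. -/
lemma star_between_caps (hn : 11 ≤ n) (hred : K.Reduced) {d d₀ d₁ y₀ y₁ c₁ c₂ c₃ c₄ : K.Dart}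
    (h₀ : K.Triangle t d₀ y₀ d) (h₁ : K.Triangle t d y₁ d₁)
    (hs : K.Star t' (K.rev d) c₁ c₂ c₃ c₄) : t' = t ∧ c₁ = K.rev y₀ ∧ c₄ = y₁ := by
  have e1 := InNext.right_unique hn hred hs.in₀ h₀.inNext
  have e4 := Spoke.right_unique hn hred hs.spoke' h₁.spoke
  refine ⟨?_, e1, e4⟩
  by_contra hc
  have : t' = !t := by cases t <;> cases t' <;> simp_all
  subst this
  have := h₀.target.right_unique (corner_not.1 hs.corner₄)
  rw [← e1] at this
  exact hs.in₀.2.2.1 (this ▸ hs.out.2.2.1)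

/-- Two triangles with a common edge which induce opposite orientations on it lie on its two
sides. -/
lemma side_eq_rev {x y z x' y' z' : K.Dart} (h : K.Triangle t x y z) (h' : K.Triangle t' x' y' z')
    (p q : Fin 3) (hpq : ![x, y, z] p = ![x', y', z'] q) (ht : t = t' ↔ ¬ (p = 2 ↔ q = 2)) :
    K.side (Triangle.src t x z) p = K.rev (K.side (Triangle.src t' x' z') q) := by
  rw [h.side_src, h'.side_src]
  fin_cases p <;> fin_cases q <;> cases t <;> cases t' <;>
    simp at ht hpq ⊢ <;> simp [hpq, K.rev_rev]

/-- A spherically reduced diagram contains no large part of `SDn` around a pole: `e` lists outward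
edges of a vertex by their labels, `C` caps between these, and `F` edges that end as first inward
edges of 5 vertices. By `hsep`, no triangle of the upper belt coincides with the cap that carries the same
relator. -/
theorem card_le_of_sphericallyReduced [DecidableEq (ZMod n)] (hodd : Odd n) (hn : 11 ≤ n)
    (hred : K.Reduced) (hsph : K.SphericallyReduced) (t : Bool) (e : ZMod n → K.Dart)
    (C F : Finset (ZMod n)) (c : ZMod n)
    (he : ∀ a, K.letter (e a) = (a, true)) (hC : ∀ a ∈ C, K.Corner t (e (a - 2)) (e a))
    (hc : ∀ a, a ≠ c → a ∈ C) (hF : ∀ a ∈ F, a ∈ C ∧ a + 2 ∈ C ∧ K.FiveFirst (K.rev (e a)))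
    (hsep : ∀ a ∈ C, a - 1 ∈ F ∨ a + 1 ∈ F →
      a + 2 ∈ C ∨ K.origin (K.rev (e (a - 1))) ≠ K.origin (e a)) :
    C.card + ((F ∪ F.image (· - 2)).card + F.card) ≤ 2 * n := by
  by_contra! hcard
  rw [← card_belt] at hcard
  refine hsph _ (isSubdiagram_belt hodd hn hc fun a ha => ⟨(hF a ha).1, (hF a ha).2.1⟩) hcard ?_
  -- the remaining sides of the triangles; the values outside of the belt do not matter
  have hcap : ∀ a, ∃ y, a ∈ C → K.Triangle t (e (a - 2)) y (e a) := by
    intro a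
    by_cases ha : a ∈ C
    · obtain ⟨y, hy⟩ := triangle_of_outNext hn (hC a ha) ⟨(hC a ha).consecutive,
        by rw [Outward, he], by rw [Outward, he], by rw [he, he]; ring⟩
      exact ⟨y, fun _ => hy⟩
    · exact ⟨e a, fun h => absurd h ha⟩
  choose y hy using hcap
  have hstar : ∀ a ∈ F, ∃ c₂ c₃, K.Star t (K.rev (e a)) (K.rev (y a)) c₂ c₃ (y (a + 2)) := by
    intro a ha
    obtain ⟨h0, h1, -, t', c₁, c₂, c₃, c₄, hs⟩ := hF a ha
    have h2 := hy _ h1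
    rw [add_sub_cancel_right] at h2
    obtain ⟨rfl, rfl, rfl⟩ := star_between_caps hn hred (hy _ h0) h2 hs
    exact ⟨c₂, c₃, hs⟩
  have hupper : ∀ a, ∃ x w, a ∈ F ∨ a + 2 ∈ F → K.Triangle t x w (y (a + 2)) := by
    intro a
    by_cases ha : a ∈ F
    · obtain ⟨c₂, c₃, hs⟩ := hstar a ha
      obtain ⟨w, hw⟩ := triangle_of_outNext hn hs.corner₃ hs.out
      exact ⟨_, w, fun _ => hw⟩
    · by_cases ha' : a + 2 ∈ F
      · obtain ⟨c₂, c₃, hs⟩ := hstar _ ha'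
        obtain ⟨x, hx⟩ := triangle_of_inNext hn hs.corner₁ hs.in₁
        rw [K.rev_rev] at hx
        exact ⟨x, _, fun _ => hx⟩
      · exact ⟨e a, e a, fun h => by tauto⟩
  choose x w hxw using hupper
  have hlower : ∀ a, ∃ z, a ∈ F → K.Triangle (!t) (w (a - 2)) (x a) z := by
    intro a
    by_cases ha : a ∈ F
    · obtain ⟨c₂, c₃, hs⟩ := hstar a ha
      have h1 := hxw a (Or.inl ha)
      have h2 := hxw (a - 2) (Or.inr (by rwa [sub_add_cancel]))
      rw [sub_add_cancel] at h2
      have e3 : c₃ = x a := hs.corner₃.left_unique h1.source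
      have e2 : c₂ = K.rev (w (a - 2)) := hs.corner₁.right_unique h2.target
      obtain ⟨z, hz⟩ := triangle_of_spoke hs.corner₂.symm hs.spoke
      rw [e2, K.rev_rev, e3] at hz
      exact ⟨z, fun _ => hz⟩
    · exact ⟨e a, fun h => absurd h ha⟩
  choose z hz using hlower
  let flag : SDFace n → Bool
    | cap _ => t
    | upperBelt _ => t
    | lowerBelt _ => !t
    | base _ => t
  let tri : SDFace n → Fin 3 → K.Dart
    | cap a => ![e (a - 2), y a, e a]
    | upperBelt a => ![x a, w a, y (a + 2)]
    | lowerBelt a => ![w (a - 2), x a, z a]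
    | base a => ![e a, e a, e a]
  have htri : ∀ f ∈ belt C F, K.Triangle (flag f) (tri f 0) (tri f 1) (tri f 2) ∧
      (K.letter (tri f 0)).1 = f.index := by
    intro f hf
    have hx : ∀ a, (a ∈ F ∨ a + 2 ∈ F) → (K.letter (x a)).1 = a - 1 := by
      intro a ha
      have h1 := (hxw a ha).letter_z
      have h2 : a + 2 ∈ C := by
        rcases ha with h | h
        · exact (hF _ h).2.1
        · exact (hF _ h).1
      have h3 := (hy _ h2).letter_y
      rw [he, add_sub_cancel_right] at h3
      rw [h3] at h1
      linear_combination -congrArg Prod.fst h1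
    cases f with
    | cap a =>
      refine ⟨hy a (cap_mem_belt.1 hf), ?_⟩
      change (K.letter (e (a - 2))).1 = a - 2
      rw [he]
    | upperBelt a => exact ⟨hxw a (upperBelt_mem_belt.1 hf), hx a (upperBelt_mem_belt.1 hf)⟩
    | lowerBelt a =>
      have ha := lowerBelt_mem_belt.1 hf
      refine ⟨hz a ha, ?_⟩
      have ha' : a - 2 ∈ F ∨ a - 2 + 2 ∈ F := Or.inr (by rwa [sub_add_cancel])
      change (K.letter (w (a - 2))).1 = a - 2
      rw [(hxw _ ha').letter_y, hx _ ha']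
      ring
    | base a => exact absurd hf base_notMem_belt
  -- faces of the belt with a common edge have the same dart on it, on opposite sides
  have hshare : ∀ f g p q, f ≠ g → f.edge p = g.edge q → f ∈ belt C F → g ∈ belt C F →
      tri f p = tri g q ∧ ((flag f = flag g) ↔ ¬ ((p = 2) ↔ (q = 2))) := by
    intro f g p q hfg hpq hf hg
    cases f <;> cases g
    all_goals first
      | exact absurd hf base_notMem_belt
      | exact absurd hg base_notMem_belt
      | skip
    all_goals fin_cases p <;> fin_cases q <;> simp [edge, corner] at hpq
    all_goals first
      | exact absurd (congrArg _ hpq) hfg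
      | exact ⟨by simp [tri, hpq], by cases t <;> simp [flag]⟩
  refine ⟨fun f => Triangle.src (flag f) (tri f 0) (tri f 2), ?_, ?_, ?_⟩
  · intro f hf g hg hfg
    obtain ⟨tf, lf⟩ := htri f hf
    obtain ⟨tg, lg⟩ := htri g hg
    obtain ⟨e1, e2, -, e3⟩ := tf.src_injective tg hfg
    rw [e2, lg] at lf
    -- different faces of the belt with the same flag and index are a cap and an upper triangle
    have hsep' : ∀ a b, cap a ∈ belt C F → upperBelt b ∈ belt C F → tri (cap a) 2 =
        tri (upperBelt b) 2 → (cap a).index = (upperBelt b).index → False := by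
      intro a b ha hb h3 h0
      change e a = y (b + 2) at h3
      change a - 2 = b - 1 at h0
      obtain rfl : b = a - 1 := by linear_combination -h0
      have hb' := upperBelt_mem_belt.1 hb
      have e1 : a - 1 + 2 = a + 1 := by ring
      have e2 : a + 1 - 2 = a - 1 := by ring
      rw [e1] at hb' h3
      have h1 : a + 1 ∈ C := by
        rcases hb' with h | h
        · have := (hF _ h).2.1
          rwa [e1] at this
        · exact (hF _ h).1
      have hm := (hy _ h1).middle
      rw [← h3, e2] at hm
      rcases hsep a (cap_mem_belt.1 ha) hb' with h | h
      · have h5 := hC _ h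
        rw [add_sub_cancel_right] at h5
        have h6 := congrArg K.letter (hm.right_unique h5)
        rw [K.letter_rev, he, he] at h6
        simp at h6
      · exact h hm.consecutive.origin_eq.symm
    cases f <;> cases g <;> simp only [index] at lf
    all_goals first
      | exact absurd hf base_notMem_belt
      | exact absurd hg base_notMem_belt
      | (exfalso; revert e1; cases t <;> simp [flag]; done)
      | exact (hsep' _ _ hf hg e3 lf.symm).elim
      | exact (hsep' _ _ hg hf e3.symm lf).elim
      | (congr 1; linear_combination -lf)
  · intro f hf
    obtain ⟨tf, lf⟩ := htri f hf
    refine ⟨tf.isSource, ?_⟩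
    rw [← lf]
    exact tf.faceLabel_src
  · intro f hf g hg hfg p q hpq
    obtain ⟨h1, h2⟩ := hshare f g p q hfg hpq hf hg
    refine side_eq_rev (htri f hf).1 (htri g hg).1 p q ?_ h2
    have key : ∀ f p, ![tri f 0, tri f 1, tri f 2] p = tri f p := by
      intro f p
      fin_cases p <;> rfl
    rw [key, key, h1]

end VanKampenDiagram
end Fibonacci

namespace Fibonacci
namespace VanKampenDiagram

open LabelledMap

variable {n : ℕ} {K : VanKampenDiagram n} {t o u : Bool} {a b c d : K.Dart} {v : K.Vertex}

/-! ### Coloured edges at a vertex that is not a 5 vertex -/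

lemma blue_iff (h : K.origin d = v) (h5 : ¬ K.IsFive v) : K.Blue d ↔ K.BlueAt (K.rev d) :=
  or_iff_right fun hb => h5 (h ▸ hb.1)

lemma green_iff (h : K.origin d = v) (h5 : ¬ K.IsFive v) : K.Green d ↔ K.GreenAt (K.rev d) :=
  or_iff_right fun hb => h5 (h ▸ hb.1)

lemma yellow_iff (h : K.origin d = v) (h5 : ¬ K.IsFive v) : K.Yellow d ↔ K.YellowAt (K.rev d) :=
  or_iff_right fun hb => h5 (h ▸ hb.1)

lemma exists_inNext_of_green (hn : 11 ≤ n) (hred : K.Reduced) (h : K.origin d = v)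
    (h5 : ¬ K.IsFive v) (hg : K.Green d) : ∃ p q, K.InNext p d ∧ K.InNext d q := by
  rw [green_iff h h5] at hg
  have := exists_inNext_of_greenAt hn hred hg
  rwa [K.rev_rev] at this

lemma not_green_of_outward (hn : 11 ≤ n) (hred : K.Reduced) (h : K.origin d = v)
    (h5 : ¬ K.IsFive v) (hd : K.Outward d) : ¬ K.Green d := fun hg => by
  obtain ⟨p, q, hp, -⟩ := exists_inNext_of_green hn hred h h5 hg
  exact hp.2.2.1 hd

lemma exists_spoke_of_blue (hn : 11 ≤ n) (hred : K.Reduced) (hv : K.Interior v)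
    (h : K.origin d = v) (h5 : ¬ K.IsFive v) (hb : K.Blue d) :
    ∃ i w p, K.Spoke i d ∧ K.InNext w i ∧ K.OutNext p d := by
  rw [blue_iff h h5] at hb
  exact exists_spoke_of_blueAt hn hred hb (h ▸ hv)

lemma exists_chain_of_yellow (hn : 11 ≤ n) (hred : K.Reduced)
    (h : K.origin d = v) (h5 : ¬ K.IsFive v) (hy : K.Yellow d) :
    ∃ p q s w, K.OutNext p q ∧ K.OutNext q d ∧ K.OutNext d s ∧ K.OutNext s w ∧
      K.FiveFirst (K.rev d) ∧ K.FiveFirst (K.rev s) := by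
  rw [yellow_iff h h5] at hy
  exact exists_chain_of_yellowAt hn hred hy

/-- Blue and yellow edges are outward at the vertex which does not colour them. -/
lemma uncoloured_iff_of_not_outward (hn : 11 ≤ n) (hred : K.Reduced) (hv : K.Interior v)
    (h : K.origin d = v) (h5 : ¬ K.IsFive v) (hd : ¬ K.Outward d) :
    K.Uncoloured d ↔ ¬ K.Green d := by
  refine ⟨fun hu => hu.2.1, fun hg => ⟨fun hb => ?_, hg, fun hy => ?_⟩⟩
  · obtain ⟨i, w, p, hs, -⟩ := exists_spoke_of_blue hn hred hv h h5 hb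
    exact hd hs.2.2.1
  · obtain ⟨p, q, s, w, -, hq, -⟩ := exists_chain_of_yellow hn hred h h5 hy
    exact hd hq.2.2.1

lemma uncoloured_iff_of_outward (hn : 11 ≤ n) (hred : K.Reduced)
    (h : K.origin d = v) (h5 : ¬ K.IsFive v) (hd : K.Outward d) :
    K.Uncoloured d ↔ ¬ K.Blue d ∧ ¬ K.Yellow d :=
  ⟨fun hu => ⟨hu.1, hu.2.2⟩, fun hu => ⟨hu.1, not_green_of_outward hn hred h h5 hd, hu.2⟩⟩

/-! ### Long outward sequences have few yellow edges -/

/-- The labels of `n` consecutive outward edges are distinct, so they index these edges. -/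
lemma exists_listing (hodd : Odd n) (f : ℕ → K.Dart)
    (hout : ∀ k, k + 1 < n → K.OutNext (f k) (f (k + 1))) (h0 : K.Outward (f 0)) :
    ∃ e : ZMod n → K.Dart, (∀ a, K.letter (e a) = (a, true)) ∧
      ∀ k < n, e ((K.letter (f 0)).1 + 2 * (k : ZMod n)) = f k := by
  have hlab : ∀ k < n, (K.letter (f k)).1 = (K.letter (f 0)).1 + 2 * (k : ZMod n) := by
    intro k hk
    have := label_of_run (o := true) (u := true) (f := f) (p := 0) (q := n)
      (fun k _ hk => hout k hk) k (by omega)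
    rw [zero_add] at this
    rw [this, shift, mul_comm]
  have hlet : ∀ k < n, K.letter (f k) = ((K.letter (f 0)).1 + 2 * (k : ZMod n), true) := by
    intro k hk
    have ho : K.Outward (f k) := by
      cases k with
      | zero => exact h0
      | succ k => exact (hout k hk).2.2.1
    rw [outward_iff.1 ho, hlab k hk]
  choose pos hpos hpos' using fun a : ZMod n =>
    SDFace.exists_two_mul hodd (a - (K.letter (f 0)).1)
  refine ⟨fun a => f (pos a), fun a => ?_, fun k hk => ?_⟩
  · rw [hlet _ (hpos a), ← hpos' a, add_sub_cancel]
  · have h1 := hpos' ((K.letter (f 0)).1 + 2 * (k : ZMod n))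
    rw [add_sub_cancel_left] at h1
    have h2 : ((2 * k : ℕ) : ZMod n) =
        ((2 * pos ((K.letter (f 0)).1 + 2 * (k : ZMod n)) : ℕ) : ZMod n) := by
      push_cast; exact h1
    rw [ZMod.natCast_eq_natCast_iff] at h2
    have h3 := Nat.ModEq.cancel_left_of_coprime (Nat.coprime_two_right.2 hodd) h2
    exact congrArg f (Nat.ModEq.eq_of_lt_of_lt h3 hk (hpos _)).symm

lemma listing_injOn (hodd : Odd n) (l : ZMod n) :
    Set.InjOn (fun k : ℕ => l + 2 * (k : ZMod n)) (Set.Iio n) := by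
  intro i hi j hj hij
  have h2 : ((2 * i : ℕ) : ZMod n) = ((2 * j : ℕ) : ZMod n) := by
    push_cast; exact add_left_cancel hij
  rw [ZMod.natCast_eq_natCast_iff] at h2
  have h3 := Nat.ModEq.cancel_left_of_coprime (Nat.coprime_two_right.2 hodd) h2
  exact Nat.ModEq.eq_of_lt_of_lt h3 hi hj

/-- A proper nonempty set of labels is not closed under subtracting 2, which generates `ZMod n` for
odd `n`. -/
lemma card_lt_card_union [DecidableEq (ZMod n)] [Fintype (ZMod n)] (hodd : Odd n)
    {A : Finset (ZMod n)} (hA : A.Nonempty) (hA' : A ≠ Finset.univ) :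
    A.card < (A ∪ A.image (· - 2)).card := by
  refine Finset.card_lt_card (Finset.ssubset_iff_subset_ne.2 ⟨Finset.subset_union_left, ?_⟩)
  intro h
  apply hA'
  obtain ⟨x, hx⟩ := hA
  have hcl : ∀ k : ℕ, x - 2 * (k : ZMod n) ∈ A := by
    intro k
    induction k with
    | zero => simpa using hx
    | succ k ih =>
      rw [h]
      refine Finset.mem_union_right _ (Finset.mem_image.2 ⟨_, ih, ?_⟩)
      push_cast; ring
  refine Finset.eq_univ_iff_forall.2 fun y => ?_
  obtain ⟨k, -, hk⟩ := SDFace.exists_two_mul hodd (x - y)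
  have := hcl k
  rwa [← hk, sub_sub_cancel] at this

/-- An outward sequence of length at least `n` is not yellow up to its ends. Otherwise `n - 1` caps
and the belt triangles at `n - 4` 5 vertices would match more than `2n` faces of `SDn`. -/
lemma not_all_yellow (hodd : Odd n) (hn : 11 ≤ n) (hred : K.Reduced) (hsph : K.SphericallyReduced)
    (hv : K.Interior v) (h5 : ¬ K.IsFive v) (h : K.origin a = v)
    (hout : ∀ k, k + 1 < n → K.OutNext ((K.dir t ^ k) a) ((K.dir t ^ (k + 1)) a))
    (hy : ∀ k, 2 ≤ k → k + 4 ≤ n → K.Yellow ((K.dir t ^ k) a)) : False := by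
  classical
  have : NeZero n := ⟨by omega⟩
  have hor := fun k => origin_pow (t := t) h k
  have hcr := fun k => corner_pow (t := t) hv h k
  set f : ℕ → K.Dart := fun k => (K.dir t ^ k) a with hf
  change ∀ k, k + 1 < n → K.OutNext (f k) (f (k + 1)) at hout
  change ∀ k, 2 ≤ k → k + 4 ≤ n → K.Yellow (f k) at hy
  change ∀ k, K.origin (f k) = v at hor
  change ∀ k, K.Corner t (f k) (f (k + 1)) at hcr
  obtain ⟨e, he, hef⟩ := exists_listing hodd f hout (hout 0 (by omega)).2.1
  set l := (K.letter (f 0)).1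
  have hinj := listing_injOn hodd l
  have hne : ∀ k, 0 < k → k < n → l + 2 * (k : ZMod n) ≠ l := by
    intro k h0 hk hc
    have := @hinj k hk 0 (by simp; omega) (by simpa using hc)
    omega
  have hsurj : ∀ a : ZMod n, ∃ k < n, a = l + 2 * (k : ZMod n) := by
    intro a
    obtain ⟨k, hk, h⟩ := SDFace.exists_two_mul hodd (a - l)
    exact ⟨k, hk, by linear_combination h⟩
  have hfive : ∀ k, 2 ≤ k → k + 3 ≤ n → K.FiveFirst (K.rev (f k)) := by
    intro k h2 h3
    by_cases h4 : k + 4 ≤ n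
    · obtain ⟨-, -, -, -, -, -, -, -, h', -⟩ := exists_chain_of_yellow hn hred (hor k) h5 (hy k h2 h4)
      exact h'
    · obtain ⟨k, rfl⟩ : ∃ j, k = j + 1 := ⟨k - 1, by omega⟩
      obtain ⟨-, -, s, -, -, -, hs, -, -, h'⟩ :=
        exists_chain_of_yellow hn hred (hor k) h5 (hy k (by omega) (by omega))
      rwa [OutNext.right_unique hn hred (hout k (by omega)) hs]
  set L : ℕ → ZMod n := fun k => l + 2 * (k : ZMod n) with hL
  -- the yellow edges and the one after them end as first inward edges of 5 vertices
  set F := (Finset.Ico 2 (n - 2)).image L with hFdef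
  have hLF : ∀ k, 2 ≤ k → k + 3 ≤ n → L k ∈ F := fun k h2 h3 =>
    Finset.mem_image_of_mem _ (Finset.mem_Ico.2 ⟨h2, by omega⟩)
  have hcard := card_le_of_sphericallyReduced hodd hn hred hsph t e (Finset.univ.erase l) F l he
    ?_ ?_ ?_ ?_
  · have c1 : (Finset.univ.erase l).card = n - 1 := by
      rw [Finset.card_erase_of_mem (Finset.mem_univ _), Finset.card_univ, ZMod.card]
    have c2 : F.card = n - 4 := by
      rw [hFdef, Finset.card_image_of_injOn, Nat.card_Ico]
      · omega
      · refine hinj.mono fun k hk => ?_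
        simp only [Finset.coe_Ico, Set.mem_Ico] at hk
        simp only [Set.mem_Iio]
        omega
    have c3 : n - 3 ≤ (F ∪ F.image (· - 2)).card := by
      have : ((Finset.Ico 1 (n - 2)).image L).card = n - 3 := by
        rw [Finset.card_image_of_injOn, Nat.card_Ico]
        · omega
        · refine hinj.mono fun k hk => ?_
          simp only [Finset.coe_Ico, Set.mem_Ico] at hk
          simp only [Set.mem_Iio]
          omega
      rw [← this]
      refine Finset.card_le_card fun x hx => ?_
      obtain ⟨k, hk, rfl⟩ := Finset.mem_image.1 hx
      rw [Finset.mem_Ico] at hk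
      rw [Finset.mem_union]
      by_cases hk2 : 2 ≤ k
      · exact Or.inl (hLF k hk2 (by omega))
      · refine Or.inr (Finset.mem_image.2 ⟨L (k + 1), hLF _ (by omega) (by omega), ?_⟩)
        simp only [hL]; push_cast; ring
    omega
  · intro a ha
    obtain ⟨k, hk, rfl⟩ := hsurj a
    have hk0 : k ≠ 0 := by
      rintro rfl
      simp at ha
    obtain ⟨k, rfl⟩ : ∃ j, k = j + 1 := ⟨k - 1, by omega⟩
    have e1 : l + 2 * ((k + 1 : ℕ) : ZMod n) - 2 = l + 2 * (k : ZMod n) := by push_cast; ring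
    rw [e1, hef _ hk, hef _ (by omega)]
    exact hcr k
  · intro a ha
    exact Finset.mem_erase.2 ⟨ha, Finset.mem_univ _⟩
  · intro a ha
    obtain ⟨k, hk, rfl⟩ := Finset.mem_image.1 ha
    rw [Finset.mem_Ico] at hk
    have e1 : L k + 2 = l + 2 * ((k + 1 : ℕ) : ZMod n) := by simp only [hL]; push_cast; ring
    refine ⟨Finset.mem_erase.2 ⟨hne k (by omega) (by omega), Finset.mem_univ _⟩,
      Finset.mem_erase.2 ⟨?_, Finset.mem_univ _⟩, ?_⟩
    · rw [e1]; exact hne _ (by omega) (by omega)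
    · rw [hef k (by omega)]
      exact hfive k hk.1 (by omega)
  · intro a _ _
    by_cases ha2 : a + 2 = l
    · right
      obtain ⟨m, hm⟩ := hodd
      -- the edge with label `a - 1` lies in the middle of the sequence
      have hn0 : ((2 * m + 1 : ℕ) : ZMod n) = 0 := by rw [← hm]; exact ZMod.natCast_self n
      have e1 : a - 1 = l + 2 * ((m - 1 : ℕ) : ZMod n) := by
        rw [Nat.cast_sub (by omega)]
        push_cast at hn0 ⊢
        linear_combination ha2 - hn0
      obtain ⟨k, hk, hak⟩ := hsurj a
      rw [e1, hef _ (by omega), hak, hef k hk, hor k]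
      intro hc
      exact h5 (hc ▸ (hfive (m - 1) (by omega) (by omega)).1)
    · exact Or.inl (Finset.mem_erase.2 ⟨ha2, Finset.mem_univ _⟩)

end VanKampenDiagram
end Fibonacci

namespace Fibonacci
namespace VanKampenDiagram

open LabelledMap

variable {n : ℕ} {K : VanKampenDiagram n} {t o u : Bool} {a b c d : K.Dart} {v : K.Vertex}

/-! ### Vertices all of whose edges are outward, or all inward -/

lemma exists_all_next (hn : 11 ≤ n) (hred : K.Reduced) (hv : K.Interior v)
    (ho : ∀ d, K.origin d = v → (K.letter d).2 = o) :
    ∃ t a, K.origin a = v ∧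
      (∀ k, K.Next o true ((K.dir t ^ k) a) ((K.dir t ^ (k + 1)) a)) ∧
      (K.degree v : ZMod n) * shift n o true = 0 := by
  obtain ⟨a, ha⟩ := exists_origin v
  obtain ⟨u, hu, hL⟩ := all_next (t := true) hn hred hv ha fun k => ho _ (origin_pow ha k)
  cases u
  · have hb : K.origin (K.dir true a) = v := origin_pow (t := true) ha 1
    obtain ⟨u, hu', hL'⟩ := all_next (t := false) hn hred hv hb fun k => ho _ (origin_pow hb k)
    have h0 : K.Next o false a (K.dir true a) := hu 0
    have h1 : K.Next o u (K.dir true a) (K.dir false (K.dir true a)) := hu' 0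
    rw [show K.dir false (K.dir true a) = a from dir_not true a] at h1
    have : u = true := by
      by_contra hc
      rw [Bool.not_eq_true] at hc
      subst hc
      have e0 := h0.2.2.2
      have e1 := h1.2.2.2
      cases o <;> simp only [shift] at e0 e1
      · exact two_ne_zero_of hn (by linear_combination -e0 - e1)
      · exact four_ne_zero_of hn (by linear_combination e0 + e1)
    subst this
    exact ⟨false, _, hb, hu', hL'⟩
  · exact ⟨true, a, ha, hu, hL⟩

lemma dvd_degree (hodd : Odd n) (hL : (K.degree v : ZMod n) * shift n o true = 0) :
    n ∣ K.degree v := by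
  rw [← ZMod.natCast_eq_zero_iff]
  cases o <;> simp only [shift] at hL
  · linear_combination -hL
  · have : ((2 * K.degree v : ℕ) : ZMod n) = 0 := by push_cast; linear_combination hL
    rw [ZMod.natCast_eq_zero_iff] at this ⊢
    exact (Nat.coprime_two_right.2 hodd).dvd_of_dvd_mul_left this

lemma uncolouredCount_add (f : ℕ → K.Dart) {p q r : ℕ} (hpq : p ≤ q) (hqr : q ≤ r) :
    uncolouredCount f p r = uncolouredCount f p q + uncolouredCount f q r := by
  classical
  unfold uncolouredCount
  rw [← Finset.card_union_of_disjoint, ← Finset.filter_union, Finset.Ico_union_Ico_eq_Ico hpq hqr]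
  exact Finset.disjoint_filter_filter (Finset.Ico_disjoint_Ico_consecutive p q r)

lemma card_filter_yellow [DecidablePred fun d : K.Dart => K.Yellow d] (f : ℕ → K.Dart)
    (hf : ∀ k, K.Uncoloured (f k) ↔ ¬ K.Yellow (f k)) (p q : ℕ) :
    ((Finset.Ico p q).filter fun k => K.Yellow (f k)).card + uncolouredCount f p q = q - p := by
  classical
  unfold uncolouredCount
  simp only [hf]
  rw [← Finset.card_union_of_disjoint (Finset.disjoint_filter_filter_not _ _ _),
    Finset.filter_union_filter_not_eq, Nat.card_Ico]

/-- Among `n` consecutive edges of a vertex with outward edges only, at least four are uncoloured.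
Otherwise `n - 1` caps and the belt triangles at `n - 5` or more 5 vertices, at least
`3n - 10 > 2n` faces in all, would match faces of `SDn`. -/
lemma four_le_uncolouredCount (hodd : Odd n) (hn : 11 ≤ n) (hred : K.Reduced)
    (hsph : K.SphericallyReduced) (hv : K.Interior v) (h5 : ¬ K.IsFive v) (h : K.origin a = v)
    (ho : ∀ d, K.origin d = v → K.Outward d)
    (hout : ∀ k, K.OutNext ((K.dir t ^ k) a) ((K.dir t ^ (k + 1)) a))
    (hunc : ∀ d, K.origin d = v → (K.Uncoloured d ↔ ¬ K.Yellow d)) :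
    4 ≤ uncolouredCount (fun k => (K.dir t ^ k) a) 0 n := by
  classical
  by_contra! hcount
  have : NeZero n := ⟨by omega⟩
  have hor := fun k => origin_pow (t := t) h k
  have hcr := fun k => corner_pow (t := t) hv h k
  set f : ℕ → K.Dart := fun k => (K.dir t ^ k) a with hf
  change ∀ k, K.OutNext (f k) (f (k + 1)) at hout
  change ∀ k, K.origin (f k) = v at hor
  change ∀ k, K.Corner t (f k) (f (k + 1)) at hcr
  obtain ⟨e, he, hef⟩ := exists_listing hodd f (fun k _ => hout k) (hout 0).2.1
  set l := (K.letter (f 0)).1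
  have hinj := listing_injOn hodd l
  have hsurj : ∀ a : ZMod n, ∃ k < n, a = l + 2 * (k : ZMod n) := by
    intro a
    obtain ⟨k, hk, h⟩ := SDFace.exists_two_mul hodd (a - l)
    exact ⟨k, hk, by linear_combination h⟩
  have hne : ∀ k, 0 < k → k < n → l + 2 * (k : ZMod n) ≠ l := by
    intro k h0 hk hc
    have := @hinj k hk 0 (by simp; omega) (by simpa using hc)
    omega
  set L : ℕ → ZMod n := fun k => l + 2 * (k : ZMod n) with hL
  set S := (Finset.Ico 1 (n - 1)).filter fun k => K.Yellow (f k) with hS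
  have hSn : ∀ k ∈ S, 1 ≤ k ∧ k + 1 < n ∧ K.Yellow (f k) := by
    intro k hk
    rw [hS, Finset.mem_filter, Finset.mem_Ico] at hk
    exact ⟨hk.1.1, by omega, hk.2⟩
  have hScard : n ≤ S.card + 5 := by
    have h1 := card_filter_yellow f (fun k => hunc _ (hor k)) 1 (n - 1)
    have h2 := uncolouredCount_add f (p := 0) (q := 1) (r := n) (by omega) (by omega)
    have h3 := uncolouredCount_add f (p := 1) (q := n - 1) (r := n) (by omega) (by omega)
    rw [← hS] at h1
    omega
  have hFcard : (S.image L).card = S.card := Finset.card_image_of_injOn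
    (hinj.mono fun k hk => by have := hSn k hk; simp only [Set.mem_Iio]; omega)
  have hcard := card_le_of_sphericallyReduced hodd hn hred hsph t e (Finset.univ.erase l)
    (S.image L) l he ?_ ?_ ?_ ?_
  · have c1 : (Finset.univ.erase l).card = n - 1 := by
      rw [Finset.card_erase_of_mem (Finset.mem_univ _), Finset.card_univ, ZMod.card]
    have c3 : (S.image L).card < (S.image L ∪ (S.image L).image (· - 2)).card := by
      refine card_lt_card_union hodd (Finset.card_pos.1 (by omega)) ?_
      intro hc
      obtain ⟨k, hk, hkl⟩ := Finset.mem_image.1 (hc ▸ Finset.mem_univ l)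
      have := hSn k hk
      exact hne k (by omega) (by omega) hkl
    omega
  · intro a ha
    obtain ⟨k, hk, rfl⟩ := hsurj a
    have hk0 : k ≠ 0 := by
      rintro rfl
      simp at ha
    obtain ⟨k, rfl⟩ : ∃ j, k = j + 1 := ⟨k - 1, by omega⟩
    have e1 : l + 2 * ((k + 1 : ℕ) : ZMod n) - 2 = l + 2 * (k : ZMod n) := by push_cast; ring
    rw [e1, hef _ hk, hef _ (by omega)]
    exact hcr k
  · intro a ha
    exact Finset.mem_erase.2 ⟨ha, Finset.mem_univ _⟩
  · intro a ha
    obtain ⟨k, hk, rfl⟩ := Finset.mem_image.1 ha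
    obtain ⟨hk1, hkn, hky⟩ := hSn k hk
    have e1 : L k + 2 = l + 2 * ((k + 1 : ℕ) : ZMod n) := by simp only [hL]; push_cast; ring
    refine ⟨Finset.mem_erase.2 ⟨hne k (by omega) (by omega), Finset.mem_univ _⟩,
      Finset.mem_erase.2 ⟨?_, Finset.mem_univ _⟩, ?_⟩
    · rw [e1]; exact hne _ (by omega) (by omega)
    · rw [hef k (by omega)]
      obtain ⟨-, -, -, -, -, -, -, -, h', -⟩ := exists_chain_of_yellow hn hred (hor k) h5 hky
      exact h'
  · intro a _ _
    right
    intro hc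
    obtain ⟨k, hk, hak⟩ := hsurj a
    rw [hak, hef k hk, hor k] at hc
    exact outward_rev.1 (ho _ hc) (by rw [Outward, he])

/-- A vertex with outward edges only is a deg-7 vertex. If its degree is a proper multiple of `n`,
two disjoint stretches of `n` edges contribute four uncoloured edges each. If its degree is `n`, the
caps close up, and `n - 6` yellow edges or more lead to at least `n - 5` 5 vertices. -/
lemma seven_le_of_all_outward (hodd : Odd n) (hn : 11 ≤ n) (hred : K.Reduced)
    (hsph : K.SphericallyReduced) (hv : K.Interior v) (h5 : ¬ K.IsFive v)
    (ho : ∀ d, K.origin d = v → K.Outward d) : 7 ≤ K.uncolouredDegree v := by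
  classical
  have : NeZero n := ⟨by omega⟩
  have hunc : ∀ d, K.origin d = v → (K.Uncoloured d ↔ ¬ K.Yellow d) := by
    intro d hd
    rw [uncoloured_iff_of_outward hn hred hd h5 (ho d hd), and_iff_right]
    intro hb
    obtain ⟨i, -, -, hi, -⟩ := exists_spoke_of_blue hn hred hv hd h5 hb
    exact hi.2.1 (ho i (hi.1.origin_eq.trans hd))
  obtain ⟨t, a, ha, hout, hL⟩ := exists_all_next hn hred hv ho
  rw [uncolouredDegree_eq (t := t) ha]
  obtain ⟨m, hm⟩ := dvd_degree hodd hL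
  have hLpos := degree_pos v
  by_cases hm1 : m = 1
  · rw [hm1, mul_one] at hm
    rw [hm]
    by_contra! hcount
    have hor := fun k => origin_pow (t := t) ha k
    have hcr := fun k => corner_pow (t := t) hv ha k
    have hper := pow_add_degree (t := t) ha 0
    rw [hm, zero_add] at hper
    set f : ℕ → K.Dart := fun k => (K.dir t ^ k) a with hf
    change ∀ k, K.OutNext (f k) (f (k + 1)) at hout
    change ∀ k, K.origin (f k) = v at hor
    change ∀ k, K.Corner t (f k) (f (k + 1)) at hcr
    change f n = f 0 at hper
    obtain ⟨e, he, hef⟩ := exists_listing hodd f (fun k _ => hout k) (hout 0).2.1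
    set l := (K.letter (f 0)).1
    have hinj := listing_injOn hodd l
    have hsurj : ∀ a : ZMod n, ∃ k < n, a = l + 2 * (k : ZMod n) := by
      intro a
      obtain ⟨k, hk, h⟩ := SDFace.exists_two_mul hodd (a - l)
      exact ⟨k, hk, by linear_combination h⟩
    have hefn : ∀ k ≤ n, e (l + 2 * (k : ZMod n)) = f k := by
      intro k hk
      rcases hk.lt_or_eq with h | rfl
      · exact hef k h
      · rw [hper, ← hef 0 (by omega)]; simp
    have hcor : ∀ a, K.Corner t (e (a - 2)) (e a) := by
      intro a
      obtain ⟨k, hk, hak⟩ := hsurj (a - 2)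
      have : a = l + 2 * ((k + 1 : ℕ) : ZMod n) := by push_cast; linear_combination hak
      rw [hak, hef k hk, this, hefn _ (by omega)]
      exact hcr k
    set Y := Finset.univ.filter fun a => K.Yellow (e a) with hY
    set F := Finset.univ.filter fun a => K.FiveFirst (K.rev (e a)) with hF
    have hYcard : n ≤ Y.card + 6 := by
      have h1 := card_filter_yellow f (fun k => hunc _ (hor k)) 0 n
      have h2 : (((Finset.Ico 0 n).filter fun k => K.Yellow (f k)).image
          fun k : ℕ => l + 2 * (k : ZMod n)).card ≤ Y.card := by
        refine Finset.card_le_card fun x hx => ?_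
        obtain ⟨k, hk, rfl⟩ := Finset.mem_image.1 hx
        rw [Finset.mem_filter, Finset.mem_Ico] at hk
        rw [hY, Finset.mem_filter, hef k hk.1.2]
        exact ⟨Finset.mem_univ _, hk.2⟩
      rw [Finset.card_image_of_injOn] at h2
      · omega
      · refine hinj.mono fun k hk => ?_
        simp only [Finset.coe_filter, Finset.mem_Ico, Set.mem_ofPred_eq] at hk
        exact hk.1.2
    have hea : ∀ a, K.origin (e a) = v := by
      intro a
      obtain ⟨k, hk, rfl⟩ := hsurj a
      rw [hef k hk]; exact hor k
    have hYF : Y.image (· + 2) ∪ (Y.image (· + 2)).image (· - 2) ⊆ F := by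
      have hcons : ∀ x ∈ Y, K.FiveFirst (K.rev (e x)) ∧ K.FiveFirst (K.rev (e (x + 2))) := by
        intro x hx
        rw [hY, Finset.mem_filter] at hx
        obtain ⟨-, -, s, -, -, -, hs, -, h1, h2⟩ := exists_chain_of_yellow hn hred (hea x) h5 hx.2
        refine ⟨h1, ?_⟩
        have h3 := hcor (x + 2)
        rw [add_sub_cancel_right] at h3
        have : K.OutNext (e x) (e (x + 2)) := ⟨h3.consecutive, by rw [Outward, he],
          by rw [Outward, he], by rw [he, he]⟩
        rwa [OutNext.right_unique hn hred this hs]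
      intro x hx
      rw [hF, Finset.mem_filter]
      refine ⟨Finset.mem_univ _, ?_⟩
      simp only [Finset.mem_union, Finset.mem_image] at hx
      rcases hx with ⟨y, hy, rfl⟩ | ⟨-, ⟨y, hy, rfl⟩, rfl⟩
      · exact (hcons y hy).2
      · rw [add_sub_cancel_right]; exact (hcons y hy).1
    have hZcard : (Y.image (· + 2)).card = Y.card :=
      Finset.card_image_of_injective _ (add_left_injective 2)
    have hle : ∀ A : Finset (ZMod n), A.card ≤ n := fun A => by
      have := Finset.card_le_univ A
      rwa [ZMod.card] at this
    have grow : ∀ A : Finset (ZMod n), A.Nonempty →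
        A.card = n ∨ A.card < (A ∪ A.image (· - 2)).card := by
      intro A hA
      by_cases hA' : A = Finset.univ
      · left; rw [hA', Finset.card_univ, ZMod.card]
      · exact Or.inr (card_lt_card_union hodd hA hA')
    have hcard := card_le_of_sphericallyReduced hodd hn hred hsph t e Finset.univ F l he
      (fun a _ => hcor a) (fun a _ => Finset.mem_univ a)
      (fun a ha => ⟨Finset.mem_univ _, Finset.mem_univ _, (Finset.mem_filter.1 ha).2⟩)
      (fun a _ _ => Or.inl (Finset.mem_univ _))
    rw [Finset.card_univ, ZMod.card] at hcard
    have g1 := grow (Y.image (· + 2)) (Finset.card_pos.1 (by omega))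
    have g2 := Finset.card_le_card hYF
    have g3 : (Y.image (· + 2)).card ≤ F.card :=
      (Finset.card_le_card Finset.subset_union_left).trans g2
    have g4 := grow F (Finset.card_pos.1 (by omega))
    have g5 : F.card ≤ (F ∪ F.image (· - 2)).card := Finset.card_le_card Finset.subset_union_left
    omega
  · have hm2 : 2 ≤ m := by
      have : m ≠ 0 := by
        rintro rfl
        omega
      omega
    have h2n : n * 2 ≤ n * m := Nat.mul_le_mul_left n hm2
    have h1 := four_le_uncolouredCount hodd hn hred hsph hv h5 ha ho hout hunc
    have hpow : ∀ k, (K.dir t ^ k) ((K.dir t ^ n) a) = (K.dir t ^ (n + k)) a := fun k => by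
      rw [← Equiv.Perm.mul_apply, ← pow_add, add_comm]
    have h2 := four_le_uncolouredCount (t := t) hodd hn hred hsph hv h5 (origin_pow (t := t) ha n) ho
      (fun k => by rw [hpow, hpow]; exact hout (n + k)) hunc
    have h3 : uncolouredCount (fun k => (K.dir t ^ k) ((K.dir t ^ n) a)) 0 n =
        uncolouredCount (fun k => (K.dir t ^ k) a) n (n + n) := by
      unfold uncolouredCount
      simp only [hpow]
      refine Finset.card_bij (fun k _ => n + k) ?_ (fun i _ j _ hij => by omega) ?_
      · intro k hk
        rw [Finset.mem_filter, Finset.mem_Ico] at hk ⊢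
        exact ⟨by omega, hk.2⟩
      · intro k hk
        rw [Finset.mem_filter, Finset.mem_Ico] at hk
        obtain ⟨j, rfl⟩ : ∃ j, k = n + j := ⟨k - n, by omega⟩
        refine ⟨j, ?_, rfl⟩
        rw [Finset.mem_filter, Finset.mem_Ico]
        exact ⟨by omega, hk.2⟩
    have h4 := uncolouredCount_add (fun k => (K.dir t ^ k) a) (p := 0) (q := n) (r := n + n)
      (by omega) (by omega)
    have h6 := uncolouredCount_add (fun k => (K.dir t ^ k) a) (p := 0) (q := n + n)
      (r := K.degree v) (by omega) (by omega)
    omega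

end VanKampenDiagram
end Fibonacci

namespace Fibonacci
namespace VanKampenDiagram

open LabelledMap

variable {n : ℕ} {K : VanKampenDiagram n} {t o u : Bool} {a b c d e : K.Dart} {v : K.Vertex}

/-! ### Counting uncoloured edges -/

lemma le_uncolouredCount (f : ℕ → K.Dart) {p q : ℕ} (S : Finset ℕ)
    (hS : ∀ k ∈ S, p ≤ k ∧ k < q ∧ K.Uncoloured (f k)) : S.card ≤ uncolouredCount f p q := by
  classical
  unfold uncolouredCount
  refine Finset.card_le_card fun k hk => ?_
  obtain ⟨h1, h2, h3⟩ := hS k hk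
  exact Finset.mem_filter.2 ⟨Finset.mem_Ico.2 ⟨h1, h2⟩, h3⟩

lemma mem_of_uncolouredCount_le (f : ℕ → K.Dart) {p q : ℕ} (S : Finset ℕ)
    (hS : ∀ k ∈ S, p ≤ k ∧ k < q ∧ K.Uncoloured (f k)) (hcard : uncolouredCount f p q ≤ S.card)
    {k : ℕ} (hpk : p ≤ k) (hkq : k < q) (hk : K.Uncoloured (f k)) : k ∈ S := by
  by_contra hkS
  have := le_uncolouredCount f (insert k S) (p := p) (q := q) (by
    intro j hj
    rcases Finset.mem_insert.1 hj with rfl | hj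
    · exact ⟨hpk, hkq, hk⟩
    · exact hS j hj)
  rw [Finset.card_insert_of_notMem hkS] at this
  omega

/-- If no two consecutive edges are coloured, about half of them are uncoloured. -/
lemma le_two_mul_uncolouredCount (f : ℕ → K.Dart) {p q : ℕ}
    (h : ∀ k, p ≤ k → k + 1 < q → K.Uncoloured (f k) ∨ K.Uncoloured (f (k + 1))) :
    q ≤ p + 2 * uncolouredCount f p q + 1 := by
  induction q using Nat.strong_induction_on with
  | _ q ih =>
    by_cases hq : q ≤ p + 1
    · omega
    obtain ⟨q, rfl⟩ : ∃ j, q = j + 2 := ⟨q - 2, by omega⟩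
    have h1 := ih q (by omega) fun k hk hkq => h k hk (by omega)
    have h2 := uncolouredCount_add f (p := p) (q := q) (r := q + 2) (by omega) (by omega)
    have h3 : 1 ≤ uncolouredCount f q (q + 2) := by
      rcases h q (by omega) (by omega) with hu | hu
      · exact le_uncolouredCount f {q} (by simp [hu])
      · exact le_uncolouredCount f {q + 1} (by simp [hu])
    omega

/-- An inward edge next to an outward edge is not green. -/
lemma uncoloured_of_spoke (hn : 11 ≤ n) (hred : K.Reduced) (hv : K.Interior v)
    (h5 : ¬ K.IsFive v) (h : K.origin d = v) (hs : K.Spoke d e) : K.Uncoloured d := by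
  rw [uncoloured_iff_of_not_outward hn hred hv h h5 hs.2.1]
  intro hg
  obtain ⟨p, q, hp, hq⟩ := exists_inNext_of_green hn hred h h5 hg
  exact not_spoke_of_inNext hn hp hq hs

lemma not_yellow_of_spoke (hn : 11 ≤ n) (hred : K.Reduced) (h5 : ¬ K.IsFive v)
    (h : K.origin d = v) (hs : K.Spoke e d) : ¬ K.Yellow d := by
  intro hy
  obtain ⟨-, q, s, -, -, hq, hs', -⟩ := exists_chain_of_yellow hn hred h h5 hy
  exact not_spoke_of_outNext hn hq hs' hs

lemma not_yellow_of_consecutive_spoke (hn : 11 ≤ n) (hred : K.Reduced) (h5 : ¬ K.IsFive v)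
    (h : K.origin d = v) (hc : K.Consecutive d c) (hs : K.Spoke e c) : ¬ K.Yellow d := by
  intro hy
  obtain ⟨p, q, s, w, hp, hq, hs', hw, -⟩ := exists_chain_of_yellow hn hred h h5 hy
  rcases hc.pigeonhole hq.1.symm hs'.1 with rfl | rfl | rfl
  · exact not_spoke_of_outNext hn hp hq hs
  · exact not_spoke_of_outNext hn hs' hw hs
  · exact OutNext.asymm hn hq hs'

lemma blue_of_spoke (hn : 11 ≤ n) (hred : K.Reduced) (h5 : ¬ K.IsFive v)
    (h : K.origin d = v) (hs : K.Spoke e d) (hd : ¬ K.Uncoloured d) : K.Blue d := by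
  rw [uncoloured_iff_of_outward hn hred h h5 hs.2.2.1] at hd
  by_contra hb
  exact hd ⟨hb, not_yellow_of_spoke hn hred h5 h hs⟩

/-- A first outward edge is neither blue nor yellow. -/
lemma uncoloured_of_spoke_outNext (hn : 11 ≤ n) (hred : K.Reduced) (hv : K.Interior v)
    (h5 : ¬ K.IsFive v) (h : K.origin d = v) (hs : K.Spoke e d) (hc : K.OutNext d c) :
    K.Uncoloured d := by
  by_contra hd
  obtain ⟨-, -, p, -, -, hp⟩ :=
    exists_spoke_of_blue hn hred hv h h5 (blue_of_spoke hn hred h5 h hs hd)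
  exact not_spoke_of_outNext hn hp hc hs

/-- An outward edge between two outward edges is not blue. -/
lemma uncoloured_iff_of_outNext (hn : 11 ≤ n) (hred : K.Reduced) (hv : K.Interior v)
    (h5 : ¬ K.IsFive v) (h : K.origin d = v) (hb : K.OutNext b d) (hc : K.OutNext d c) :
    K.Uncoloured d ↔ ¬ K.Yellow d := by
  rw [uncoloured_iff_of_outward hn hred h h5 hb.2.2.1, and_iff_right]
  intro hbl
  obtain ⟨i, -, -, hs, -⟩ := exists_spoke_of_blue hn hred hv h h5 hbl
  exact not_spoke_of_outNext hn hb hc hs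

/-- If the last outward edge is blue, it is next to the last inward edge, not the first. -/
lemma not_inNext_of_blue (hn : 11 ≤ n) (hred : K.Reduced) (hv : K.Interior v)
    (h5 : ¬ K.IsFive v) (h : K.origin d = v) (hb : K.Blue d) (hs : K.Spoke e d) :
    ¬ K.InNext e c := by
  intro hc
  obtain ⟨i, w, -, hs', hw, -⟩ := exists_spoke_of_blue hn hred hv h h5 hb
  rw [Spoke.left_unique hn hred hs' hs] at hw
  exact not_spoke_of_inNext hn hw hc hs

lemma uncoloured_or_uncoloured (hn : 11 ≤ n) (hred : K.Reduced) (hv : K.Interior v)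
    (h5 : ¬ K.IsFive v) (h : K.origin d = v) (hc : K.InNext d c) :
    K.Uncoloured d ∨ K.Uncoloured c := by
  have h' : K.origin c = v := hc.1.origin_eq.symm.trans h
  rw [uncoloured_iff_of_not_outward hn hred hv h h5 hc.2.1,
    uncoloured_iff_of_not_outward hn hred hv h' h5 hc.2.2.1, ← not_and_or]
  rintro ⟨hd, hc'⟩
  rw [green_iff h h5] at hd
  rw [green_iff h' h5] at hc'
  exact not_inNext_of_greenAt hn hred hd hc' hc

/-- An inward sequence of length `i` has at least `(i + 1) / 2` uncoloured edges. -/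
lemma le_uncolouredCount_inward (hn : 11 ≤ n) (hred : K.Reduced) (hv : K.Interior v)
    (h5 : ¬ K.IsFive v) (f : ℕ → K.Dart) (hf : ∀ k, K.origin (f k) = v) {p q : ℕ} (hpq : p + 2 ≤ q)
    (hrun : ∀ k, p ≤ k → k + 1 < q → K.Next false u (f k) (f (k + 1)))
    (hp : K.Spoke (f p) d) (hq : K.Spoke (f (q - 1)) e) :
    q + 1 ≤ p + 2 * uncolouredCount f p q := by
  have h1 := le_two_mul_uncolouredCount f (p := p + 1) (q := q - 1) (by
    intro k hk hkq
    have := hrun k (by omega) (by omega)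
    cases u
    · exact (uncoloured_or_uncoloured hn hred hv h5 (hf _) (next_false_false.1 this)).symm
    · exact uncoloured_or_uncoloured hn hred hv h5 (hf _) (next_false_true.1 this))
  have up := uncoloured_of_spoke hn hred hv h5 (hf _) hp
  have uq := uncoloured_of_spoke hn hred hv h5 (hf _) hq
  have h2 := uncolouredCount_add f (p := p) (q := p + 1) (r := q) (by omega) (by omega)
  have h3 := uncolouredCount_add f (p := p + 1) (q := q - 1) (r := q) (by omega) (by omega)
  have h4 : 1 ≤ uncolouredCount f p (p + 1) := le_uncolouredCount f {p} (by simp [up])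
  have h5 : 1 ≤ uncolouredCount f (q - 1) q :=
    le_uncolouredCount f {q - 1} (by simp [uq]; omega)
  omega

/-- A vertex with inward edges only has at least seven uncoloured edges, or it is of type 5G. -/
lemma of_all_inward (hodd : Odd n) (hn : 11 ≤ n) (hred : K.Reduced)
    (hv : K.Interior v) (h5 : ¬ K.IsFive v) (ho : ∀ d, K.origin d = v → ¬ K.Outward d) :
    7 ≤ K.uncolouredDegree v ∨ K.uncolouredDegree v = 6 ∧ K.IsFiveG v := by
  classical
  obtain ⟨t, a, ha, hin, hL⟩ := exists_all_next (o := false) hn hred hv fun d hd => by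
    simpa [Outward] using ho d hd
  obtain ⟨m, hm⟩ := dvd_degree hodd hL
  have hLpos := degree_pos v
  have hLn : n ≤ K.degree v := Nat.le_of_dvd hLpos ⟨m, hm⟩
  have hpow : ∀ i k, (K.dir t ^ k) ((K.dir t ^ i) a) = (K.dir t ^ (i + k)) a := fun i k => by
    rw [← Equiv.Perm.mul_apply, ← pow_add, add_comm]
  have hper := fun k => pow_add_degree (t := t) ha k
  have hor := fun k => origin_pow (t := t) ha k
  -- counted from an uncoloured edge on, at least half of the edges are uncoloured
  have hbound : K.degree v ≤ 2 * K.uncolouredDegree v := by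
    obtain ⟨i, hi⟩ : ∃ i, K.Uncoloured ((K.dir t ^ i) a) := by
      rcases uncoloured_or_uncoloured hn hred hv h5 (hor 0) (next_false_true.1 (hin 0)) with h | h
      · exact ⟨0, h⟩
      · exact ⟨1, h⟩
    rw [uncolouredDegree_eq (t := t) (hor i)]
    set f : ℕ → K.Dart := fun k => (K.dir t ^ k) ((K.dir t ^ i) a) with hf
    have h1 := le_two_mul_uncolouredCount f (p := 1) (q := K.degree v) (by
      intro k _ _
      refine uncoloured_or_uncoloured hn hred hv h5 (v := v) ?_ ?_
      · simp only [hf, hpow]; exact hor _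
      · simp only [hf, hpow]; exact next_false_true.1 (hin (i + k)))
    have h2 := uncolouredCount_add f (p := 0) (q := 1) (r := K.degree v) (by omega) (by omega)
    have h3 : 1 ≤ uncolouredCount f 0 1 := le_uncolouredCount f {0} (by simpa [hf] using hi)
    omega
  by_cases h7 : 7 ≤ K.uncolouredDegree v
  · exact Or.inl h7
  right
  have hn11 : n = 11 := by
    obtain ⟨j, hj⟩ := hodd
    omega
  have hdeg : K.degree v = 11 := by
    have : m = 1 := by
      rcases Nat.lt_or_ge m 2 with h | h
      · interval_cases m <;> omega
      · have := Nat.mul_le_mul_left n h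
        omega
    rw [hm, this, hn11]
  refine ⟨by omega, hn11, ?_⟩
  have hU : K.uncolouredDegree v = 6 := by omega
  -- the indicator of the green edges, indexed around the vertex
  set g : ℕ → ℕ := fun k => if K.Uncoloured ((K.dir t ^ k) a) then 0 else 1 with hg
  have hg1 : ∀ k, g k + g (k + 1) ≤ 1 := by
    intro k
    simp only [hg]
    rcases uncoloured_or_uncoloured hn hred hv h5 (hor k) (next_false_true.1 (hin k)) with h | h
    · rw [if_pos h]; split_ifs <;> simp
    · rw [if_pos h]; split_ifs <;> simp
  have hgper : ∀ k, g (k + 11) = g k := by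
    intro k
    simp only [hg]
    rw [← hdeg, hper]
  have hsum : g 0 + g 1 + g 2 + g 3 + g 4 + g 5 + g 6 + g 7 + g 8 + g 9 + g 10 = 5 := by
    have h1 : (∑ k ∈ Finset.range 11, g k) + K.uncolouredDegree v = 11 := by
      rw [uncolouredDegree_eq (t := t) ha, hdeg, uncolouredCount, Finset.card_filter,
        ← Finset.range_eq_Ico, ← Finset.sum_add_distrib]
      rw [Finset.sum_congr rfl (g := fun _ => 1)]
      · simp
      · intro k _
        simp only [hg]
        split_ifs <;> rfl
    rw [hU] at h1
    simp only [Finset.sum_range_succ, Finset.sum_range_zero] at h1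
    omega
  -- the number of edges is odd, so two consecutive ones are uncoloured
  obtain ⟨i, hi⟩ : ∃ i, g (i + 10) = 0 ∧ g (i + 11) = 0 := by
    by_contra! hc
    have hc' : ∀ k, g k + g (k + 1) = 1 := by
      intro k
      have h1 := hc (k + 1)
      have h2 := hg1 k
      have e1 : g (k + 1 + 10) = g k := hgper k
      have e2 : g (k + 1 + 11) = g (k + 1) := hgper (k + 1)
      rw [e1, e2] at h1
      omega
    have := hgper 0
    have h0 := hc' 0
    have h1 := hc' 1
    have h2 := hc' 2
    have h3 := hc' 3
    have h4 := hc' 4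
    have h5 := hc' 5
    have h6 := hc' 6
    have h7 := hc' 7
    have h8 := hc' 8
    have h9 := hc' 9
    have h10 := hc' 10
    simp only [zero_add, Nat.reduceAdd] at *
    omega
  have hsum' : ∀ i, g i + g (i + 1) + g (i + 2) + g (i + 3) + g (i + 4) + g (i + 5) + g (i + 6) +
      g (i + 7) + g (i + 8) + g (i + 9) + g (i + 10) = 5 := by
    intro i
    induction i with
    | zero => simpa using hsum
    | succ i ih =>
      have := hgper i
      simp only [add_assoc, Nat.reduceAdd, add_comm 1] at ih ⊢
      omega
  have hodd_even : ∀ k < 11, (Odd k → g (i + k) = 1) ∧ (Even k → g (i + k) = 0) := by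
    have hs := hsum' i
    have e0 := hgper i
    have h0 := hg1 i
    have h1 := hg1 (i + 1)
    have h2 := hg1 (i + 2)
    have h3 := hg1 (i + 3)
    have h4 := hg1 (i + 4)
    have h5 := hg1 (i + 5)
    have h6 := hg1 (i + 6)
    have h7 := hg1 (i + 7)
    have h8 := hg1 (i + 8)
    simp only [add_assoc, Nat.reduceAdd] at h0 h1 h2 h3 h4 h5 h6 h7 h8
    intro k hk
    interval_cases k <;> refine ⟨fun hk' => ?_, fun hk' => ?_⟩ <;>
      first
        | exact absurd hk' (by decide)
        | omega
        | (rw [add_zero]; omega)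
  refine ⟨K.dir t, (K.dir t ^ i) a, dir_cases t, hor i, hdeg, ?_, ?_⟩
  · intro k
    rw [hpow, hpow]
    exact next_false_true.1 (hin (i + k))
  · intro k hk
    obtain ⟨h1, h2⟩ := hodd_even k hk
    rw [hpow]
    refine ⟨fun hk' => ?_, fun hk' => ?_⟩
    · have := h1 hk'
      simp only [hg] at this
      have hu : ¬ K.Uncoloured ((K.dir t ^ (i + k)) a) := by
        intro hu
        rw [if_pos hu] at this
        omega
      rwa [uncoloured_iff_of_not_outward hn hred hv (hor _) h5 (ho _ (hor _)), not_not] at hu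
    · have := h2 hk'
      simp only [hg] at this
      by_contra hu
      rw [if_neg hu] at this
      omega

end VanKampenDiagram
end Fibonacci

namespace Fibonacci
namespace VanKampenDiagram

open LabelledMap

variable {n : ℕ} {K : VanKampenDiagram n} {t o u : Bool} {a b c d e : K.Dart} {v : K.Vertex}

/-! ### Vertices with one outward and one inward sequence -/

/-- One outward sequence of length `p` and one inward sequence of length `i` in the same orientation.
The labels around the vertex give `2p ≡ i + 1` modulo `n`. The first two and the last two outward
edges are uncoloured, as are about half of the inward ones. With at most six uncoloured edges this
leaves `p = 3`, `i = 5`, or `i = 2` and otherwise yellow outward edges, fewer than `n`. -/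
lemma cases_of_sameOriented (hn : 11 ≤ n) (hred : K.Reduced) (hodd : Odd n)
    (hsph : K.SphericallyReduced) (hv : K.Interior v) (h5 : ¬ K.IsFive v) {p i : ℕ}
    (hs : K.SameOriented v (K.dir t) a p i) (hp : 2 ≤ p) (hi : 2 ≤ i)
    (hmid : K.Spoke ((K.dir t ^ p) a) ((K.dir t ^ (p - 1)) a))
    (hend : K.Spoke ((K.dir t ^ (p + i - 1)) a) a) :
    7 ≤ K.uncolouredDegree v ∨ K.uncolouredDegree v = 6 ∧ (K.IsGG v ∨ K.IsYMinus v) := by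
  have hor := fun k => origin_pow (t := t) hs.base k
  have houts := hs.outs
  have hins := hs.ins
  have hdeg := uncolouredDegree_eq (t := t) hs.base
  rw [hs.deg] at hdeg
  have hall := not_all_yellow (t := t) hodd hn hred hsph hv h5 hs.base
  set f : ℕ → K.Dart := fun k => (K.dir t ^ k) a with hf
  change ∀ k, K.origin (f k) = v at hor
  change ∀ k, k + 1 < p → K.OutNext (f k) (f (k + 1)) at houts
  change ∀ k, p ≤ k → k + 1 < p + i → K.InNext (f k) (f (k + 1)) at hins
  change K.Spoke (f p) (f (p - 1)) at hmid
  change K.Spoke (f (p + i - 1)) (f 0) at hend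
  change (∀ k, k + 1 < n → K.OutNext (f k) (f (k + 1))) →
    (∀ k, 2 ≤ k → k + 4 ≤ n → K.Yellow (f k)) → False at hall
  rw [uncolouredCount_add f (p := 0) (q := p) (by omega) (by omega)] at hdeg
  -- the labels
  have hlab : ((2 * p : ℤ) - i - 1 : ZMod n) = 0 := by
    have h1 := label_of_run (o := true) (u := true) (f := f) (p := 0) (q := p)
      (fun k _ hk => houts k hk) (p - 1) (by omega)
    have h2 := label_of_run (o := false) (u := true) (f := f) (p := p) (q := p + i)
      (fun k h0 hk => next_false_true.2 (hins k h0 hk)) (i - 1) (by omega)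
    have h3 := hmid.2.2.2
    have h4 := hend.2.2.2
    rw [zero_add] at h1
    rw [show p + (i - 1) = p + i - 1 by omega] at h2
    rw [h2] at h4
    rw [h1] at h3
    simp only [shift] at h3 h4
    rw [Nat.cast_sub (by omega)] at h3 h4
    push_cast at h3 h4 ⊢
    linear_combination h3 - h4
  have hdvd : (n : ℤ) ∣ 2 * p - i - 1 := by
    rw [← ZMod.intCast_zmod_eq_zero_iff_dvd]
    push_cast at hlab ⊢
    exact hlab
  have hin := le_uncolouredCount_inward (u := true) hn hred hv h5 f hor (p := p) (q := p + i)
    (by omega) (fun k h0 hk => next_false_true.2 (hins k h0 hk)) hmid hend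
  have u0 : K.Uncoloured (f 0) :=
    uncoloured_of_spoke_outNext hn hred hv h5 (hor 0) hend (houts 0 (by omega))
  have ulast : K.Uncoloured (f (p - 1)) := by
    by_contra hc
    have hb := blue_of_spoke hn hred h5 (hor _) hmid hc
    exact not_inNext_of_blue hn hred hv h5 (hor _) hb hmid (hins p le_rfl (by omega))
  have uin : ∀ k, k = p ∨ k = p + i - 1 → K.Uncoloured (f k) := by
    rintro k (rfl | rfl)
    · exact uncoloured_of_spoke hn hred hv h5 (hor _) hmid
    · exact uncoloured_of_spoke hn hred hv h5 (hor _) hend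
  rcases Nat.lt_or_ge p 3 with hp3 | hp3
  · -- two outward edges
    left
    obtain rfl : p = 2 := by omega
    have h1 : 2 ≤ uncolouredCount f 0 2 := le_uncolouredCount f {0, 1} (by
      intro k hk
      simp only [Finset.mem_insert, Finset.mem_singleton] at hk
      rcases hk with rfl | rfl
      · exact ⟨by omega, by omega, u0⟩
      · exact ⟨by omega, by omega, ulast⟩)
    have hi3 : i ≠ 3 := by
      rintro rfl
      exact h5 ⟨hv, hs.deg⟩
    have : 11 ≤ i := by
      by_contra! hc
      have := Int.eq_zero_of_abs_lt_dvd hdvd (by rw [abs_lt]; constructor <;> push_cast <;> omega)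
      push_cast at this
      omega
    omega
  have hu1 : K.Uncoloured (f 1) := by
    rw [uncoloured_iff_of_outNext hn hred hv h5 (hor 1) (houts 0 (by omega)) (houts 1 (by omega))]
    exact not_yellow_of_consecutive_spoke hn hred h5 (hor 1) (houts 0 (by omega)).1.symm hend
  have hu2 : K.Uncoloured (f (p - 2)) := by
    obtain ⟨p, rfl⟩ : ∃ j, p = j + 3 := ⟨p - 3, by omega⟩
    have h1 : K.OutNext (f (p + 1)) (f (p + 2)) := houts _ (by omega)
    change K.Uncoloured (f (p + 1))
    rw [uncoloured_iff_of_outNext hn hred hv h5 (hor _) (houts _ (by omega)) h1]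
    exact not_yellow_of_consecutive_spoke hn hred h5 (hor _) h1.1 hmid
  rcases Nat.lt_or_ge p 4 with hp4 | hp4
  · obtain rfl : p = 3 := by omega
    have h1 : 3 ≤ uncolouredCount f 0 3 := le_uncolouredCount f {0, 1, 2} (by
      intro k hk
      simp only [Finset.mem_insert, Finset.mem_singleton] at hk
      rcases hk with rfl | rfl | rfl
      · exact ⟨by omega, by omega, u0⟩
      · exact ⟨by omega, by omega, hu1⟩
      · exact ⟨by omega, by omega, ulast⟩)
    by_cases h7 : 7 ≤ K.uncolouredDegree v
    · exact Or.inl h7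
    obtain rfl : i = 5 := by
      by_contra hc
      have := Int.eq_zero_of_abs_lt_dvd hdvd (by rw [abs_lt]; constructor <;> push_cast <;> omega)
      push_cast at this
      omega
    refine Or.inr ⟨by omega, Or.inl ?_⟩
    have u3 := uin 3 (Or.inl rfl)
    have u7 := uin 7 (Or.inr rfl)
    have hno : ∀ k, 3 ≤ k → k + 1 < 3 + 5 → ¬ K.Outward (f k) := fun k h0 hk => (hins k h0 hk).2.1
    have hor45 := uncoloured_or_uncoloured hn hred hv h5 (hor 4) (hins 4 (by omega) (by omega))
    have hor56 := uncoloured_or_uncoloured hn hred hv h5 (hor 5) (hins 5 (by omega) (by omega))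
    have hthree : ∀ x, (x = 4 ∨ x = 5 ∨ x = 6) → K.Uncoloured (f x) →
        ∀ y, (y = 4 ∨ y = 5 ∨ y = 6) → K.Uncoloured (f y) → y = x := by
      intro x hx hux y hy huy
      have hcard : ({3, x, 7} : Finset ℕ).card = 3 := by
        rcases hx with rfl | rfl | rfl <;> rfl
      have := mem_of_uncolouredCount_le f (p := 3) (q := 3 + 5) {3, x, 7} (by
        intro k hk
        simp only [Finset.mem_insert, Finset.mem_singleton] at hk
        rcases hk with rfl | rfl | rfl
        · exact ⟨by omega, by omega, u3⟩
        · exact ⟨by omega, by omega, hux⟩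
        · exact ⟨by omega, by omega, u7⟩) (by omega) (k := y) (by omega) (by omega) huy
      simp only [Finset.mem_insert, Finset.mem_singleton] at this
      omega
    have u5 : K.Uncoloured (f 5) := by
      by_contra hc
      have h4 : K.Uncoloured (f 4) := by tauto
      have h6 : K.Uncoloured (f 6) := by tauto
      have := hthree 4 (by omega) h4 6 (by omega) h6
      omega
    have n4 : ¬ K.Uncoloured (f 4) := fun h => by
      have := hthree 5 (by omega) u5 4 (by omega) h
      omega
    have n6 : ¬ K.Uncoloured (f 6) := fun h => by
      have := hthree 5 (by omega) u5 6 (by omega) h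
      omega
    rw [uncoloured_iff_of_not_outward hn hred hv (hor _) h5 (hno _ (by omega) (by omega)),
      not_not] at n4 n6
    refine ⟨K.dir t, a, hs, n4, n6, ?_⟩
    intro k hk h4 h6
    interval_cases k
    · exact u0
    · exact hu1
    · exact ulast
    · exact u3
    · exact absurd rfl h4
    · exact u5
    · exact absurd rfl h6
    · exact u7
  · have hS : ∀ k ∈ ({0, 1, p - 2, p - 1} : Finset ℕ), 0 ≤ k ∧ k < p ∧ K.Uncoloured (f k) := by
      intro k hk
      simp only [Finset.mem_insert, Finset.mem_singleton] at hk
      rcases hk with rfl | rfl | rfl | rfl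
      · exact ⟨by omega, by omega, u0⟩
      · exact ⟨by omega, by omega, hu1⟩
      · exact ⟨by omega, by omega, hu2⟩
      · exact ⟨by omega, by omega, ulast⟩
    have hScard : ({0, 1, p - 2, p - 1} : Finset ℕ).card = 4 := by
      rw [Finset.card_insert_of_notMem, Finset.card_insert_of_notMem,
        Finset.card_insert_of_notMem, Finset.card_singleton] <;>
        simp only [Finset.mem_insert, Finset.mem_singleton] <;> omega
    have h4 := le_uncolouredCount f _ hS
    rw [hScard] at h4
    by_cases h7 : 7 ≤ K.uncolouredDegree v
    · exact Or.inl h7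
    have hyel : ∀ k, 2 ≤ k → k + 3 ≤ p → K.Yellow (f k) := by
      intro k h2 h3
      by_contra hy
      obtain ⟨k, rfl⟩ : ∃ j, k = j + 1 := ⟨k - 1, by omega⟩
      have hu := (uncoloured_iff_of_outNext hn hred hv h5 (hor (k + 1)) (houts k (by omega))
        (houts (k + 1) (by omega))).2 hy
      have := mem_of_uncolouredCount_le f _ hS (by rw [hScard]; omega) (by omega) (by omega) hu
      simp only [Finset.mem_insert, Finset.mem_singleton] at this
      omega
    have hpn : p < n := by
      by_contra! hc
      exact hall (fun k hk => houts k (by omega)) (fun k h2 hk => hyel k h2 (by omega))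
    have hi2 : i = 2 ∧ 2 * p = n + 3 := by
      obtain ⟨c, hc⟩ := hdvd
      obtain ⟨m, hm⟩ := hodd
      have hc1 : 0 < c := by
        by_contra! h0
        have : (n : ℤ) * c ≤ 0 := mul_nonpos_of_nonneg_of_nonpos (by omega) h0
        omega
      have hc2 : c < 2 := by
        by_contra! h0
        have : (n : ℤ) * 2 ≤ n * c := mul_le_mul_of_nonneg_left h0 (by omega)
        omega
      obtain rfl : c = 1 := by omega
      omega
    obtain ⟨rfl, hpn2⟩ := hi2
    refine Or.inr ⟨by omega, Or.inr ⟨K.dir t, a, p, hpn2, hs, hyel, ?_⟩⟩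
    intro k hk hk'
    rcases Nat.lt_or_ge k p with h | h
    · exact (hS k (by
        simp only [Finset.mem_insert, Finset.mem_singleton]
        omega)).2.2
    · exact uin k (by omega)

/-- One outward sequence of length `p` and one inward sequence of length `i` in opposite orientation.
The labels around the vertex give `2p + i ≡ 3` modulo `n`. Four outward edges are uncoloured when
there are at least five: the first two, the last but one, and the last or, if that is blue, the third
last. With at most six uncoloured edges this leaves `i = 2` and otherwise yellow outward edges, fewer
than `n`. -/
lemma cases_of_oppOriented (hn : 11 ≤ n) (hred : K.Reduced) (hodd : Odd n)
    (hsph : K.SphericallyReduced) (hv : K.Interior v) (h5 : ¬ K.IsFive v) {p i : ℕ}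
    (hs : K.OppOriented v (K.dir t) a p i) (hp : 2 ≤ p) (hi : 2 ≤ i)
    (hmid : K.Spoke ((K.dir t ^ p) a) ((K.dir t ^ (p - 1)) a))
    (hend : K.Spoke ((K.dir t ^ (p + i - 1)) a) a) :
    7 ≤ K.uncolouredDegree v ∨ K.uncolouredDegree v = 6 ∧ (K.IsYB v ∨ K.IsYPlus v) := by
  have hor := fun k => origin_pow (t := t) hs.base k
  have houts := hs.outs
  have hins := hs.ins
  have hdeg := uncolouredDegree_eq (t := t) hs.base
  rw [hs.deg] at hdeg
  have hall := not_all_yellow (t := t) hodd hn hred hsph hv h5 hs.base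
  set f : ℕ → K.Dart := fun k => (K.dir t ^ k) a with hf
  change ∀ k, K.origin (f k) = v at hor
  change ∀ k, k + 1 < p → K.OutNext (f k) (f (k + 1)) at houts
  change ∀ k, p ≤ k → k + 1 < p + i → K.InNext (f (k + 1)) (f k) at hins
  change K.Spoke (f p) (f (p - 1)) at hmid
  change K.Spoke (f (p + i - 1)) (f 0) at hend
  change (∀ k, k + 1 < n → K.OutNext (f k) (f (k + 1))) →
    (∀ k, 2 ≤ k → k + 4 ≤ n → K.Yellow (f k)) → False at hall
  rw [uncolouredCount_add f (p := 0) (q := p) (by omega) (by omega)] at hdeg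
  -- the labels
  have hlab : ((2 * p : ℤ) + i - 3 : ZMod n) = 0 := by
    have h1 := label_of_run (o := true) (u := true) (f := f) (p := 0) (q := p)
      (fun k _ hk => houts k hk) (p - 1) (by omega)
    have h2 := label_of_run (o := false) (u := false) (f := f) (p := p) (q := p + i)
      (fun k h0 hk => next_false_false.2 (hins k h0 hk)) (i - 1) (by omega)
    have h3 := hmid.2.2.2
    have h4 := hend.2.2.2
    rw [zero_add] at h1
    rw [show p + (i - 1) = p + i - 1 by omega] at h2
    rw [h2] at h4
    rw [h1] at h3
    simp only [shift] at h3 h4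
    rw [Nat.cast_sub (by omega)] at h3 h4
    push_cast at h3 h4 ⊢
    linear_combination h3 - h4
  have hdvd : (n : ℤ) ∣ 2 * p + i - 3 := by
    rw [← ZMod.intCast_zmod_eq_zero_iff_dvd]
    push_cast at hlab ⊢
    exact hlab
  have hlarge : n + 3 ≤ 2 * p + i := by
    have := Int.le_of_dvd (by omega) hdvd
    omega
  have hin := le_uncolouredCount_inward (u := false) hn hred hv h5 f hor (p := p) (q := p + i)
    (by omega) (fun k h0 hk => next_false_false.2 (hins k h0 hk)) hmid hend
  have u0 : K.Uncoloured (f 0) :=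
    uncoloured_of_spoke_outNext hn hred hv h5 (hor 0) hend (houts 0 (by omega))
  have uin : ∀ k, k = p ∨ k = p + i - 1 → K.Uncoloured (f k) := by
    rintro k (rfl | rfl)
    · exact uncoloured_of_spoke hn hred hv h5 (hor _) hmid
    · exact uncoloured_of_spoke hn hred hv h5 (hor _) hend
  have h1 : 1 ≤ uncolouredCount f 0 p := le_uncolouredCount f {0} (by simp [u0]; omega)
  rcases Nat.lt_or_ge p 3 with hp3 | hp3
  · left; omega
  have hu1 : K.Uncoloured (f 1) := by
    rw [uncoloured_iff_of_outNext hn hred hv h5 (hor 1) (houts 0 (by omega)) (houts 1 (by omega))]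
    exact not_yellow_of_consecutive_spoke hn hred h5 (hor 1) (houts 0 (by omega)).1.symm hend
  have h2 : 2 ≤ uncolouredCount f 0 p := le_uncolouredCount f {0, 1} (by
    intro k hk
    simp only [Finset.mem_insert, Finset.mem_singleton] at hk
    rcases hk with rfl | rfl
    · exact ⟨by omega, by omega, u0⟩
    · exact ⟨by omega, by omega, hu1⟩)
  rcases Nat.lt_or_ge p 4 with hp4 | hp4
  · left; omega
  have hu2 : K.Uncoloured (f (p - 2)) := by
    obtain ⟨p, rfl⟩ : ∃ j, p = j + 3 := ⟨p - 3, by omega⟩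
    have h1 : K.OutNext (f (p + 1)) (f (p + 2)) := houts _ (by omega)
    change K.Uncoloured (f (p + 1))
    rw [uncoloured_iff_of_outNext hn hred hv h5 (hor _) (houts _ (by omega)) h1]
    exact not_yellow_of_consecutive_spoke hn hred h5 (hor _) h1.1 hmid
  have h3 : ({0, 1, p - 2} : Finset ℕ).card ≤ uncolouredCount f 0 p := le_uncolouredCount f _ (by
    intro k hk
    simp only [Finset.mem_insert, Finset.mem_singleton] at hk
    rcases hk with rfl | rfl | rfl
    · exact ⟨by omega, by omega, u0⟩
    · exact ⟨by omega, by omega, hu1⟩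
    · exact ⟨by omega, by omega, hu2⟩)
  rcases Nat.lt_or_ge p 5 with hp5 | hp5
  · left
    obtain rfl : p = 4 := by omega
    have : ({0, 1, 4 - 2} : Finset ℕ).card = 3 := rfl
    omega
  -- the fourth uncoloured outward edge is the last one, or the third last one if that is blue
  obtain ⟨x, hx, hux, hxb⟩ : ∃ x, (x = p - 1 ∨ x = p - 3) ∧ K.Uncoloured (f x) ∧
      (x = p - 3 → K.Blue (f (p - 1))) := by
    by_cases hu : K.Uncoloured (f (p - 1))
    · exact ⟨p - 1, Or.inl rfl, hu, fun h => by omega⟩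
    · have hb := blue_of_spoke hn hred h5 (hor _) hmid hu
      refine ⟨p - 3, Or.inr rfl, ?_, fun _ => hb⟩
      obtain ⟨p, rfl⟩ : ∃ j, p = j + 4 := ⟨p - 4, by omega⟩
      change K.Uncoloured (f (p + 1))
      have e1 : K.OutNext (f (p + 1)) (f (p + 2)) := houts _ (by omega)
      have e2 : K.OutNext (f (p + 2)) (f (p + 3)) := houts _ (by omega)
      rw [uncoloured_iff_of_outNext hn hred hv h5 (hor _) (houts _ (by omega)) e1,
        yellow_iff (hor _) h5]
      exact not_yellowAt_of_blueAt hn hred ((blue_iff (hor _) h5).1 hb) e1 e2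
  have hS : ∀ k ∈ ({0, 1, p - 2, x} : Finset ℕ), 0 ≤ k ∧ k < p ∧ K.Uncoloured (f k) := by
    intro k hk
    simp only [Finset.mem_insert, Finset.mem_singleton] at hk
    rcases hk with rfl | rfl | rfl | rfl
    · exact ⟨by omega, by omega, u0⟩
    · exact ⟨by omega, by omega, hu1⟩
    · exact ⟨by omega, by omega, hu2⟩
    · exact ⟨by omega, by omega, hux⟩
  have hScard : ({0, 1, p - 2, x} : Finset ℕ).card = 4 := by
    rw [Finset.card_insert_of_notMem, Finset.card_insert_of_notMem,
      Finset.card_insert_of_notMem, Finset.card_singleton] <;>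
      simp only [Finset.mem_insert, Finset.mem_singleton] <;> omega
  have h4 := le_uncolouredCount f _ hS
  rw [hScard] at h4
  by_cases h7 : 7 ≤ K.uncolouredDegree v
  · exact Or.inl h7
  have hyel : ∀ k, 2 ≤ k → k + 3 ≤ p → k ≠ x → K.Yellow (f k) := by
    intro k h2 h3 hkx
    by_contra hy
    obtain ⟨k, rfl⟩ : ∃ j, k = j + 1 := ⟨k - 1, by omega⟩
    have hu := (uncoloured_iff_of_outNext hn hred hv h5 (hor (k + 1)) (houts k (by omega))
      (houts (k + 1) (by omega))).2 hy
    have := mem_of_uncolouredCount_le f _ hS (by rw [hScard]; omega) (by omega) (by omega) hu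
    simp only [Finset.mem_insert, Finset.mem_singleton] at this
    omega
  have hpn : p < n := by
    by_contra! hc
    exact hall (fun k hk => houts k (by omega)) (fun k h2 hk => hyel k h2 (by omega) (by omega))
  have hi2 : i = 2 ∧ 2 * p = n + 1 := by
    obtain ⟨c, hc⟩ := hdvd
    obtain ⟨m, hm⟩ := hodd
    have hc1 : 0 < c := by
      by_contra! h0
      have : (n : ℤ) * c ≤ 0 := mul_nonpos_of_nonneg_of_nonpos (by omega) h0
      omega
    have hc2 : c < 2 := by
      by_contra! h0
      have : (n : ℤ) * 2 ≤ n * c := mul_le_mul_of_nonneg_left h0 (by omega)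
      omega
    obtain rfl : c = 1 := by omega
    omega
  obtain ⟨rfl, hpn2⟩ := hi2
  refine Or.inr ⟨by omega, ?_⟩
  rcases hx with rfl | rfl
  · refine Or.inr ⟨K.dir t, a, p, hpn2, hs, fun k h2 h3 => hyel k h2 h3 (by omega), ?_⟩
    intro k hk hk'
    rcases Nat.lt_or_ge k p with h | h
    · exact (hS k (by
        simp only [Finset.mem_insert, Finset.mem_singleton]
        omega)).2.2
    · exact uin k (by omega)
  · refine Or.inl ⟨K.dir t, a, p, hpn2, hs, fun k h2 h3 => hyel k h2 (by omega) (by omega),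
      hxb rfl, ?_⟩
    intro k hk hk'
    rcases Nat.lt_or_ge k p with h | h
    · exact (hS k (by
        simp only [Finset.mem_insert, Finset.mem_singleton]
        omega)).2.2
    · exact uin k (by omega)

end VanKampenDiagram
end Fibonacci

namespace Fibonacci
namespace VanKampenDiagram

open LabelledMap

variable {n : ℕ} {K : VanKampenDiagram n} {t o u : Bool} {a b c d e : K.Dart} {v : K.Vertex}

/-! ### Vertices with several outward and inward sequences -/

/-- An outward sequence has an uncoloured edge, and two if it has at least three edges. If only one
of two edges is uncoloured, the last one is blue. -/
lemma uncolouredCount_outward (hn : 11 ≤ n) (hred : K.Reduced) (hv : K.Interior v)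
    (h5 : ¬ K.IsFive v) (f : ℕ → K.Dart) (hf : ∀ k, K.origin (f k) = v) {p q : ℕ} (hpq : p + 2 ≤ q)
    (hrun : ∀ k, p ≤ k → k + 1 < q → K.Next true u (f k) (f (k + 1)))
    (hp : K.Spoke d (f p)) (hq : K.Spoke e (f (q - 1))) :
    2 ≤ uncolouredCount f p q ∨ 1 ≤ uncolouredCount f p q ∧ q = p + 2 ∧
      K.Blue (f (bif u then q - 1 else p)) := by
  have h0 := hrun p le_rfl (by omega)
  have h1 := hrun (q - 2) (by omega) (by omega)
  rw [show q - 2 + 1 = q - 1 by omega] at h1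
  have hfirst : K.Uncoloured (f (bif u then p else q - 1)) := by
    cases u
    · exact uncoloured_of_spoke_outNext hn hred hv h5 (hf _) hq (next_true_false.1 h1)
    · exact uncoloured_of_spoke_outNext hn hred hv h5 (hf _) hp h0
  have hone : 1 ≤ uncolouredCount f p q :=
    le_uncolouredCount f {bif u then p else q - 1} (by
      intro k hk
      rw [Finset.mem_singleton] at hk
      rw [hk]
      refine ⟨?_, ?_, hfirst⟩ <;> cases u <;> simp <;> omega)
  by_cases h2 : 2 ≤ uncolouredCount f p q
  · exact Or.inl h2
  have htwo : ∀ x y, x ≠ y → p ≤ x → x < q → p ≤ y → y < q → K.Uncoloured (f x) →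
      ¬ K.Uncoloured (f y) := by
    intro x y hxy hx hx' hy hy' hux huy
    have := le_uncolouredCount f (p := p) (q := q) {x, y} (by
      intro k hk
      simp only [Finset.mem_insert, Finset.mem_singleton] at hk
      rcases hk with rfl | rfl
      · exact ⟨hx, hx', hux⟩
      · exact ⟨hy, hy', huy⟩)
    rw [Finset.card_pair hxy] at this
    omega
  refine Or.inr ⟨hone, ?_, ?_⟩
  · by_contra hlen
    have h3 := hrun (p + 1) (by omega) (by omega)
    have hsecond : K.Uncoloured (f (p + 1)) := by
      have hy := not_yellow_of_consecutive_spoke hn hred h5 (hf (p + 1)) h0.1.symm hp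
      cases u
      · exact (uncoloured_iff_of_outNext hn hred hv h5 (hf _) (next_true_false.1 h3)
          (next_true_false.1 h0)).2 hy
      · exact (uncoloured_iff_of_outNext hn hred hv h5 (hf _) h0 h3).2 hy
    cases u
    · exact htwo (p + 1) (q - 1) (by omega) (by omega) (by omega) (by omega) (by omega) hsecond
        hfirst
    · exact htwo (p + 1) p (by omega) (by omega) (by omega) (by omega) (by omega) hsecond hfirst
  · cases u
    · exact blue_of_spoke hn hred h5 (hf _) hp
        (htwo (q - 1) p (by omega) (by omega) (by omega) (by omega) (by omega) hfirst)
    · exact blue_of_spoke hn hred h5 (hf _) hq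
        (htwo p (q - 1) (by omega) (by omega) (by omega) (by omega) (by omega) hfirst)

/-- A vertex with outward and inward edges. An inward sequence has at least two uncoloured edges, an
outward one at least one. Hence three outward and three inward sequences have more than six, and two
of each kind have six only if both outward sequences consist of an uncoloured edge and a blue one.
Then the label shifts around the vertex add up to a number from 4 to 8, which is not zero
modulo `n`. -/
lemma cases_of_mixed (hodd : Odd n) (hn : 11 ≤ n) (hred : K.Reduced)
    (hsph : K.SphericallyReduced) (hv : K.Interior v) (h5 : ¬ K.IsFive v)
    (hb : K.origin b = v) (hbo : K.Outward b) (hc : K.origin c = v) (hci : ¬ K.Outward c) :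
    7 ≤ K.uncolouredDegree v ∨ K.uncolouredDegree v = 6 ∧
      (K.IsGG v ∨ K.IsYB v ∨ K.IsYPlus v ∨ K.IsYMinus v) := by
  obtain ⟨t, a, ha, h0, hlast, h01⟩ := exists_start hn hred hv hb hbo hc hci
  have hor := fun k => origin_pow (t := t) ha k
  have hcr := fun k => (corner_pow (t := t) hv ha k).consecutive
  have hper := fun k => pow_add_degree (t := t) ha k
  have hdeg := uncolouredDegree_eq (t := t) ha
  have hrun := fun o u p q => next_of_run (t := t) (o := o) (u := u) (p := p) (q := q) hn hred hv ha
  have htwo := fun k => outward_iff_of_outward_ne (k := k) (t := t) hn hred hv ha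
  have hLpos := degree_pos v
  have hsame := fun p i =>
    cases_of_sameOriented (t := t) (a := a) (p := p) (i := i) hn hred hodd hsph hv h5
  have hopp := fun p i =>
    cases_of_oppOriented (t := t) (a := a) (p := p) (i := i) hn hred hodd hsph hv h5
  have hdir := dir_cases (M := K.toLabelledMap) t
  set L := K.degree v with hL
  clear_value L
  set f : ℕ → K.Dart := fun k => (K.dir t ^ k) a with hf
  change ∀ k, K.origin (f k) = v at hor
  change ∀ k, K.Consecutive (f k) (f (k + 1)) at hcr
  change ∀ k, f (k + L) = f k at hper
  change K.Outward (f 0) at h0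
  change ¬ K.Outward (f (L - 1)) at hlast
  change K.OutNext (f 0) (f 1) at h01
  change ∀ o u p q, (∀ k, p ≤ k → k < q → (K.letter (f k)).2 = o) →
    K.Next o u (f p) (f (p + 1)) → ∀ {k}, p ≤ k → k + 1 < q → K.Next o u (f k) (f (k + 1)) at hrun
  change ∀ k, (K.Outward (f k) ↔ ¬ K.Outward (f (k + 1))) →
    (K.Outward (f (k + 2)) ↔ K.Outward (f (k + 1))) at htwo
  have hfL : f L = f 0 := by have := hper 0; rwa [zero_add] at this
  have hend : K.Spoke (f (L - 1)) (f 0) := by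
    have := hcr (L - 1)
    rw [Nat.sub_add_cancel hLpos, hfL] at this
    exact spoke_of_consecutive this hlast h0
  -- the runs, with their directions
  have outRun : ∀ p q, p + 2 ≤ q → (∀ k, p ≤ k → k < q → K.Outward (f k)) →
      ∃ u, ∀ k, p ≤ k → k + 1 < q → K.Next true u (f k) (f (k + 1)) := by
    intro p q hpq h
    obtain ⟨u, hu⟩ := exists_next (hcr p) (h p le_rfl (by omega)) (h (p + 1) (by omega) (by omega))
    exact ⟨u, fun k hk hkq => hrun true u p q (fun k h1 h2 => h k h1 h2) hu hk hkq⟩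
  have inRun : ∀ p q, p + 2 ≤ q → (∀ k, p ≤ k → k < q → ¬ K.Outward (f k)) →
      ∃ u, ∀ k, p ≤ k → k + 1 < q → K.Next false u (f k) (f (k + 1)) := by
    intro p q hpq h
    have h' : ∀ k, p ≤ k → k < q → (K.letter (f k)).2 = false := fun k h1 h2 => by
      simpa [Outward] using h k h1 h2
    obtain ⟨u, hu⟩ := exists_next (hcr p) (h' p le_rfl (by omega)) (h' (p + 1) (by omega) (by omega))
    exact ⟨u, fun k hk hkq => hrun false u p q h' hu hk hkq⟩
  have spokeUp : ∀ p, 0 < p → ¬ K.Outward (f (p - 1)) → K.Outward (f p) →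
      K.Spoke (f (p - 1)) (f p) := by
    intro p hp h1 h2
    have := hcr (p - 1)
    rw [Nat.sub_add_cancel hp] at this
    exact spoke_of_consecutive this h1 h2
  have spokeDown : ∀ p, 0 < p → K.Outward (f (p - 1)) → ¬ K.Outward (f p) →
      K.Spoke (f p) (f (p - 1)) := by
    intro p hp h1 h2
    have := hcr (p - 1)
    rw [Nat.sub_add_cancel hp] at this
    exact spoke_of_consecutive this.symm h2 h1
  have long : ∀ p, 0 < p → (K.Outward (f (p - 1)) ↔ ¬ K.Outward (f p)) →
      (K.Outward (f (p + 1)) ↔ K.Outward (f p)) := by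
    intro p hp h
    have := htwo (p - 1)
    rw [show p - 1 + 1 = p by omega, show p - 1 + 2 = p + 1 by omega] at this
    exact this h
  -- the first outward and the first inward sequence
  obtain ⟨p₁, hp1, hp1L, hp1i, hout1⟩ := exists_run_end (P := fun k => K.Outward (f k)) (p := 0) h0
    (Nat.zero_le (L - 1)) hlast
  have hp12 : p₁ ≠ 1 := fun h => hp1i (h ▸ h01.2.2.1)
  have up1 : ∀ k, 0 ≤ k → k + 1 < p₁ → K.OutNext (f k) (f (k + 1)) := fun k hk hkp =>
    hrun true true 0 p₁ (fun k h1 h2 => hout1 k h1 h2) h01 hk hkp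
  have s1 := spokeDown p₁ hp1 (hout1 _ (by omega) (by omega)) hp1i
  obtain ⟨p₂, hp2, hp2L, hp2o, hin1⟩ := exists_run_end (P := fun k => ¬ K.Outward (f k)) (p := p₁)
    (m := L) hp1i (by omega) (by rw [hfL]; exact not_not.2 h0)
  rw [not_not] at hp2o
  have hp2' : p₁ + 2 ≤ p₂ := by
    by_contra hlt
    obtain rfl : p₂ = p₁ + 1 := by omega
    have := long p₁ hp1 (iff_of_true (hout1 _ (by omega) (by omega)) hp1i)
    exact hp1i (this.1 hp2o)
  obtain ⟨u₁, hu1⟩ := inRun p₁ p₂ hp2' hin1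
  by_cases hone : p₂ = L
  · -- one outward and one inward sequence
    rw [hone] at hu1
    cases u₁
    · have := hopp p₁ (L - p₁) ⟨hdir, ha, by omega, fun k hk => up1 k (by omega) hk,
        fun k hk hkL => next_false_false.1 (hu1 k hk (by omega))⟩ (by omega) (by omega) s1
        (by rw [show p₁ + (L - p₁) - 1 = L - 1 by omega]; exact hend)
      tauto
    · have := hsame p₁ (L - p₁) ⟨hdir, ha, by omega, fun k hk => up1 k (by omega) hk,
        fun k hk hkL => next_false_true.1 (hu1 k hk (by omega))⟩ (by omega) (by omega) s1
        (by rw [show p₁ + (L - p₁) - 1 = L - 1 by omega]; exact hend)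
      tauto
  left
  have hp2lt : p₂ < L := lt_of_le_of_ne hp2L hone
  -- the second outward and the second inward sequence
  have s2 := spokeUp p₂ (by omega) (hin1 _ (by omega) (by omega)) hp2o
  obtain ⟨p₃, hp3, hp3L, hp3i, hout2⟩ := exists_run_end (P := fun k => K.Outward (f k)) (p := p₂)
    (m := L - 1) hp2o (by omega) hlast
  have hp3' : p₂ + 2 ≤ p₃ := by
    by_contra hlt
    obtain rfl : p₃ = p₂ + 1 := by omega
    have := long p₂ (by omega)
      (iff_of_false (hin1 _ (by omega) (by omega)) (not_not.2 hp2o))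
    exact hp3i (this.2 hp2o)
  obtain ⟨u₂, hu2⟩ := outRun p₂ p₃ hp3' hout2
  have s3 := spokeDown p₃ (by omega) (hout2 _ (by omega) (by omega)) hp3i
  obtain ⟨p₄, hp4, hp4L, hp4o, hin2⟩ := exists_run_end (P := fun k => ¬ K.Outward (f k)) (p := p₃)
    (m := L) hp3i (by omega) (by rw [hfL]; exact not_not.2 h0)
  rw [not_not] at hp4o
  have hp4' : p₃ + 2 ≤ p₄ := by
    by_contra hlt
    obtain rfl : p₄ = p₃ + 1 := by omega
    have := long p₃ (by omega) (iff_of_true (hout2 _ (by omega) (by omega)) hp3i)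
    exact hp3i (this.1 hp4o)
  obtain ⟨u₃, hu3⟩ := inRun p₃ p₄ hp4' hin2
  have s4 := spokeUp p₄ (by omega) (hin2 _ (by omega) (by omega)) hp4o
  -- the uncoloured edges of the four sequences
  have c1 := uncolouredCount_outward (u := true) hn hred hv h5 f hor (p := 0) (q := p₁) (by omega)
    up1 hend s1
  have c2 := le_uncolouredCount_inward hn hred hv h5 f hor hp2' hu1 s1 s2
  have c3 := uncolouredCount_outward hn hred hv h5 f hor hp3' hu2 s2 s3
  have c4 := le_uncolouredCount_inward hn hred hv h5 f hor hp4' hu3 s3 s4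
  have a1 := uncolouredCount_add f (p := 0) (q := p₁) (r := L) (by omega) (by omega)
  have a2 := uncolouredCount_add f (p := p₁) (q := p₂) (r := L) (by omega) (by omega)
  have a3 := uncolouredCount_add f (p := p₂) (q := p₃) (r := L) (by omega) (by omega)
  have a4 := uncolouredCount_add f (p := p₃) (q := p₄) (r := L) (by omega) (by omega)
  by_cases htwoPairs : p₄ = L
  · by_contra! hlt
    rw [htwoPairs] at hu3 hp4' c4 a4
    rcases c1 with c1 | ⟨c1, hq1, b1⟩
    · omega
    rcases c3 with c3 | ⟨c3, hq3, b3⟩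
    · omega
    have hlen1 : p₂ ≤ p₁ + 3 := by omega
    have hlen2 : L ≤ p₃ + 3 := by omega
    -- both outward sequences end with a blue edge, so all sequences turn the same way
    have hu1' : u₁ = false := by
      by_contra hc'
      rw [Bool.not_eq_false] at hc'
      subst hc'
      exact not_inNext_of_blue hn hred hv h5 (hor _) b1 s1
        (next_false_true.1 (hu1 p₁ le_rfl (by omega)))
    subst hu1'
    have hu2' : u₂ = true := by
      by_contra hc'
      rw [Bool.not_eq_true] at hc'
      subst hc'
      have h6 := hu1 (p₂ - 2) (by omega) (by omega)
      rw [show p₂ - 2 + 1 = p₂ - 1 by omega] at h6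
      exact not_inNext_of_blue hn hred hv h5 (hor _) b3 s2 (next_false_false.1 h6)
    subst hu2'
    have hu3' : u₃ = false := by
      by_contra hc'
      rw [Bool.not_eq_false] at hc'
      subst hc'
      exact not_inNext_of_blue hn hred hv h5 (hor _) b3 s3
        (next_false_true.1 (hu3 p₃ le_rfl (by omega)))
    subst hu3'
    have l1 := label_of_run (o := true) (u := true) (f := f) up1 (p₁ - 1) (by omega)
    have l2 := label_of_run hu1 (p₂ - p₁ - 1) (by omega)
    have l3 := label_of_run hu2 (p₃ - p₂ - 1) (by omega)
    have l4 := label_of_run hu3 (L - p₃ - 1) (by omega)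
    rw [show 0 + (p₁ - 1) = p₁ - 1 by omega, show p₁ - 1 = 1 by omega] at l1
    rw [show p₁ + (p₂ - p₁ - 1) = p₂ - 1 by omega] at l2
    rw [show p₂ + (p₃ - p₂ - 1) = p₃ - 1 by omega, show p₃ - p₂ - 1 = 1 by omega] at l3
    rw [show p₃ + (L - p₃ - 1) = L - 1 by omega] at l4
    have e1 := s1.2.2.2
    have e2 := s2.2.2.2
    have e3 := s3.2.2.2
    have e4 := hend.2.2.2
    rw [show p₁ - 1 = 1 by omega] at e1
    simp only [shift] at l1 l2 l3 l4
    have key : ((4 + (p₂ - p₁ - 1) + (L - p₃ - 1) : ℕ) : ZMod n) = 0 := by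
      push_cast at l1 l2 l3 l4 ⊢
      linear_combination -l1 - l2 - l3 - l4 + e1 - e2 + e3 - e4
    exact natCast_ne_zero (by omega) (by omega) key
  · -- at least three pairs: the last inward edges give two more
    have hp4lt : p₄ < L := lt_of_le_of_ne hp4L htwoPairs
    obtain ⟨p₅, hp5, hp5L, hp5i, hout3⟩ := exists_run_end (P := fun k => K.Outward (f k)) (p := p₄)
      (m := L - 1) hp4o (by omega) hlast
    have s5 := spokeDown p₅ (by omega) (hout3 _ (by omega) (by omega)) hp5i
    have hp5ne : p₅ ≠ L - 1 := by
      intro h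
      have := long p₅ (by omega) (iff_of_true (hout3 _ (by omega) (by omega)) hp5i)
      rw [show p₅ + 1 = L by omega, hfL] at this
      exact hp5i (this.1 h0)
    have c5 := le_uncolouredCount f (p := p₄) (q := L) {p₅, L - 1} (by
      intro k hk
      simp only [Finset.mem_insert, Finset.mem_singleton] at hk
      rcases hk with rfl | rfl
      · exact ⟨by omega, by omega, uncoloured_of_spoke hn hred hv h5 (hor _) s5⟩
      · exact ⟨by omega, by omega, uncoloured_of_spoke hn hred hv h5 (hor _) hend⟩)
    rw [Finset.card_pair hp5ne] at c5
    omega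

end VanKampenDiagram
end Fibonacci

theorem lemma4 (n : ℕ) (hodd : Odd n) (hn : 11 ≤ n) (K : Fibonacci.VanKampenDiagram n)
    (hred : K.Reduced) (hsph : K.SphericallyReduced)
    (v : K.Vertex) (hv : K.Interior v) :
    K.IsFive v ∨ K.IsDegSeven v ∨
      (K.IsDegSix v ∧ (K.IsGG v ∨ K.IsYB v ∨ K.IsYPlus v ∨ K.IsYMinus v ∨ K.IsFiveG v)) := by
  by_cases h5 : K.IsFive v
  · exact Or.inl h5
  right
  by_cases hout : ∃ b, K.origin b = v ∧ K.Outward b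
  · by_cases hin : ∃ c, K.origin c = v ∧ ¬ K.Outward c
    · obtain ⟨b, hb, hbo⟩ := hout
      obtain ⟨c, hc, hci⟩ := hin
      rcases Fibonacci.VanKampenDiagram.cases_of_mixed hodd hn hred hsph hv h5 hb hbo hc hci with
        h | ⟨h, h'⟩
      · exact Or.inl ⟨hv, h⟩
      · exact Or.inr ⟨⟨hv, h⟩, by tauto⟩
    · push Not at hin
      exact Or.inl ⟨hv, Fibonacci.VanKampenDiagram.seven_le_of_all_outward hodd hn hred hsph hv h5
        hin⟩
  · push Not at hout
    rcases Fibonacci.VanKampenDiagram.of_all_inward hodd hn hred hv h5 hout with h | ⟨h, h'⟩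
    · exact Or.inl ⟨hv, h⟩
    · exact Or.inr ⟨⟨hv, h⟩, by tauto⟩
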